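/- **Conventions.** Let $J=(0,1)$ and $I=[0,1]$. For $k\ge 0$ let $\mathcal C_1(k)$ be the set of $k$-tuples $c=((x_1,y_1),\dots,(x_k,y_k))$ of pairwise disjoint open intervals with $0\le x_j<y_j\le 1$, viewed as a subspace of $\mathrm{Map}(\{1,\dots,k\}\times J,J)$ (compact-open topology) through the linear embeddings $(j,t)\mapsto (y_j-x_j)t+x_j$. With composition of embeddings, identity $(0,1)\in\mathcal C_1(1)$ and permutation of the intervals this is the little 1-cubes operad. A $\mathcal C_1$-algebra is a topological space $X$ with continuous maps $\mathcal C_1(k)\times X^k\to X$, $(c,x)\mapsto c\cdot x$, satisfying the associativity, unit and equivariance axioms. The fundamental 2-groupoid $\Pi_2X$ is the bicategory whose objects are the points of $X$, whose 1-cells $x\to y$ are the paths $I\to X$ from $x$ to $y$ (composed by concatenation), and whose 2-cells are homotopy classes, relative to the boundary, of homotopies between paths with fixed endpoints; its associators and unitors are given by reparametrization. A monoidal bicategory is a bicategory $K$ with pseudofunctors $\otimes:K\times K\to K$ and $e:\mathbf 1\to K$; adjoint equivalences $a:(A\otimes B)\otimes C\to A\otimes(B\otimes C)$, $l:e\otimes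 A\to A$, $r:A\otimes e\to A$ of pseudofunctors (with strong transformations and modifications), where $r^{\bullet}$ is the chosen pseudo-inverse of $r$; and invertible modifications $\pi:(1\otimes a)\circ a\circ(a\otimes 1)\Rightarrow a\circ a$, $\mu:(1\otimes l)\circ a\circ(r^{\bullet}\otimes1)\Rightarrow 1$, $\lambda:l\otimes 1\Rightarrow l\circ a$, $\rho:1\otimes r^{\bullet}\Rightarrow a\circ r^{\bullet}$; subject to the non-abelian 4-cocycle condition and the left and right normalization conditions (equivalently, a tricategory with one object). **Theorem.** Let $X$ be an algebra over the little 1-cubes operad $\mathcal C_1$. Then $\Pi_2X$ has the structure of a monoidal bicategory, which can be chosen as follows. 1. $\otimes$ is the composite $\Pi_2X\times\Pi_2X\cong\Pi_2(X\times X)\to\Pi_2X$, the second map being induced by $(x,y)\mapsto m\cdot(x,y)$ with $m=\big((\tfrac15,\tfrac25),(\tfrac35,\tfrac45)\big)\in\mathcal C_1(2)$. The unit functor is induced by the action of the unique point of $\mathcal C_1(0)$. 2. Let $\alpha$ be the path in $\mathcal C_1(3)$ whose value at $t$ has centers $\big(\tfrac{13+2t}{50},\tfrac{17+16t}{50},\tfrac{35+2t}{50}\big)$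 and lengths $\big(\tfrac{1+4t}{25},\tfrac1{25},\tfrac{5-4t}{25}\big)$; let $\ell$ and $\varrho$ be the straight-line paths in $\mathcal C_1(1)$ from $(\tfrac35,\tfrac45)$, respectively $(\tfrac15,\tfrac25)$, to $(0,1)$. The 1-cell component of $a$ at $(x,y,z)$ is the path $t\mapsto\alpha(t)\cdot(x,y,z)$; the 1-cell components of $l$ and $r$ at $x$ are $t\mapsto \ell(t)\cdot x$ and $t\mapsto\varrho(t)\cdot x$. The components of the pseudo-inverses are given by the reversed paths. The naturality 2-cells of $a$ at paths $(f,g,h)$ are represented by the square $(s,s')\mapsto\alpha(s)\cdot(f(s'),g(s'),h(s'))$, regarded as a homotopy between the two boundary paths from $(0,0)$ to $(1,1)$; the same holds for $l,r$ and for the pseudo-inverses. The units and counits are the images of homotopies, with fixed endpoints, in $\mathcal C_1(3)$ or $\mathcal C_1(1)$ from the constant path to $\gamma\gamma^{-1}$ and from $\gamma^{-1}\gamma$ to the constant path, where $\gamma=\alpha,\ell,\varrho$. 3. The components of $\pi$ at $(x,y,z,w)$, and of $\mu,\lambda,\rho$ at $(x,y)$, are represented by homotopies of the form $(u,t)\mapsto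 H(u,t)\cdot(x,y,z,w)$, respectively $(u,t)\mapsto H(u,t)\cdot(x,y)$, where $H$ is a homotopy between paths with fixed endpoints in $\mathcal C_1(4)$, respectively $\mathcal C_1(2)$, that does not depend on the points. -/

import Mathlib

noncomputable section

section fundamental

universe u

open CategoryTheory Bicategory
open scoped unitInterval

/-- The fundamental 2-groupoid `Π₂X` of a space `X`, as a type synonym carrying a bicategory structure.
Its objects are the points of `X`, its 1-cells are the paths `[0, 1] → X` with the usual (not strictly
associative) concatenation, and its 2-cells are homotopy classes, relative to the boundary, of
homotopies between paths with fixed endpoints. A homotopy with fixed endpoints from `p` to `q` is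
here a path from `p` to `q` in the space `Path x y` of paths with the compact-open topology, and a
homotopy relative to the boundary between two such is a homotopy of paths in `Path x y`. -/
structure Pi2 (X : Type u) where
  pt : X

namespace Pi2

variable {X Y Z : Type u} [TopologicalSpace X] [TopologicalSpace Y] [TopologicalSpace Z]

section cells
variable {A B C : Type u} [TopologicalSpace A] [TopologicalSpace B] [TopologicalSpace C]

/-- The image of a class of paths under a continuous map between path spaces. -/
def mapCell (F : C(A, B)) {a b : A} (η : Path.Homotopic.Quotient a b) :
    Path.Homotopic.Quotient (F a) (F b) := η.map F

theorem mapCell_trans (F : C(A, B)) {a b c : A} (η : Path.Homotopic.Quotient a b)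
    (θ : Path.Homotopic.Quotient b c) :
    mapCell F (η.trans θ) = (mapCell F η).trans (mapCell F θ) := by
  induction η; induction θ
  simp only [mapCell, ← Path.Homotopic.Quotient.mk_trans, ← Path.Homotopic.Quotient.mk_map,
    Path.map_trans]

/-- A homotopy between maps is natural with respect to classes of paths. -/
theorem homotopy_natural (H : C(I × A, B)) {F G : C(A, B)} (hF : ∀ a, H (0, a) = F a)
    (hG : ∀ a, H (1, a) = G a) {a b : A} (η : Path.Homotopic.Quotient a b) :
    (mapCell F η).trans (.mk (x₀ := F b) (x₁ := G b) ⟨⟨fun t => H (t, b), by fun_prop⟩, hF b, hG b⟩) =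
    Path.Homotopic.Quotient.trans (.mk (x₀ := F a) (x₁ := G a) ⟨⟨fun t => H (t, a), by fun_prop⟩, hF a, hG a⟩)
      (mapCell G η) := by
  obtain rfl : F = ⟨fun a => H (0, a), by fun_prop⟩ := by ext a; exact (hF a).symm
  obtain rfl : G = ⟨fun a => H (1, a), by fun_prop⟩ := by ext a; exact (hG a).symm
  have key : ∀ (p : Path a b), Path.Homotopic.Quotient.trans
      (Path.Homotopic.prod (.refl (0 : I)) (.mk p)) (Path.Homotopic.prod (.mk Path.id) (.refl b))
      = Path.Homotopic.Quotient.trans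
      (Path.Homotopic.prod (.mk Path.id) (.refl a)) (Path.Homotopic.prod (.refl 1) (.mk p)) := by
    intro p
    rw [Path.Homotopic.comp_prod_eq_prod_comp, Path.Homotopic.comp_prod_eq_prod_comp]
    simp
  induction η with
  | mk p =>
  have := congrArg (mapCell H) (key p)
  rw [mapCell_trans, mapCell_trans] at this
  exact this

/-- Two classes of paths in different factors commute. -/
theorem map_interchange (F : C(A × B, C)) {a a' : A} {b b' : B}
    (η : Path.Homotopic.Quotient a a') (θ : Path.Homotopic.Quotient b b') :
    (mapCell F (Path.Homotopic.prod (.refl a) θ)).trans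
      (mapCell F (Path.Homotopic.prod η (.refl b'))) =
    (mapCell F (Path.Homotopic.prod η (.refl b))).trans
      (mapCell F (Path.Homotopic.prod (.refl a') θ)) := by
  rw [← mapCell_trans, ← mapCell_trans, Path.Homotopic.comp_prod_eq_prod_comp,
    Path.Homotopic.comp_prod_eq_prod_comp]
  simp
end cells

/-- Reparametrisation of a path along a path in the unit interval from `0` to `1`. -/
def reparam {x y : X} (p : Path x y) (φ : Path (0 : I) 1) : Path x y where
  toFun t := p (φ t)
  source' := by simp
  target' := by simp

theorem continuous_reparam {x y : X} :
    Continuous fun q : Path x y × Path (0 : I) 1 => reparam q.1 q.2 := by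
  rw [← Path.continuous_uncurry_iff]
  change Continuous fun r : (Path x y × Path (0 : I) 1) × I => r.1.1 (r.1.2 r.2)
  fun_prop

/-- The straight line between two reparametrisations. -/
def lineReparam (φ ψ : Path (0 : I) 1) (u : I) : Path (0 : I) 1 where
  toFun t := ⟨(1 - (u : ℝ)) * φ t + u * ψ t, by
    have h1 := (φ t).2; have h2 := (ψ t).2; have h3 := u.2
    constructor
    · have := h1.1; have := h2.1; have := h3.1; have := h3.2
      have : (0 : ℝ) ≤ 1 - u := by linarith
      positivity
    · nlinarith [h1.2, h2.2, h3.1, h3.2]⟩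
  source' := by ext; simp
  target' := by ext; simp
  continuous_toFun := by fun_prop

theorem continuous_lineReparam (φ ψ : Path (0 : I) 1) : Continuous (lineReparam φ ψ) := by
  rw [← Path.continuous_uncurry_iff]
  refine Continuous.subtype_mk ?_ _
  fun_prop

/-- The cell from `p ∘ φ` to `p` given by the straight line from `φ` to the identity. -/
def thinPath (φ : Path (0 : I) 1) {x y : X} (p : Path x y) {q : Path x y} (h : q = reparam p φ) :
    Path q p where
  toFun u := reparam p (lineReparam φ Path.id u)
  source' := by subst h; congr 1; ext t; simp [lineReparam]
  target' := by
    ext t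
    change p _ = p t
    congr 1
    ext
    simp only [lineReparam, Path.coe_mk_mk, Set.Icc.coe_one, sub_self, zero_mul, one_mul, zero_add]
    rfl
  continuous_toFun :=
    continuous_reparam.comp (continuous_const.prodMk (continuous_lineReparam φ Path.id))

theorem thin_natural {A : Type u} [TopologicalSpace A] {x y : X} (φ : Path (0 : I) 1)
    (F G : C(A, Path x y)) (h : ∀ a, F a = reparam (G a) φ) {a b : A}
    (η : Path.Homotopic.Quotient a b) :
    (mapCell F η).trans (.mk (thinPath φ (G b) (h b))) =
      Path.Homotopic.Quotient.trans (.mk (thinPath φ (G a) (h a))) (mapCell G η) := by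
  refine homotopy_natural (H := ⟨fun r => reparam (G r.2) (lineReparam φ Path.id r.1), ?_⟩)
    ?_ ?_ η
  · exact continuous_reparam.comp ((G.continuous.comp continuous_snd).prodMk
      ((continuous_lineReparam φ Path.id).comp continuous_fst))
  · intro a
    exact (thinPath φ (G a) (h a)).source
  · intro a
    exact (thinPath φ (G a) (h a)).target

/-- The reparametrisation carrying `f (g h)` to `(f g) h`. -/
def assocParam : Path (0 : I) 1 where
  toFun t := ⟨Path.Homotopy.transAssocReparamAux t, Path.Homotopy.transAssocReparamAux_mem_I t⟩
  source' := Subtype.ext Path.Homotopy.transAssocReparamAux_zero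
  target' := Subtype.ext Path.Homotopy.transAssocReparamAux_one

/-- The reparametrisation carrying `f` to `1 f`. -/
def leftParam : Path (0 : I) 1 where
  toFun t := Set.projIcc (0 : ℝ) 1 zero_le_one (2 * t - 1)
  source' := by ext; simp
  target' := by ext; norm_num [Set.coe_projIcc]
  continuous_toFun := by fun_prop

/-- The reparametrisation carrying `f` to `f 1`. -/
def rightParam : Path (0 : I) 1 where
  toFun t := Set.projIcc (0 : ℝ) 1 zero_le_one (2 * t)
  source' := by ext; simp
  target' := by ext; norm_num [Set.coe_projIcc]
  continuous_toFun := by fun_prop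

theorem trans_trans_eq {x y z w : X} (f : Path x y) (g : Path y z) (h : Path z w) :
    (f.trans g).trans h = reparam (f.trans (g.trans h)) assocParam := by
  rw [Path.Homotopy.trans_assoc_reparam]; rfl

theorem refl_trans_eq {x y : X} (f : Path x y) :
    (Path.refl x).trans f = reparam f leftParam := by
  ext t
  rw [Path.trans_apply]
  simp only [reparam, leftParam, Path.coe_mk_mk]
  split_ifs with ht
  · rw [Path.refl_apply, Set.projIcc_of_le_left _ (by linarith)]
    exact f.source.symm
  · rw [Set.projIcc_of_mem]

theorem trans_refl_eq {x y : X} (f : Path x y) :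
    f.trans (Path.refl y) = reparam f rightParam := by
  ext t
  rw [Path.trans_apply]
  simp only [reparam, rightParam, Path.coe_mk_mk]
  split_ifs with ht
  · rw [Set.projIcc_of_mem]
  · rw [Path.refl_apply, Set.projIcc_of_right_le _ (by linarith)]
    exact f.target.symm

/-- Composition with a fixed path on the left, as a continuous map of path spaces. -/
def preMap {x y : X} (f : Path x y) (z : X) : C(Path y z, Path x z) :=
  ⟨fun g => f.trans g, by fun_prop⟩

/-- Composition with a fixed path on the right, as a continuous map of path spaces. -/
def postMap (x : X) {y z : X} (g : Path y z) : C(Path x y, Path x z) :=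
  ⟨fun f => f.trans g, by fun_prop⟩

section chain

/-- The line segment in `ℝ`. -/
def seg (a b : ℝ) : Path a b where
  toFun t := (1 - (t : ℝ)) * a + t * b
  source' := by simp
  target' := by simp
  continuous_toFun := by fun_prop

/-- `IsImg P p₀ q₀ c` : the cell `c` is the image under `P` of a cell from `p₀` to `q₀`. -/
def IsImg (P : C(ℝ, X)) {s t : ℝ} (p₀ q₀ : Path s t) {x y : X} {p q : Path x y}
    (c : Path.Homotopic.Quotient p q) : Prop :=
  ∃ (R : Path p₀ q₀) (R' : Path p q), .mk R' = c ∧ ∀ u v, R' u v = P (R u v)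

theorem homotopic_real {s t : ℝ} {p q : Path s t} (R S : Path p q) : R.Homotopic S := by
  let L : I → Path s t → Path s t → Path s t := fun u p q =>
    { toFun := fun v => (1 - (u : ℝ)) * p v + u * q v
      source' := by simp; ring
      target' := by simp; ring
      continuous_toFun := by fun_prop }
  have hL : Continuous fun r : I × I => L r.1 (R r.2) (S r.2) := by
    rw [← Path.continuous_uncurry_iff]
    change Continuous fun r : (I × I) × I =>
      (1 - (r.1.1 : ℝ)) * R r.1.2 r.2 + r.1.1 * S r.1.2 r.2
    fun_prop
  have hLL : ∀ (u : I) (p : Path s t), L u p p = p := by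
    intro u p; ext v; simp only [L, Path.coe_mk_mk]; ring
  refine ⟨{ toFun := fun r => L r.1 (R r.2) (S r.2), continuous_toFun := hL,
            map_zero_left := ?_, map_one_left := ?_, prop' := ?_ }⟩
  · intro v; ext; simp [L]
  · intro v; ext; simp [L]
  · rintro u v (rfl | hv)
    · simp [hLL]
    · obtain rfl : v = 1 := hv
      simp [hLL]

theorem IsImg.unique {P : C(ℝ, X)} {s t : ℝ} {p₀ q₀ : Path s t} {x y : X} {p q : Path x y}
    {c c' : Path.Homotopic.Quotient p q} (h : IsImg P p₀ q₀ c) (h' : IsImg P p₀ q₀ c') :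
    c = c' := by
  obtain ⟨R, R', rfl, hR⟩ := h
  obtain ⟨S, S', rfl, hS⟩ := h'
  obtain rfl : x = P s := by have := hR 0 0; simpa using this
  obtain rfl : y = P t := by have := hR 0 1; simpa using this
  let F : C(Path s t, Path (P s) (P t)) := ⟨fun p => p.map P.continuous, by
    rw [← Path.continuous_uncurry_iff]
    change Continuous fun r : Path s t × I => P (r.1 r.2)
    fun_prop⟩
  obtain rfl : p = F p₀ := by ext v; have := hR 0 v; simpa [F] using this
  obtain rfl : q = F q₀ := by ext v; have := hR 1 v; simpa [F] using this
  have e1 : R' = R.map F.continuous := by ext u v; exact hR u v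
  have e2 : S' = S.map F.continuous := by ext u v; exact hS u v
  rw [e1, e2, Path.Homotopic.Quotient.eq]
  exact (homotopic_real R S).map F

theorem IsImg.trans {P : C(ℝ, X)} {s t : ℝ} {p₀ q₀ r₀ : Path s t} {x y : X} {p q r : Path x y}
    {c : Path.Homotopic.Quotient p q} {d : Path.Homotopic.Quotient q r}
    (h : IsImg P p₀ q₀ c) (h' : IsImg P q₀ r₀ d) : IsImg P p₀ r₀ (c.trans d) := by
  obtain ⟨R, R', rfl, hR⟩ := h
  obtain ⟨S, S', rfl, hS⟩ := h'
  refine ⟨R.trans S, R'.trans S', rfl, fun u v => ?_⟩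
  rw [Path.trans_apply, Path.trans_apply]
  split_ifs <;> simp [hR, hS]

theorem IsImg.post {P : C(ℝ, X)} {s t r : ℝ} {p₀ q₀ : Path s t} {p q : Path (P s) (P t)}
    {c : Path.Homotopic.Quotient p q} (h : IsImg P p₀ q₀ c) (k : Path t r) :
    IsImg P (p₀.trans k) (q₀.trans k) (mapCell (postMap _ (k.map P.continuous)) c) := by
  obtain ⟨R, R', rfl, hR⟩ := h
  refine ⟨R.map (postMap s k).continuous, R'.map (postMap _ (k.map P.continuous)).continuous,
    rfl, fun u v => ?_⟩
  change ((R' u).trans (k.map P.continuous)) v = P (((R u).trans k) v)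
  rw [Path.trans_apply, Path.trans_apply]
  split_ifs <;> simp [hR]

theorem IsImg.pre {P : C(ℝ, X)} {s t r : ℝ} {p₀ q₀ : Path s t} {p q : Path (P s) (P t)}
    {c : Path.Homotopic.Quotient p q} (h : IsImg P p₀ q₀ c) (k : Path r s) :
    IsImg P (k.trans p₀) (k.trans q₀) (mapCell (preMap (k.map P.continuous) _) c) := by
  obtain ⟨R, R', rfl, hR⟩ := h
  refine ⟨R.map (preMap k t).continuous, R'.map (preMap (k.map P.continuous) _).continuous,
    rfl, fun u v => ?_⟩
  change ((k.map P.continuous).trans (R' u)) v = P ((k.trans (R u)) v)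
  rw [Path.trans_apply, Path.trans_apply]
  split_ifs <;> simp [hR]

theorem isImg_thin (P : C(ℝ, X)) (φ : Path (0 : I) 1) {s t : ℝ} {p₀ q₀ : Path s t}
    (h₀ : q₀ = reparam p₀ φ) {x y : X} {p q : Path x y} (h : q = reparam p φ)
    (hp : ∀ v, p v = P (p₀ v)) :
    IsImg P q₀ p₀ (.mk (thinPath φ p h)) :=
  ⟨thinPath φ p₀ h₀, thinPath φ p h, rfl, fun _ _ => hp _⟩

theorem chain_induction {motive : ∀ {a b c d e : X}, Path a b → Path b c → Path c d → Path d e → Prop}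
    (H : ∀ P : C(ℝ, X), motive ((seg 0 1).map P.continuous) ((seg 1 2).map P.continuous)
      ((seg 2 3).map P.continuous) ((seg 3 4).map P.continuous)) {a b c d e : X}
    (f : Path a b) (g : Path b c) (h : Path c d) (k : Path d e) : motive f g h k := by
  let P : C(ℝ, X) := ⟨fun t => if t ≤ 1 then f.extend t else if t ≤ 2 then g.extend (t - 1) else
    if t ≤ 3 then h.extend (t - 2) else k.extend (t - 3), by
    refine Continuous.if_le (by fun_prop) (Continuous.if_le (by fun_prop)
      (Continuous.if_le (by fun_prop) (by fun_prop) (by fun_prop) (by fun_prop) ?_)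
      (by fun_prop) (by fun_prop) ?_) (by fun_prop) (by fun_prop) ?_
    · rintro t rfl; norm_num
    · rintro t rfl; norm_num
    · rintro t rfl; norm_num⟩
  have ha : P 0 = a := by simp [P]
  have hb : P 1 = b := by simp [P]
  have hc : P 2 = c := by norm_num [P]
  have hd : P 3 = d := by norm_num [P]
  have he : P 4 = e := by norm_num [P]
  have hf : ∀ t : I, f t = P (seg 0 1 t) := by
    intro t
    have := t.2.2
    simp [P, seg, this]
  have hg : ∀ t : I, g t = P (seg 1 2 t) := by
    intro t
    have h1 := t.2.1
    have h2 := t.2.2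
    by_cases h0 : (t : ℝ) = 0
    · obtain rfl : t = 0 := Subtype.ext h0
      simp [seg, hb]
    · have h3 : 0 < (t : ℝ) := lt_of_le_of_ne h1 (Ne.symm h0)
      have e : seg 1 2 t = t + 1 := by simp [seg]; ring
      rw [e]
      simp only [P, ContinuousMap.coe_mk]
      rw [if_neg (by linarith), if_pos (by linarith)]; simp
  have hh : ∀ t : I, h t = P (seg 2 3 t) := by
    intro t
    have h1 := t.2.1
    have h2 := t.2.2
    by_cases h0 : (t : ℝ) = 0
    · obtain rfl : t = 0 := Subtype.ext h0
      simp [seg, hc]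
    · have h3 : 0 < (t : ℝ) := lt_of_le_of_ne h1 (Ne.symm h0)
      have e : seg 2 3 t = t + 2 := by simp [seg]; ring
      rw [e]
      simp only [P, ContinuousMap.coe_mk]
      rw [if_neg (by linarith), if_neg (by linarith), if_pos (by linarith)]; simp
  have hk : ∀ t : I, k t = P (seg 3 4 t) := by
    intro t
    have h1 := t.2.1
    have h2 := t.2.2
    by_cases h0 : (t : ℝ) = 0
    · obtain rfl : t = 0 := Subtype.ext h0
      simp [seg, hd]
    · have h3 : 0 < (t : ℝ) := lt_of_le_of_ne h1 (Ne.symm h0)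
      have e : seg 3 4 t = t + 3 := by simp [seg]; ring
      rw [e]
      simp only [P, ContinuousMap.coe_mk]
      rw [if_neg (by linarith), if_neg (by linarith), if_neg (by linarith)]; simp
  clear_value P
  subst ha hb hc hd he
  obtain rfl : f = (seg 0 1).map P.continuous := by ext t; exact hf t
  obtain rfl : g = (seg 1 2).map P.continuous := by ext t; exact hg t
  obtain rfl : h = (seg 2 3).map P.continuous := by ext t; exact hh t
  obtain rfl : k = (seg 3 4).map P.continuous := by ext t; exact hk t
  exact H P

end chain

/-- Paths from `x` to `y` and classes of homotopies between them. -/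
instance homCategory (x y : X) : Category (Path x y) where
  Hom p q := Path.Homotopic.Quotient p q
  id p := .refl p
  comp η θ := η.trans θ
  id_comp _ := by simp
  comp_id _ := by simp
  assoc _ _ _ := by simp

/-- The isomorphism in the hom-category given by a path in the path space. -/
def isoOfPath {x y : X} {p q : Path x y} (R : Path p q) : p ≅ q where
  hom := .mk R
  inv := .mk R.symm
  hom_inv_id := by change (Path.Homotopic.Quotient.mk R).trans (.mk R.symm) = _; simp; rfl
  inv_hom_id := by change (Path.Homotopic.Quotient.mk R.symm).trans (.mk R) = _; simp; rfl

/-- The associator `(f g) h ≅ f (g h)`, given by reparametrisation. -/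
def assocIso {x y z w : X} (f : Path x y) (g : Path y z) (h : Path z w) :
    (f.trans g).trans h ≅ f.trans (g.trans h) :=
  isoOfPath (thinPath assocParam (f.trans (g.trans h)) (trans_trans_eq f g h))

/-- The left unitor, given by reparametrisation. -/
def leftIso {x y : X} (f : Path x y) : (Path.refl x).trans f ≅ f :=
  isoOfPath (thinPath leftParam f (refl_trans_eq f))

/-- The right unitor, given by reparametrisation. -/
def rightIso {x y : X} (f : Path x y) : f.trans (Path.refl y) ≅ f :=
  isoOfPath (thinPath rightParam f (trans_refl_eq f))

/-- Left whiskering. -/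
def whiskerL {x y z : X} (f : Path x y) {g h : Path y z} (η : g ⟶ h) : f.trans g ⟶ f.trans h :=
  mapCell (preMap f z) η

/-- Right whiskering. -/
def whiskerR {x y z : X} {f g : Path x y} (η : f ⟶ g) (h : Path y z) : f.trans h ⟶ g.trans h :=
  mapCell (postMap x h) η

theorem eq_conj {x y : X} {p p' q q' : Path x y} (e : p ≅ p') (e' : q ≅ q') (c : p ⟶ q)
    (d : p' ⟶ q') (h : c ≫ e'.hom = e.hom ≫ d) : c = e.hom ≫ d ≫ e'.inv := by
  rw [← Category.assoc, Iso.eq_comp_inv, h]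

theorem eq_conj' {x y : X} {p p' q q' : Path x y} (e : p ≅ p') (e' : q ≅ q') (c : p ⟶ q)
    (d : p' ⟶ q') (h : c ≫ e'.hom = e.hom ≫ d) : d = e.inv ≫ c ≫ e'.hom := by
  rw [Iso.eq_inv_comp, h]

theorem mapCell_id {A : Type u} [TopologicalSpace A] {a b : A} (η : Path.Homotopic.Quotient a b) :
    mapCell (.id A) η = η := by
  induction η; rfl

theorem mapCell_comp {A B C : Type u} [TopologicalSpace A] [TopologicalSpace B]
    [TopologicalSpace C] (G : C(B, C)) (F : C(A, B)) {a b : A} (η : Path.Homotopic.Quotient a b) :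
    mapCell (G.comp F) η = mapCell G (mapCell F η) := by
  induction η; rfl

theorem exchange {x y z : X} {f g : Path x y} {h i : Path y z}
    (η : Path.Homotopic.Quotient f g) (θ : Path.Homotopic.Quotient h i) :
    (mapCell (preMap f z) θ).trans (mapCell (postMap x i) η) =
      (mapCell (postMap x h) η).trans (mapCell (preMap g z) θ) := by
  induction η with | mk η =>
  induction θ with | mk θ =>
  exact map_interchange ⟨fun r : Path x y × Path y z => r.1.trans r.2, by fun_prop⟩ (.mk η) (.mk θ)

theorem pentagon {a b c d e : X} (f : Path a b) (g : Path b c) (h : Path c d) (i : Path d e) :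
    whiskerR (assocIso f g h).hom i ≫ (assocIso f (g.trans h) i).hom ≫
      whiskerL f (assocIso g h i).hom =
    (assocIso (f.trans g) h i).hom ≫ (assocIso f g (h.trans i)).hom := by
  refine chain_induction (motive := fun f g h i =>
    whiskerR (assocIso f g h).hom i ≫ (assocIso f (g.trans h) i).hom ≫
      whiskerL f (assocIso g h i).hom =
    (assocIso (f.trans g) h i).hom ≫ (assocIso f g (h.trans i)).hom) (fun P => ?_) f g h i
  let s₁ := seg 0 1
  let s₂ := seg 1 2
  let s₃ := seg 2 3
  let s₄ := seg 3 4
  have e : ∀ {a b c : ℝ} (p : Path a b) (q : Path b c) (v : I),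
      ((p.map P.continuous).trans (q.map P.continuous)) v = P (p.trans q v) := by
    intro a b c p q v; rw [← Path.map_trans]; rfl
  refine IsImg.unique (P := P) (p₀ := ((s₁.trans s₂).trans s₃).trans s₄)
      (q₀ := s₁.trans (s₂.trans (s₃.trans s₄))) ?_ ?_
  · refine IsImg.trans (q₀ := (s₁.trans (s₂.trans s₃)).trans s₄) ?_
      (IsImg.trans (q₀ := s₁.trans ((s₂.trans s₃).trans s₄)) ?_ ?_)
    · refine IsImg.post (isImg_thin P assocParam (trans_trans_eq _ _ _) _ ?_) s₄
      intro v; rw [← Path.map_trans, e]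
    · refine isImg_thin P assocParam (trans_trans_eq _ _ _) _ ?_
      intro v; rw [← Path.map_trans, ← Path.map_trans, e]
    · refine IsImg.pre (isImg_thin P assocParam (trans_trans_eq _ _ _) _ ?_) s₁
      intro v; rw [← Path.map_trans, e]
  · refine IsImg.trans (q₀ := (s₁.trans s₂).trans (s₃.trans s₄)) ?_ ?_
    · refine isImg_thin P assocParam (trans_trans_eq _ _ _) _ ?_
      intro v; rw [← Path.map_trans, ← Path.map_trans, e]
    · refine isImg_thin P assocParam (trans_trans_eq _ _ _) _ ?_
      intro v; rw [← Path.map_trans, ← Path.map_trans, e]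

theorem triangle {a b c : X} (f : Path a b) (g : Path b c) :
    (assocIso f (Path.refl b) g).hom ≫ whiskerL f (leftIso g).hom =
      whiskerR (rightIso f).hom g := by
  refine chain_induction (motive := fun {a b c _ _} (f : Path a b) (g : Path b c) _ _ =>
    (assocIso f (Path.refl b) g).hom ≫ whiskerL f (leftIso g).hom =
      whiskerR (rightIso f).hom g) (fun P => ?_) f g (Path.refl c) (Path.refl c)
  let s₁ := seg 0 1
  let s₂ := seg 1 2
  have e : ∀ {a b c : ℝ} (p : Path a b) (q : Path b c) (v : I),
      ((p.map P.continuous).trans (q.map P.continuous)) v = P (p.trans q v) := by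
    intro a b c p q v; rw [← Path.map_trans]; rfl
  refine IsImg.unique (P := P) (p₀ := (s₁.trans (Path.refl 1)).trans s₂)
      (q₀ := s₁.trans s₂) ?_ ?_
  · refine IsImg.trans (q₀ := s₁.trans ((Path.refl 1).trans s₂)) ?_ ?_
    · refine isImg_thin P assocParam (trans_trans_eq _ _ _) _ ?_
      intro v
      change ((s₁.map P.continuous).trans (((Path.refl (1 : ℝ)).map P.continuous).trans
        (s₂.map P.continuous))) v = _
      rw [← Path.map_trans, e]
    · exact IsImg.pre (isImg_thin P leftParam (refl_trans_eq _) _ fun v => rfl) s₁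
  · exact IsImg.post (isImg_thin P rightParam (trans_refl_eq _) _ fun v => rfl) s₂

/-- The bicategory structure of the fundamental 2-groupoid. -/
instance : Bicategory (Pi2 X) where
  Hom a b := Path a.pt b.pt
  id a := Path.refl a.pt
  comp f g := f.trans g
  homCategory a b := homCategory a.pt b.pt
  whiskerLeft f _ _ η := whiskerL f η
  whiskerRight η h := whiskerR η h
  associator f g h := assocIso f g h
  leftUnitor f := leftIso f
  rightUnitor f := rightIso f
  whiskerLeft_id f g := rfl
  whiskerLeft_comp f _ _ _ η θ := mapCell_trans _ η θ
  id_whiskerLeft {a b f g} η :=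
    eq_conj (leftIso f) (leftIso g) _ _ ((thin_natural leftParam (preMap (Path.refl a.pt) b.pt)
      (.id _) refl_trans_eq η).trans (congrArg _ (mapCell_id η)))
  comp_whiskerLeft {a b c d} f g h h' η :=
    eq_conj (assocIso f g h) (assocIso f g h') _ _ ((thin_natural assocParam
      (preMap (f.trans g) d.pt) ((preMap f _).comp (preMap g d.pt))
      (fun k => trans_trans_eq f g k) η).trans (congrArg _ (mapCell_comp _ _ η)))
  id_whiskerRight _ _ := rfl
  comp_whiskerRight η θ _ := mapCell_trans _ η θ
  whiskerRight_id {a b f g} η :=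
    eq_conj (rightIso f) (rightIso g) _ _ ((thin_natural rightParam
      (postMap a.pt (Path.refl b.pt)) (.id _) trans_refl_eq η).trans (congrArg _ (mapCell_id η)))
  whiskerRight_comp {a b c d f f'} η g h :=
    eq_conj' (assocIso f g h) (assocIso f' g h) _ _ ((congrArg (fun c =>
      Path.Homotopic.Quotient.trans c _) (mapCell_comp (postMap a.pt h) (postMap a.pt g) η)).symm.trans
      (thin_natural assocParam ((postMap a.pt h).comp (postMap a.pt g))
      (postMap a.pt (g.trans h)) (fun k => trans_trans_eq k g h) η))
  whisker_assoc {a b c d} f g g' η h :=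
    eq_conj (assocIso f g h) (assocIso f g' h) _ _ ((congrArg (fun c =>
      Path.Homotopic.Quotient.trans c _) (mapCell_comp (postMap a.pt h) (preMap f c.pt) η)).symm.trans
      ((thin_natural assocParam ((postMap a.pt h).comp (preMap f c.pt))
      ((preMap f d.pt).comp (postMap b.pt h)) (fun k => trans_trans_eq f k h) η).trans
      (congrArg _ (mapCell_comp _ _ η))))
  whisker_exchange η θ := exchange η θ
  pentagon f g h i := pentagon f g h i
  triangle f g := triangle f g

/-- Composition with `F`, as a continuous map of path spaces. -/
def mapPath (F : C(X, Y)) (x y : X) : C(Path x y, Path (F x) (F y)) :=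
  ⟨fun p => p.map F.continuous, by
    rw [← Path.continuous_uncurry_iff]
    change Continuous fun r : Path x y × I => F (r.1 r.2)
    fun_prop⟩

/-- Pairing of paths, as a continuous map of path spaces. -/
def prodPath (x x' : X) (y y' : Y) : C(Path x x' × Path y y', Path (x, y) (x', y')) :=
  ⟨fun p => p.1.prod p.2, by
    rw [← Path.continuous_uncurry_iff]
    change Continuous fun r : (Path x x' × Path y y') × I => (r.1.1 r.2, r.1.2 r.2)
    fun_prop⟩

theorem mk_eq_conj {x y : X} {p p' q q' : Path x y} (h : p = p') (h' : q' = q) (R : Path p q)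
    (R' : Path p' q') (hR : ∀ u v, R u v = R' u v) :
    (show p ⟶ q from .mk R) = eqToHom h ≫ (show p' ⟶ q' from .mk R') ≫ eqToHom h' := by
  subst h h'
  obtain rfl : R = R' := by ext u v; exact hR u v
  simp

theorem map_trans_apply (F : C(X, Y)) {x y z : X} (f : Path x y) (g : Path y z) (v : I) :
    F (f.trans g v) = ((mapPath F x y f).trans (mapPath F y z g)) v :=
  congrArg (fun p : Path (F x) (F z) => p v) (Path.map_trans f g F.continuous)

theorem mk_eq_conj' {x y : X} {p p' q : Path x y} (h : p = p') (R : Path p q)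
    (R' : Path p' q) (hR : ∀ u v, R u v = R' u v) :
    (show p ⟶ q from .mk R) = eqToHom h ≫ (show p' ⟶ q from .mk R') := by
  rw [mk_eq_conj h rfl R R' hR]; simp

/-- The strict pseudofunctor `Π₂X ⥤ Π₂Y` induced by a continuous map. -/
def map (F : C(X, Y)) : StrictPseudofunctor (Pi2 X) (Pi2 Y) := .mk'
  { obj a := ⟨F a.pt⟩
    map f := mapPath F _ _ f
    map₂ η := mapCell (mapPath F _ _) η
    map₂_id _ := rfl
    map₂_comp η θ := mapCell_trans _ η θ
    map_id _ := rfl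
    map_comp f g := Path.map_trans f g F.continuous
    map₂_whisker_left f g g' η := by
      induction η using Path.Homotopic.Quotient.ind with | mk R =>
      exact mk_eq_conj _ _ _ (R.map ((preMap _ _).comp (mapPath F _ _)).continuous)
        fun u v => map_trans_apply F _ _ v
    map₂_whisker_right η g := by
      induction η using Path.Homotopic.Quotient.ind with | mk R =>
      exact mk_eq_conj _ _ _ (R.map ((postMap _ _).comp (mapPath F _ _)).continuous)
        fun u v => map_trans_apply F _ _ v
    map₂_left_unitor f := by
      exact mk_eq_conj' _ ((thinPath leftParam f (refl_trans_eq f)).map (mapPath F _ _).continuous)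
        (thinPath leftParam _ (refl_trans_eq _)) fun u v => rfl
    map₂_right_unitor f := by
      exact mk_eq_conj' _ ((thinPath rightParam f (trans_refl_eq f)).map (mapPath F _ _).continuous)
        (thinPath rightParam _ (trans_refl_eq _)) fun u v => rfl
    map₂_associator f g h := by
      refine mk_eq_conj _ _ _ (thinPath assocParam _ (trans_trans_eq _ _ _)) fun u v => ?_
      refine (map_trans_apply F _ _ _).trans ?_
      exact congrArg (fun p : Path _ _ => ((mapPath F _ _ f).trans p) (lineReparam assocParam Path.id u v))
        (Path.map_trans g h F.continuous) }

theorem prodPath_trans {x x' x'' : X} {y y' y'' : Y} (f : Path x x') (f' : Path x' x'')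
    (g : Path y y') (g' : Path y' y'') :
    prodPath x x'' y y'' (f.trans f', g.trans g') =
      (prodPath x x' y y' (f, g)).trans (prodPath x' x'' y' y'' (f', g')) :=
  (Path.trans_prod_eq_prod_trans f f' g g').symm

/-- The pairing of classes of homotopies. -/
def prodCell {x x' : X} {y y' : Y} {f f' : Path x x'} {g g' : Path y y'}
    (η : f ⟶ f') (θ : g ⟶ g') :
    prodPath x x' y y' (f, g) ⟶ prodPath x x' y y' (f', g') :=
  mapCell (prodPath x x' y y') (Path.Homotopic.prod η θ)

theorem prodCell_comp {x x' : X} {y y' : Y} {f f' f'' : Path x x'} {g g' g'' : Path y y'}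
    (η : f ⟶ f') (η' : f' ⟶ f'') (θ : g ⟶ g') (θ' : g' ⟶ g'') :
    prodCell (η ≫ η') (θ ≫ θ') = prodCell η θ ≫ prodCell η' θ' :=
  (congrArg (mapCell (prodPath x x' y y'))
    (Path.Homotopic.comp_prod_eq_prod_comp η θ η' θ')).symm.trans (mapCell_trans _ _ _)

/-- The strict pseudofunctor `Π₂X × Π₂Y ⥤ Π₂(X × Y)`. -/
def prodComparison (X Y : Type u) [TopologicalSpace X] [TopologicalSpace Y] :
    StrictPseudofunctor (Pi2 X × Pi2 Y) (Pi2 (X × Y)) := .mk'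
  { obj a := ⟨(a.1.pt, a.2.pt)⟩
    map f := prodPath _ _ _ _ (f.1, f.2)
    map₂ η := prodCell η.1 η.2
    map₂_id _ := rfl
    map₂_comp η θ := prodCell_comp η.1 θ.1 η.2 θ.2
    map_id _ := rfl
    map_comp f g := prodPath_trans f.1 g.1 f.2 g.2
    map₂_whisker_left f g g' η := by
      obtain ⟨η₁, η₂⟩ := η
      induction η₁ using Path.Homotopic.Quotient.ind with | mk R =>
      induction η₂ using Path.Homotopic.Quotient.ind with | mk S =>
      exact mk_eq_conj _ _ _ ((R.prod S).map ((preMap _ _).comp (prodPath _ _ _ _)).continuous)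
        fun u v => congrArg (fun p : Path _ _ => p v) (prodPath_trans f.1 (R u) f.2 (S u))
    map₂_whisker_right η g := by
      obtain ⟨η₁, η₂⟩ := η
      induction η₁ using Path.Homotopic.Quotient.ind with | mk R =>
      induction η₂ using Path.Homotopic.Quotient.ind with | mk S =>
      exact mk_eq_conj _ _ _ ((R.prod S).map ((postMap _ _).comp (prodPath _ _ _ _)).continuous)
        fun u v => congrArg (fun p : Path _ _ => p v) (prodPath_trans (R u) g.1 (S u) g.2)
    map₂_left_unitor f := by
      exact mk_eq_conj' _ (((thinPath leftParam f.1 (refl_trans_eq f.1)).prod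
        (thinPath leftParam f.2 (refl_trans_eq f.2))).map (prodPath _ _ _ _).continuous)
        (thinPath leftParam _ (refl_trans_eq _)) fun u v => rfl
    map₂_right_unitor f := by
      exact mk_eq_conj' _ (((thinPath rightParam f.1 (trans_refl_eq f.1)).prod
        (thinPath rightParam f.2 (trans_refl_eq f.2))).map (prodPath _ _ _ _).continuous)
        (thinPath rightParam _ (trans_refl_eq _)) fun u v => rfl
    map₂_associator f g h := by
      refine mk_eq_conj _ _ _ (thinPath assocParam _ (trans_trans_eq _ _ _)) fun u v => ?_
      refine (congrArg (fun p : Path _ _ => p (lineReparam assocParam Path.id u v))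
        (prodPath_trans f.1 _ f.2 _)).trans ?_
      exact congrArg (fun p : Path _ _ => ((prodPath _ _ _ _ (f.1, f.2)).trans p)
        (lineReparam assocParam Path.id u v)) (prodPath_trans g.1 h.1 g.2 h.2) }

end Pi2

end fundamental

section monoidal

universe w₁ w₂ w₃ w₄ v₁ v₂ v₃ v₄ u₁ u₂ u₃ u₄ w v u

open CategoryTheory Bicategory
open scoped Pseudofunctor.StrongTrans

/-- The product of two pseudofunctors. -/
def prodPseudofunctor {A : Type u₁} [Bicategory.{w₁, v₁} A] {B : Type u₂} [Bicategory.{w₂, v₂} B]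
    {C : Type u₃} [Bicategory.{w₃, v₃} C] {D : Type u₄} [Bicategory.{w₄, v₄} D]
    (F : A ⥤ᵖ B) (G : C ⥤ᵖ D) : (A × C) ⥤ᵖ (B × D) where
  obj a := (F.obj a.1, G.obj a.2)
  map f := (F.map f.1, G.map f.2)
  map₂ η := (F.map₂ η.1, G.map₂ η.2)
  map₂_id f := Prod.ext (F.map₂_id f.1) (G.map₂_id f.2)
  map₂_comp η θ := Prod.ext (F.map₂_comp η.1 θ.1) (G.map₂_comp η.2 θ.2)
  mapId a := Iso.prod (F.mapId a.1) (G.mapId a.2)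
  mapComp f g := Iso.prod (F.mapComp f.1 g.1) (G.mapComp f.2 g.2)
  map₂_whisker_left f _ _ η :=
    Prod.ext (F.map₂_whisker_left f.1 η.1) (G.map₂_whisker_left f.2 η.2)
  map₂_whisker_right η f :=
    Prod.ext (F.map₂_whisker_right η.1 f.1) (G.map₂_whisker_right η.2 f.2)
  map₂_associator f g h :=
    Prod.ext (F.map₂_associator f.1 g.1 h.1) (G.map₂_associator f.2 g.2 h.2)
  map₂_left_unitor f := Prod.ext (F.map₂_left_unitor f.1) (G.map₂_left_unitor f.2)
  map₂_right_unitor f := Prod.ext (F.map₂_right_unitor f.1) (G.map₂_right_unitor f.2)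

/-- The rebracketing `(A × B) × C ⥤ A × (B × C)`. -/
def prodAssocPseudofunctor (A : Type u₁) [Bicategory.{w₁, v₁} A] (B : Type u₂)
    [Bicategory.{w₂, v₂} B] (C : Type u₃) [Bicategory.{w₃, v₃} C] :
    ((A × B) × C) ⥤ᵖ (A × (B × C)) where
  obj a := (a.1.1, (a.1.2, a.2))
  map f := (f.1.1, (f.1.2, f.2))
  map₂ η := (η.1.1, (η.1.2, η.2))
  mapId _ := Iso.refl _
  mapComp _ _ := Iso.refl _
  map₂_id _ := rfl
  map₂_comp _ _ := rfl
  map₂_whisker_left _ _ _ _ := by refine Prod.ext ?_ (Prod.ext ?_ ?_) <;> simp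
  map₂_whisker_right _ _ := by refine Prod.ext ?_ (Prod.ext ?_ ?_) <;> simp
  map₂_associator _ _ _ := by refine Prod.ext ?_ (Prod.ext ?_ ?_) <;> simp
  map₂_left_unitor _ := by refine Prod.ext ?_ (Prod.ext ?_ ?_) <;> simp
  map₂_right_unitor _ := by refine Prod.ext ?_ (Prod.ext ?_ ?_) <;> simp

/-- The terminal bicategory: one object, one 1-cell, one 2-cell. -/
abbrev PointBicategory : Type := LocallyDiscrete (Discrete PUnit.{1})

/-- The object of the terminal bicategory. -/
abbrev PointBicategory.star : PointBicategory := ⟨⟨PUnit.unit⟩⟩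

/-- Pasting of two squares along a common side. -/
def pasteSq {K : Type u} [Bicategory.{w, v} K] {a b c a' b' c' : K} {f : a ⟶ a'} {g : b ⟶ b'}
    {h : c ⟶ c'} {p : a ⟶ b} {p' : a' ⟶ b'} {q : b ⟶ c} {q' : b' ⟶ c'}
    (s : f ≫ p' ≅ p ≫ g) (t : g ≫ q' ≅ q ≫ h) : f ≫ (p' ≫ q') ≅ (p ≫ q) ≫ h :=
  (α_ f p' q').symm ≪≫ whiskerRightIso s q' ≪≫ α_ p g q' ≪≫ whiskerLeftIso p t ≪≫ (α_ p q h).symm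

/-- The identity square on `f`. -/
def idSq {K : Type u} [Bicategory.{w, v} K] {a b : K} (f : a ⟶ b) : f ≫ 𝟙 b ≅ 𝟙 a ≫ f :=
  ρ_ f ≪≫ (λ_ f).symm

/-- The functors and adjoint equivalences of a monoidal bicategory `K`: the tensor product `⊗`, the
unit functor from the terminal bicategory, and adjoint equivalences `a : ⊗ ∘ (⊗ × 1) ⇒ ⊗ ∘ (1 × ⊗)`,
`l : ⊗ ∘ (unit × 1) ⇒ 1` and `r : ⊗ ∘ (1 × unit) ⇒ 1` in bicategories of pseudofunctors, strong
transformations and modifications. -/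
structure MonoidalBicategoryData (K : Type u) [Bicategory.{w, v} K] where
  tensor : (K × K) ⥤ᵖ K
  unit : PointBicategory ⥤ᵖ K
  assoc : ((prodPseudofunctor tensor (Pseudofunctor.id K)).comp tensor) ≌
    ((prodAssocPseudofunctor K K K).comp
      ((prodPseudofunctor (Pseudofunctor.id K) tensor).comp tensor))
  leftUnit : ((prodPseudofunctor unit (Pseudofunctor.id K)).comp tensor) ≌
    (Bicategory.Prod.snd PointBicategory K).toPseudofunctor
  rightUnit : ((prodPseudofunctor (Pseudofunctor.id K) unit).comp tensor) ≌
    (Bicategory.Prod.fst K PointBicategory).toPseudofunctor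

namespace MonoidalBicategoryData

variable {K : Type u} [Bicategory.{w, v} K] (M : MonoidalBicategoryData K)

/-- The tensor product of objects. -/
def tO (A B : K) : K := M.tensor.obj (A, B)

/-- The tensor product of 1-cells. -/
def tH {A A' B B' : K} (f : A ⟶ A') (g : B ⟶ B') : M.tO A B ⟶ M.tO A' B' :=
  M.tensor.map (X := (A, B)) (Y := (A', B')) (f, g)

/-- The tensor product of invertible 2-cells. -/
def tI {A A' B B' : K} {f f' : A ⟶ A'} {g g' : B ⟶ B'} (η : f ≅ f') (θ : g ≅ g') :
    M.tH f g ≅ M.tH f' g' :=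
  M.tensor.map₂Iso (a := (A, B)) (b := (A', B')) (f := (f, g)) (g := (f', g')) (Iso.prod η θ)

/-- The constraint `(f ≫ f') ⊗ (g ≫ g') ≅ (f ⊗ g) ≫ (f' ⊗ g')`. -/
def tComp {A A' A₂ B B' B₂ : K} (f : A ⟶ A') (f' : A' ⟶ A₂) (g : B ⟶ B') (g' : B' ⟶ B₂) :
    M.tH (f ≫ f') (g ≫ g') ≅ M.tH f g ≫ M.tH f' g' :=
  M.tensor.mapComp (a := (A, B)) (b := (A', B')) (c := (A₂, B₂)) (f, g) (f', g')

/-- The constraint `1 ⊗ 1 ≅ 1`. -/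
def tId (A B : K) : M.tH (𝟙 A) (𝟙 B) ≅ 𝟙 (M.tO A B) := M.tensor.mapId (A, B)

/-- The unit object. -/
def e : K := M.unit.obj PointBicategory.star

/-- The value of the unit functor on the identity 1-cell. -/
def eH : M.e ⟶ M.e := M.unit.map (𝟙 PointBicategory.star)

/-- The 1-cell `a : (A ⊗ B) ⊗ C ⟶ A ⊗ (B ⊗ C)`. -/
def a (A B C : K) : M.tO (M.tO A B) C ⟶ M.tO A (M.tO B C) := M.assoc.hom.app ((A, B), C)

/-- The naturality 2-cell of `a`. -/
def aSq {A A' B B' C C' : K} (f : A ⟶ A') (g : B ⟶ B') (h : C ⟶ C') :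
    M.tH (M.tH f g) h ≫ M.a A' B' C' ≅ M.a A B C ≫ M.tH f (M.tH g h) :=
  M.assoc.hom.naturality (a := ((A, B), C)) (b := ((A', B'), C')) ((f, g), h)

/-- The 1-cell `l : e ⊗ A ⟶ A`. -/
def l (A : K) : M.tO M.e A ⟶ A := M.leftUnit.hom.app (PointBicategory.star, A)

/-- The naturality 2-cell of `l`. -/
def lSq {A A' : K} (f : A ⟶ A') : M.tH M.eH f ≫ M.l A' ≅ M.l A ≫ f :=
  M.leftUnit.hom.naturality (a := (PointBicategory.star, A)) (b := (PointBicategory.star, A'))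
    (𝟙 PointBicategory.star, f)

/-- The 1-cell `r' : A ⟶ A ⊗ e` pseudo-inverse to `r : A ⊗ e ⟶ A`. -/
def r' (A : K) : A ⟶ M.tO A M.e := M.rightUnit.inv.app (A, PointBicategory.star)

/-- The naturality 2-cell of `r'`. -/
def rSq' {A A' : K} (f : A ⟶ A') : f ≫ M.r' A' ≅ M.r' A ≫ M.tH f M.eH :=
  M.rightUnit.inv.naturality (a := (A, PointBicategory.star)) (b := (A', PointBicategory.star))
    (f, 𝟙 PointBicategory.star)

/-- `(f ≫ g) ⊗ 1 ≅ (f ⊗ 1) ≫ (g ⊗ 1)` -/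
def tR {A A' A₂ : K} (f : A ⟶ A') (g : A' ⟶ A₂) (B : K) :
    M.tH (f ≫ g) (𝟙 B) ≅ M.tH f (𝟙 B) ≫ M.tH g (𝟙 B) :=
  M.tI (Iso.refl (f ≫ g)) (λ_ (𝟙 B)).symm ≪≫ M.tComp f g (𝟙 B) (𝟙 B)

/-- `1 ⊗ (f ≫ g) ≅ (1 ⊗ f) ≫ (1 ⊗ g)` -/
def tL (B : K) {A A' A₂ : K} (f : A ⟶ A') (g : A' ⟶ A₂) :
    M.tH (𝟙 B) (f ≫ g) ≅ M.tH (𝟙 B) f ≫ M.tH (𝟙 B) g :=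
  M.tI (λ_ (𝟙 B)).symm (Iso.refl (f ≫ g)) ≪≫ M.tComp (𝟙 B) (𝟙 B) f g

/-- `(f ≫ g ≫ h) ⊗ 1 ≅ (f ⊗ 1) ≫ (g ⊗ 1) ≫ (h ⊗ 1)` -/
def tR₃ {A A' A₂ A₃ : K} (f : A ⟶ A') (g : A' ⟶ A₂) (h : A₂ ⟶ A₃) (B : K) :
    M.tH (f ≫ g ≫ h) (𝟙 B) ≅ M.tH f (𝟙 B) ≫ M.tH g (𝟙 B) ≫ M.tH h (𝟙 B) :=
  M.tR f (g ≫ h) B ≪≫ whiskerLeftIso (M.tH f (𝟙 B)) (M.tR g h B)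

/-- `1 ⊗ (f ≫ g ≫ h) ≅ (1 ⊗ f) ≫ (1 ⊗ g) ≫ (1 ⊗ h)` -/
def tL₃ (B : K) {A A' A₂ A₃ : K} (f : A ⟶ A') (g : A' ⟶ A₂) (h : A₂ ⟶ A₃) :
    M.tH (𝟙 B) (f ≫ g ≫ h) ≅ M.tH (𝟙 B) f ≫ M.tH (𝟙 B) g ≫ M.tH (𝟙 B) h :=
  M.tL B f (g ≫ h) ≪≫ whiskerLeftIso (M.tH (𝟙 B) f) (M.tL B g h)

/-- The tensor product of two squares. -/
def tSq {A A' B B' C C' D D' : K} {f : A ⟶ B} {q : B ⟶ D} {p : A ⟶ C} {g : C ⟶ D}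
    {f' : A' ⟶ B'} {q' : B' ⟶ D'} {p' : A' ⟶ C'} {g' : C' ⟶ D'}
    (s : f ≫ q ≅ p ≫ g) (s' : f' ≫ q' ≅ p' ≫ g') :
    M.tH f f' ≫ M.tH q q' ≅ M.tH p p' ≫ M.tH g g' :=
  (M.tComp f q f' q').symm ≪≫ M.tI s s' ≪≫ M.tComp p g p' g'

/-- Naturality of `a` in its first variable: `((f ⊗ 1) ⊗ 1) ≫ a ≅ a ≫ (f ⊗ 1)`. -/
def aSq₁ {A A' : K} (f : A ⟶ A') (B C : K) :
    M.tH (M.tH f (𝟙 B)) (𝟙 C) ≫ M.a A' B C ≅ M.a A B C ≫ M.tH f (𝟙 (M.tO B C)) :=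
  M.aSq f (𝟙 B) (𝟙 C) ≪≫ whiskerLeftIso (M.a A B C) (M.tI (Iso.refl f) (M.tId B C))

/-- Naturality of `a` in its second variable: `((1 ⊗ f) ⊗ 1) ≫ a ≅ a ≫ (1 ⊗ (f ⊗ 1))`. -/
def aSq₂ (A : K) {B B' : K} (f : B ⟶ B') (C : K) :
    M.tH (M.tH (𝟙 A) f) (𝟙 C) ≫ M.a A B' C ≅ M.a A B C ≫ M.tH (𝟙 A) (M.tH f (𝟙 C)) :=
  M.aSq (𝟙 A) f (𝟙 C)

/-- Naturality of `a` in its third variable: `(1 ⊗ f) ≫ a ≅ a ≫ (1 ⊗ (1 ⊗ f))`. -/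
def aSq₃ (A B : K) {C C' : K} (f : C ⟶ C') :
    M.tH (𝟙 (M.tO A B)) f ≫ M.a A B C' ≅ M.a A B C ≫ M.tH (𝟙 A) (M.tH (𝟙 B) f) :=
  whiskerRightIso (M.tI (M.tId A B).symm (Iso.refl f)) (M.a A B C') ≪≫ M.aSq (𝟙 A) (𝟙 B) f

end MonoidalBicategoryData

/-- The invertible modifications `π`, `μ`, `λ`, `ρ` of a monoidal bicategory, given by their
components and the modification axiom with respect to 1-cells, subject to the non-abelian 4-cocycle
condition and the left and right normalization conditions. Here `⊗≫` is vertical composition of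
2-cells with the evident associators and unitors of the bicategory inserted. -/
structure MonoidalBicategoryCoherence {K : Type u} [Bicategory.{w, v} K]
    (M : MonoidalBicategoryData K) where
  pi (A B C D : K) :
    M.tH (M.a A B C) (𝟙 D) ≫ M.a A (M.tO B C) D ≫ M.tH (𝟙 A) (M.a B C D) ≅
      M.a (M.tO A B) C D ≫ M.a A B (M.tO C D)
  pi_naturality {A A' B B' C C' D D' : K} (f : A ⟶ A') (g : B ⟶ B') (h : C ⟶ C') (k : D ⟶ D') :
    M.tH (M.tH (M.tH f g) h) k ◁ (pi A' B' C' D').hom ≫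
        (pasteSq (M.aSq (M.tH f g) h k) (M.aSq f g (M.tH h k))).hom =
      (pasteSq (M.tSq (M.aSq f g h) (idSq k))
        (pasteSq (M.aSq f (M.tH g h) k) (M.tSq (idSq f) (M.aSq g h k)))).hom ≫
        (pi A B C D).hom ▷ M.tH f (M.tH g (M.tH h k))
  mu (A B : K) :
    M.tH (M.r' A) (𝟙 B) ≫ M.a A M.e B ≫ M.tH (𝟙 A) (M.l B) ≅ 𝟙 (M.tO A B)
  mu_naturality {A A' B B' : K} (f : A ⟶ A') (g : B ⟶ B') :
    M.tH f g ◁ (mu A' B').hom ≫ (idSq (M.tH f g)).hom =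
      (pasteSq (M.tSq (M.rSq' f) (idSq g))
        (pasteSq (M.aSq f M.eH g) (M.tSq (idSq f) (M.lSq g)))).hom ≫
        (mu A B).hom ▷ M.tH f g
  lam (A B : K) : M.tH (M.l A) (𝟙 B) ≅ M.a M.e A B ≫ M.l (M.tO A B)
  lam_naturality {A A' B B' : K} (f : A ⟶ A') (g : B ⟶ B') :
    M.tH (M.tH M.eH f) g ◁ (lam A' B').hom ≫
        (pasteSq (M.aSq M.eH f g) (M.lSq (M.tH f g))).hom =
      (M.tSq (M.lSq f) (idSq g)).hom ≫ (lam A B).hom ▷ M.tH f g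
  rho (A B : K) : M.tH (𝟙 A) (M.r' B) ≅ M.r' (M.tO A B) ≫ M.a A B M.e
  rho_naturality {A A' B B' : K} (f : A ⟶ A') (g : B ⟶ B') :
    M.tH f g ◁ (rho A' B').hom ≫ (pasteSq (M.rSq' (M.tH f g)) (M.aSq f g M.eH)).hom =
      (M.tSq (idSq f) (M.rSq' g)).hom ≫ (rho A B).hom ▷ M.tH f (M.tH g M.eH)
  cocycle (A B C D E : K) :
    𝟙 (M.tH (M.tH (M.a A B C) (𝟙 D)) (𝟙 E) ≫ M.tH (M.a A (M.tO B C) D) (𝟙 E) ≫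
        M.tH (M.tH (𝟙 A) (M.a B C D)) (𝟙 E) ≫ M.a A (M.tO B (M.tO C D)) E ≫
        M.tH (𝟙 A) (M.a B (M.tO C D) E) ≫ M.tH (𝟙 A) (M.tH (𝟙 B) (M.a C D E))) ⊗≫
      ((M.tR₃ _ _ _ E).symm ≪≫ M.tI (pi A B C D) (Iso.refl (𝟙 E)) ≪≫ M.tR _ _ E).hom ▷
        (M.a A (M.tO B (M.tO C D)) E ≫ M.tH (𝟙 A) (M.a B (M.tO C D) E) ≫
          M.tH (𝟙 A) (M.tH (𝟙 B) (M.a C D E))) ⊗≫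
      M.tH (M.a (M.tO A B) C D) (𝟙 E) ◁ (pi A B (M.tO C D) E).hom ▷
        M.tH (𝟙 A) (M.tH (𝟙 B) (M.a C D E)) ⊗≫
      (M.tH (M.a (M.tO A B) C D) (𝟙 E) ≫ M.a (M.tO A B) (M.tO C D) E) ◁
        (M.aSq₃ A B (M.a C D E)).inv ⊗≫
      (pi (M.tO A B) C D E).hom ▷ M.a A B (M.tO C (M.tO D E)) ⊗≫
      𝟙 (M.a (M.tO (M.tO A B) C) D E ≫ M.a (M.tO A B) C (M.tO D E) ≫
        M.a A B (M.tO C (M.tO D E))) =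
    𝟙 (M.tH (M.tH (M.a A B C) (𝟙 D)) (𝟙 E) ≫ M.tH (M.a A (M.tO B C) D) (𝟙 E) ≫
        M.tH (M.tH (𝟙 A) (M.a B C D)) (𝟙 E) ≫ M.a A (M.tO B (M.tO C D)) E ≫
        M.tH (𝟙 A) (M.a B (M.tO C D) E) ≫ M.tH (𝟙 A) (M.tH (𝟙 B) (M.a C D E))) ⊗≫
      (M.tH (M.tH (M.a A B C) (𝟙 D)) (𝟙 E) ≫ M.tH (M.a A (M.tO B C) D) (𝟙 E)) ◁
        (M.aSq₂ A (M.a B C D) E).hom ▷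
        (M.tH (𝟙 A) (M.a B (M.tO C D) E) ≫ M.tH (𝟙 A) (M.tH (𝟙 B) (M.a C D E))) ⊗≫
      (M.tH (M.tH (M.a A B C) (𝟙 D)) (𝟙 E) ≫ M.tH (M.a A (M.tO B C) D) (𝟙 E) ≫
        M.a A (M.tO (M.tO B C) D) E) ◁
        ((M.tL₃ A _ _ _).symm ≪≫ M.tI (Iso.refl (𝟙 A)) (pi B C D E) ≪≫ M.tL A _ _).hom ⊗≫
      M.tH (M.tH (M.a A B C) (𝟙 D)) (𝟙 E) ◁ (pi A (M.tO B C) D E).hom ▷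
        M.tH (𝟙 A) (M.a B C (M.tO D E)) ⊗≫
      (M.aSq₁ (M.a A B C) D E).hom ▷
        (M.a A (M.tO B C) (M.tO D E) ≫ M.tH (𝟙 A) (M.a B C (M.tO D E))) ⊗≫
      M.a (M.tO (M.tO A B) C) D E ◁ (pi A B C (M.tO D E)).hom ⊗≫
      𝟙 (M.a (M.tO (M.tO A B) C) D E ≫ M.a (M.tO A B) C (M.tO D E) ≫
        M.a A B (M.tO C (M.tO D E)))
  left_normalization (A B C : K) :
    𝟙 (M.tH (M.tH (M.r' A) (𝟙 B)) (𝟙 C) ≫ M.tH (M.a A M.e B) (𝟙 C) ≫ M.a A (M.tO M.e B) C ≫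
        M.tH (𝟙 A) (M.tH (M.l B) (𝟙 C))) ⊗≫
      (M.tH (M.tH (M.r' A) (𝟙 B)) (𝟙 C) ≫ M.tH (M.a A M.e B) (𝟙 C)) ◁
        (M.aSq₂ A (M.l B) C).inv ⊗≫
      ((M.tR₃ _ _ _ C).symm ≪≫ M.tI (mu A B) (Iso.refl (𝟙 C)) ≪≫ M.tId (M.tO A B) C).hom ▷
        M.a A B C ⊗≫
      𝟙 (M.a A B C) =
    𝟙 (M.tH (M.tH (M.r' A) (𝟙 B)) (𝟙 C) ≫ M.tH (M.a A M.e B) (𝟙 C) ≫ M.a A (M.tO M.e B) C ≫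
        M.tH (𝟙 A) (M.tH (M.l B) (𝟙 C))) ⊗≫
      (M.tH (M.tH (M.r' A) (𝟙 B)) (𝟙 C) ≫ M.tH (M.a A M.e B) (𝟙 C) ≫ M.a A (M.tO M.e B) C) ◁
        (M.tI (Iso.refl (𝟙 A)) (lam B C) ≪≫ M.tL A _ _).hom ⊗≫
      M.tH (M.tH (M.r' A) (𝟙 B)) (𝟙 C) ◁ (pi A M.e B C).hom ▷ M.tH (𝟙 A) (M.l (M.tO B C)) ⊗≫
      (M.aSq₁ (M.r' A) B C).hom ▷ (M.a A M.e (M.tO B C) ≫ M.tH (𝟙 A) (M.l (M.tO B C))) ⊗≫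
      M.a A B C ◁ (mu A (M.tO B C)).hom ⊗≫
      𝟙 (M.a A B C)
  right_normalization (A B C : K) :
    𝟙 (M.tH (M.tH (𝟙 A) (M.r' B)) (𝟙 C) ≫ M.a A (M.tO B M.e) C ≫ M.tH (𝟙 A) (M.a B M.e C) ≫
        M.tH (𝟙 A) (M.tH (𝟙 B) (M.l C))) ⊗≫
      (M.aSq₂ A (M.r' B) C).hom ▷
        (M.tH (𝟙 A) (M.a B M.e C) ≫ M.tH (𝟙 A) (M.tH (𝟙 B) (M.l C))) ⊗≫
      M.a A B C ◁
        ((M.tL₃ A _ _ _).symm ≪≫ M.tI (Iso.refl (𝟙 A)) (mu B C) ≪≫ M.tId A (M.tO B C)).hom ⊗≫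
      𝟙 (M.a A B C) =
    𝟙 (M.tH (M.tH (𝟙 A) (M.r' B)) (𝟙 C) ≫ M.a A (M.tO B M.e) C ≫ M.tH (𝟙 A) (M.a B M.e C) ≫
        M.tH (𝟙 A) (M.tH (𝟙 B) (M.l C))) ⊗≫
      (M.tI (rho A B) (Iso.refl (𝟙 C)) ≪≫ M.tR _ _ C).hom ▷
        (M.a A (M.tO B M.e) C ≫ M.tH (𝟙 A) (M.a B M.e C) ≫ M.tH (𝟙 A) (M.tH (𝟙 B) (M.l C))) ⊗≫
      M.tH (M.r' (M.tO A B)) (𝟙 C) ◁ (pi A B M.e C).hom ▷ M.tH (𝟙 A) (M.tH (𝟙 B) (M.l C)) ⊗≫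
      (M.tH (M.r' (M.tO A B)) (𝟙 C) ≫ M.a (M.tO A B) M.e C) ◁ (M.aSq₃ A B (M.l C)).inv ⊗≫
      (mu (M.tO A B) C).hom ▷ M.a A B C ⊗≫
      𝟙 (M.a A B C)

/-- A monoidal bicategory structure on a bicategory `K` (that is, a tricategory with one object
whose bicategory of endomorphisms is `K`). -/
structure MonoidalBicategory (K : Type u) [Bicategory.{w, v} K] where
  data : MonoidalBicategoryData K
  coherence : MonoidalBicategoryCoherence data

end monoidal

section operad

universe w' v' u' u

open CategoryTheory Bicategory
open scoped unitInterval Pseudofunctor.StrongTrans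

/-- A point of the little 1-cubes operad in arity `k`: a `k`-tuple of open subintervals
`(left i, right i)` of the open unit interval which are pairwise disjoint. -/
@[ext]
structure LittleIntervals (k : ℕ) where
  left : Fin k → ℝ
  right : Fin k → ℝ
  left_nonneg (i : Fin k) : 0 ≤ left i
  left_lt_right (i : Fin k) : left i < right i
  right_le_one (i : Fin k) : right i ≤ 1
  disjoint : Pairwise fun i j => Disjoint (Set.Ioo (left i) (right i)) (Set.Ioo (left j) (right j))

namespace LittleIntervals

/-- The embedding of `k` copies of the open unit interval into itself which is the linear map
`t ↦ (right i - left i) t + left i` on the `i`-th copy. -/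
def toMap {k : ℕ} (c : LittleIntervals k) : C(Fin k × Set.Ioo (0 : ℝ) 1, Set.Ioo (0 : ℝ) 1) where
  toFun p := ⟨(c.right p.1 - c.left p.1) * (p.2 : ℝ) + c.left p.1, by
    have h0 := c.left_nonneg p.1
    have h1 := c.left_lt_right p.1
    have h2 := c.right_le_one p.1
    have h3 := p.2.2.1
    have h4 := p.2.2.2
    constructor <;> nlinarith⟩
  continuous_toFun := by
    refine Continuous.subtype_mk ?_ _
    have hl : Continuous c.left := continuous_of_discreteTopology
    have hr : Continuous c.right := continuous_of_discreteTopology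
    fun_prop

/-- The subspace topology from the compact-open topology on the space of maps from `k` copies of
the open unit interval to the open unit interval. -/
instance (k : ℕ) : TopologicalSpace (LittleIntervals k) :=
  TopologicalSpace.induced toMap inferInstance

theorem continuous_of_endpoints {Z : Type*} [TopologicalSpace Z] {k : ℕ} {f : Z → LittleIntervals k}
    (hl : ∀ i, Continuous fun z => (f z).left i) (hr : ∀ i, Continuous fun z => (f z).right i) :
    Continuous f := by
  refine continuous_induced_rng.2 (ContinuousMap.continuous_of_continuous_uncurry _ ?_)
  have h : ∀ i : Fin k, Continuous fun q : Z × Set.Ioo (0 : ℝ) 1 => toMap (f q.1) (i, q.2) := by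
    intro i
    have h1 : Continuous fun q : Z × Set.Ioo (0 : ℝ) 1 => (f q.1).left i := (hl i).comp continuous_fst
    have h2 : Continuous fun q : Z × Set.Ioo (0 : ℝ) 1 => (f q.1).right i :=
      (hr i).comp continuous_fst
    exact Continuous.subtype_mk
      (((h2.sub h1).mul (continuous_subtype_val.comp continuous_snd)).add h1) _
  have h' : Continuous fun q : Fin k × (Z × Set.Ioo (0 : ℝ) 1) => toMap (f q.2.1) (q.1, q.2.2) :=
    continuous_prod_of_discrete_left.2 h
  exact h'.comp (f := fun q : Z × (Fin k × Set.Ioo (0 : ℝ) 1) => (q.2.1, (q.1, q.2.2)))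
    (by fun_prop)

/-- A tuple of intervals listed from left to right. -/
def ofOrdered {k : ℕ} (left right : Fin k → ℝ) (h0 : ∀ i, 0 ≤ left i)
    (hlt : ∀ i, left i < right i) (h1 : ∀ i, right i ≤ 1)
    (ho : ∀ i j, i < j → right i ≤ left j) : LittleIntervals k where
  left := left
  right := right
  left_nonneg := h0
  left_lt_right := hlt
  right_le_one := h1
  disjoint i j hij := by
    rcases lt_or_gt_of_ne hij with h | h
    · exact Set.disjoint_left.2 fun t ht ht' =>
        absurd (ht.2.trans_le (ho i j h)) (not_lt.2 ht'.1.le)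
    · exact Set.disjoint_left.2 fun t ht ht' =>
        absurd (ht'.2.trans_le (ho j i h)) (not_lt.2 ht.1.le)

/-- The identity of the operad: the whole open unit interval. -/
def one : LittleIntervals 1 :=
  ofOrdered (fun _ => 0) (fun _ => 1) (by simp) (by simp) (by simp)
    (fun i j h => absurd (Subsingleton.elim i j) h.ne)

/-- The operadic composition: the `(i, j)`-th interval is the image of the `j`-th interval of `d i`
under the linear embedding of the `i`-th interval of `c`. -/
def comp {n : ℕ} (c : LittleIntervals n) {k : Fin n → ℕ} (d : ∀ i, LittleIntervals (k i)) :
    LittleIntervals (∑ i, k i) where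
  left q := let p := finSigmaFinEquiv.symm q
    (c.right p.1 - c.left p.1) * (d p.1).left p.2 + c.left p.1
  right q := let p := finSigmaFinEquiv.symm q
    (c.right p.1 - c.left p.1) * (d p.1).right p.2 + c.left p.1
  left_nonneg q := by
    generalize finSigmaFinEquiv.symm q = p
    have h0 := c.left_nonneg p.1
    have h1 := c.left_lt_right p.1
    have h2 := (d p.1).left_nonneg p.2
    have := mul_nonneg (sub_pos.2 h1).le h2
    dsimp only
    linarith
  left_lt_right q := by
    generalize finSigmaFinEquiv.symm q = p
    have h1 := c.left_lt_right p.1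
    have h2 := (d p.1).left_lt_right p.2
    have := mul_lt_mul_of_pos_left h2 (sub_pos.2 h1)
    dsimp only
    linarith
  right_le_one q := by
    generalize finSigmaFinEquiv.symm q = p
    have h0 := c.right_le_one p.1
    have h1 := c.left_lt_right p.1
    have h2 := (d p.1).right_le_one p.2
    have := mul_le_mul_of_nonneg_left h2 (sub_pos.2 h1).le
    dsimp only
    linarith
  disjoint q q' hq := by
    have hp : finSigmaFinEquiv.symm q ≠ finSigmaFinEquiv.symm q' :=
      fun h => hq (finSigmaFinEquiv.symm.injective h)
    revert hp
    dsimp only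
    generalize finSigmaFinEquiv.symm q = p
    generalize finSigmaFinEquiv.symm q' = p'
    obtain ⟨i, j⟩ := p
    obtain ⟨i', j'⟩ := p'
    intro hp
    refine Set.disjoint_left.2 fun t ht ht' => ?_
    have ht1 : (c.right i - c.left i) * (d i).left j + c.left i < t := ht.1
    have ht2 : t < (c.right i - c.left i) * (d i).right j + c.left i := ht.2
    have ht3 : (c.right i' - c.left i') * (d i').left j' + c.left i' < t := ht'.1
    have ht4 : t < (c.right i' - c.left i') * (d i').right j' + c.left i' := ht'.2
    have hi := sub_pos.2 (c.left_lt_right i)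
    have hi' := sub_pos.2 (c.left_lt_right i')
    by_cases h : i = i'
    · subst h
      have hj : j ≠ j' := fun h => hp (by rw [h])
      have key := Set.disjoint_left.1 ((d i).disjoint hj)
      refine @key ((t - c.left i) / (c.right i - c.left i)) ⟨?_, ?_⟩ ⟨?_, ?_⟩
      · rw [lt_div_iff₀ hi]; linarith
      · rw [div_lt_iff₀ hi]; linarith
      · rw [lt_div_iff₀ hi]; linarith
      · rw [div_lt_iff₀ hi]; linarith
    · have key := Set.disjoint_left.1 (c.disjoint h)
      refine @key t ⟨?_, ?_⟩ ⟨?_, ?_⟩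
      · have := mul_nonneg hi.le ((d i).left_nonneg j); linarith
      · have := mul_le_mul_of_nonneg_left ((d i).right_le_one j) hi.le; linarith
      · have := mul_nonneg hi'.le ((d i').left_nonneg j'); linarith
      · have := mul_le_mul_of_nonneg_left ((d i').right_le_one j') hi'.le; linarith

/-- The right action of the symmetric group: the `i`-th interval of `c · s` is the `s i`-th interval
of `c`. -/
def perm {k : ℕ} (c : LittleIntervals k) (s : Equiv.Perm (Fin k)) : LittleIntervals k where
  left i := c.left (s i)
  right i := c.right (s i)
  left_nonneg i := c.left_nonneg (s i)
  left_lt_right i := c.left_lt_right (s i)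
  right_le_one i := c.right_le_one (s i)
  disjoint _ _ h := c.disjoint (s.injective.ne h)

/-- The pair `m` of intervals `(1/5, 2/5)` and `(3/5, 4/5)`. -/
def m : LittleIntervals 2 :=
  ofOrdered ![1 / 5, 3 / 5] ![2 / 5, 4 / 5]
    (by simp [Fin.forall_fin_succ]; try norm_num)
    (by simp [Fin.forall_fin_succ]; try norm_num)
    (by simp [Fin.forall_fin_succ]; try norm_num)
    (by simp [Fin.forall_fin_succ]; try norm_num)

/-- The empty collection of intervals. -/
def i : LittleIntervals 0 :=
  ofOrdered Fin.elim0 Fin.elim0 (fun j => j.elim0) (fun j => j.elim0) (fun j => j.elim0)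
    (fun j => j.elim0)

/-- The path of triples of intervals with centers `((13 + 2t)/50, (17 + 16t)/50, (35 + 2t)/50)` and
lengths `((1 + 4t)/25, 1/25, (5 - 4t)/25)`. It leads from `m (m, 1)` to `m (1, m)`. -/
def assocPath : C(I, LittleIntervals 3) where
  toFun t :=
    ofOrdered
      ![(13 + 2 * (t : ℝ)) / 50 - (1 + 4 * (t : ℝ)) / 25 / 2, (17 + 16 * (t : ℝ)) / 50 - 1 / 25 / 2,
        (35 + 2 * (t : ℝ)) / 50 - (5 - 4 * (t : ℝ)) / 25 / 2]
      ![(13 + 2 * (t : ℝ)) / 50 + (1 + 4 * (t : ℝ)) / 25 / 2, (17 + 16 * (t : ℝ)) / 50 + 1 / 25 / 2,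
        (35 + 2 * (t : ℝ)) / 50 + (5 - 4 * (t : ℝ)) / 25 / 2]
      (by
        have h0 := t.2.1; have h1 := t.2.2
        intro j; fin_cases j <;> simp <;> linarith)
      (by
        have h0 := t.2.1; have h1 := t.2.2
        intro j; fin_cases j <;> simp <;> linarith)
      (by
        have h0 := t.2.1; have h1 := t.2.2
        intro j; fin_cases j <;> simp <;> linarith)
      (by
        have h0 := t.2.1; have h1 := t.2.2
        intro j j'; fin_cases j <;> fin_cases j' <;> simp <;> linarith)
  continuous_toFun := by
    refine continuous_of_endpoints (fun j => ?_) (fun j => ?_) <;> fin_cases j <;>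
      simp [ofOrdered] <;> fun_prop

/-- The straight line from the second interval `(3/5, 4/5)` of `m` to `(0, 1)`. -/
def leftUnitPath : C(I, LittleIntervals 1) where
  toFun t :=
    ofOrdered (fun _ => 3 / 5 * (1 - (t : ℝ))) (fun _ => 4 / 5 + 1 / 5 * (t : ℝ))
      (fun _ => by linarith [t.2.2]) (fun _ => by linarith [t.2.1]) (fun _ => by linarith [t.2.2])
      (fun j j' h => absurd (Subsingleton.elim j j') h.ne)
  continuous_toFun :=
    continuous_of_endpoints (fun j => by simp only [ofOrdered]; fun_prop)
      (fun j => by simp only [ofOrdered]; fun_prop)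

/-- The straight line from the first interval `(1/5, 2/5)` of `m` to `(0, 1)`. -/
def rightUnitPath : C(I, LittleIntervals 1) where
  toFun t :=
    ofOrdered (fun _ => 1 / 5 * (1 - (t : ℝ))) (fun _ => 2 / 5 + 3 / 5 * (t : ℝ))
      (fun _ => by linarith [t.2.2]) (fun _ => by linarith [t.2.1]) (fun _ => by linarith [t.2.2])
      (fun j j' h => absurd (Subsingleton.elim j j') h.ne)
  continuous_toFun :=
    continuous_of_endpoints (fun j => by simp only [ofOrdered]; fun_prop)
      (fun j => by simp only [ofOrdered]; fun_prop)

end LittleIntervals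

/-- The structure of an algebra for the little 1-cubes operad on a topological space. The basepoint
is the action of the unique point in arity `0`. -/
structure LittleIntervalsAlgebra (X : Type u) [TopologicalSpace X] where
  act {k : ℕ} : LittleIntervals k → (Fin k → X) → X
  continuous_act (k : ℕ) : Continuous fun p : LittleIntervals k × (Fin k → X) => act p.1 p.2
  act_one (x : Fin 1 → X) : act LittleIntervals.one x = x 0
  act_comp {n : ℕ} (c : LittleIntervals n) {k : Fin n → ℕ} (d : ∀ i, LittleIntervals (k i))
    (x : Fin (∑ i, k i) → X) :
    act (c.comp d) x = act c fun i => act (d i) fun j => x (finSigmaFinEquiv ⟨i, j⟩)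
  act_perm {k : ℕ} (c : LittleIntervals k) (s : Equiv.Perm (Fin k)) (x : Fin k → X) :
    act (c.perm s) x = act c (x ∘ s.symm)

/-- The strict pseudofunctor from the terminal bicategory which is constant at a point `x`, that is,
the functor `Π₂{*} ⥤ Π₂X` induced by the map `* ↦ x`. -/
def Pi2.point {X : Type u} [TopologicalSpace X] (x : X) :
    StrictPseudofunctor PointBicategory (Pi2 X) := .mk'
  { obj _ := ⟨x⟩
    map _ := 𝟙 (Pi2.mk x)
    map₂ _ := 𝟙 _
    map₂_id _ := rfl
    map₂_comp _ _ := (Category.id_comp _).symm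
    map_id _ := rfl
    map_comp _ _ := (Path.refl_trans_refl).symm
    map₂_whisker_left _ _ _ _ := by
      exact Pi2.mk_eq_conj _ _ (Path.refl (Path.refl x)) (Path.refl _) fun u v =>
        congrArg (fun p : Path x x => p v) Path.refl_trans_refl.symm
    map₂_whisker_right _ _ := by
      exact Pi2.mk_eq_conj _ _ (Path.refl (Path.refl x)) (Path.refl _) fun u v =>
        congrArg (fun p : Path x x => p v) Path.refl_trans_refl.symm
    map₂_left_unitor _ := by
      exact Pi2.mk_eq_conj' _ (Path.refl (Path.refl x))
        (Pi2.thinPath Pi2.leftParam _ (Pi2.refl_trans_eq _)) fun u v => rfl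
    map₂_right_unitor _ := by
      exact Pi2.mk_eq_conj' _ (Path.refl (Path.refl x))
        (Pi2.thinPath Pi2.rightParam _ (Pi2.trans_refl_eq _)) fun u v => rfl
    map₂_associator _ _ _ := by
      refine Pi2.mk_eq_conj _ _ (Path.refl (Path.refl x))
        (Pi2.thinPath Pi2.assocParam _ (Pi2.trans_trans_eq _ _ _)) fun u v => ?_
      change x = ((Path.refl x).trans ((Path.refl x).trans (Path.refl x))) _
      rw [Path.refl_trans_refl, Path.refl_trans_refl]
      rfl }

/-- The 1-cell `f` of `Π₂X` is the path `t ↦ φ t`. -/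
def Pi2.IsPath {X : Type u} [TopologicalSpace X] {a b : Pi2 X} (f : a ⟶ b) (φ : I → X) : Prop :=
  ∀ t, (show Path a.pt b.pt from f) t = φ t

/-- The 2-cell `η` of `Π₂X` is the class of the homotopy `(u, t) ↦ φ u t`, where `u` is the
parameter of the homotopy and `t` the parameter of the paths. -/
def Pi2.IsCell {X : Type u} [TopologicalSpace X] {a b : Pi2 X} {f g : a ⟶ b} (η : f ⟶ g)
    (φ : I → I → X) : Prop :=
  ∃ R : Path (X := Path a.pt b.pt) f g, Path.Homotopic.Quotient.mk R = η ∧ ∀ u t, R u t = φ u t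

namespace LittleIntervalsAlgebra

open LittleIntervals (m i assocPath leftUnitPath rightUnitPath)

variable {X : Type u} [TopologicalSpace X] (A : LittleIntervalsAlgebra X)

/-- The multiplication `X × X → X` given by the point `m` of the operad. -/
def mul : C(X × X, X) where
  toFun p := A.act m ![p.1, p.2]
  continuous_toFun := (A.continuous_act 2).comp (continuous_const.prodMk
    (continuous_pi fun j => by
      fin_cases j
      · exact continuous_fst
      · exact continuous_snd))

/-- The tensor product `Π₂X × Π₂X ≅ Π₂(X × X) ⥤ Π₂X`. -/
def tensor : (Pi2 X × Pi2 X) ⥤ᵖ Pi2 X :=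
  (Pi2.prodComparison X X).toPseudofunctor.comp (Pi2.map A.mul).toPseudofunctor

/-- The unit functor, constant at the point given by the empty collection of intervals. -/
def unit : PointBicategory ⥤ᵖ Pi2 X := (Pi2.point (A.act i Fin.elim0)).toPseudofunctor

/-- The adjoint equivalence `e` between pseudofunctors into `Π₂X` is the one determined by a path
`γ` of `k`-tuples of intervals, where `pt` and `arr` send the objects and 1-cells of the source to
points and paths of `X ^ k`:
* the 1-cell components of `e` and its inverse come from `γ` and the reverse of `γ`;
* the naturality 2-cells come from the squares `(s, s') ↦ γ s • arr f s'`, swept out by the straight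
  homotopy from the boundary path which first runs through `arr f` and then through `γ` to the one
  which first runs through `γ` and then through `arr f`; likewise for the inverse;
* the unit and the counit come from contractions of `γ γ⁻¹` and `γ⁻¹ γ` in the operad. -/
structure IsEquivalenceOf {B : Type u'} [Bicategory.{w', v'} B] {F G : B ⥤ᵖ Pi2 X} (e : F ≌ G) {k : ℕ}
    (γ : C(I, LittleIntervals k)) (pt : B → Fin k → X)
    (arr : ∀ {a b : B}, (a ⟶ b) → I → Fin k → X) : Prop where
  hom_app (a : B) : Pi2.IsPath (e.hom.app a) fun t => A.act (γ t) (pt a)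
  hom_naturality {a b : B} (f : a ⟶ b) : Pi2.IsCell (e.hom.naturality f).hom fun u t =>
    A.act (γ (Pi2.lineReparam Pi2.leftParam Pi2.rightParam u t))
      (arr f (Pi2.lineReparam Pi2.rightParam Pi2.leftParam u t))
  inv_app (a : B) : Pi2.IsPath (e.inv.app a) fun t => A.act (γ (σ t)) (pt a)
  inv_naturality {a b : B} (f : a ⟶ b) : Pi2.IsCell (e.inv.naturality f).hom fun u t =>
    A.act (γ (σ (Pi2.lineReparam Pi2.leftParam Pi2.rightParam u t)))
      (arr f (Pi2.lineReparam Pi2.rightParam Pi2.leftParam u t))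
  unit_app : ∃ (g : Path (γ 0) (γ 1)) (H : Path (Path.refl (γ 0)) (g.trans g.symm)),
    (∀ t, g t = γ t) ∧ ∀ a, Pi2.IsCell (e.unit.hom.as.app a) fun u t => A.act (H u t) (pt a)
  counit_app : ∃ (g : Path (γ 0) (γ 1)) (H : Path (g.symm.trans g) (Path.refl (γ 1))),
    (∀ t, g t = γ t) ∧ ∀ a, Pi2.IsCell (e.counit.hom.as.app a) fun u t => A.act (H u t) (pt a)

/-- The monoidal structure `M` on `Π₂X` is the one induced by the algebra structure: the tensor
product and the unit are those above, the associativity and unit adjoint equivalences are determined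
by the given paths in the operad, and the components of the invertible modifications are the images
of homotopies between paths (with fixed endpoints) in the spaces of the operad. -/
structure Induces (M : MonoidalBicategory (Pi2 X)) : Prop where
  tensor_eq : M.data.tensor = A.tensor
  unit_eq : M.data.unit = A.unit
  assoc : A.IsEquivalenceOf M.data.assoc assocPath
    (fun a => ![a.1.1.pt, a.1.2.pt, a.2.pt])
    (fun {a b} f t => ![(show Path a.1.1.pt b.1.1.pt from f.1.1) t,
      (show Path a.1.2.pt b.1.2.pt from f.1.2) t, (show Path a.2.pt b.2.pt from f.2) t])
  leftUnit : A.IsEquivalenceOf M.data.leftUnit leftUnitPath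
    (fun a => ![a.2.pt]) (fun {a b} f t => ![(show Path a.2.pt b.2.pt from f.2) t])
  rightUnit : A.IsEquivalenceOf M.data.rightUnit rightUnitPath
    (fun a => ![a.1.pt]) (fun {a b} f t => ![(show Path a.1.pt b.1.pt from f.1) t])
  pi : ∃ (c d : LittleIntervals 4) (p q : Path c d) (H : Path p q), ∀ x y z w : X,
    Pi2.IsCell (M.coherence.pi ⟨x⟩ ⟨y⟩ ⟨z⟩ ⟨w⟩).hom fun u t => A.act (H u t) ![x, y, z, w]
  mu : ∃ (c d : LittleIntervals 2) (p q : Path c d) (H : Path p q), ∀ x y : X,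
    Pi2.IsCell (M.coherence.mu ⟨x⟩ ⟨y⟩).hom fun u t => A.act (H u t) ![x, y]
  lam : ∃ (c d : LittleIntervals 2) (p q : Path c d) (H : Path p q), ∀ x y : X,
    Pi2.IsCell (M.coherence.lam ⟨x⟩ ⟨y⟩).hom fun u t => A.act (H u t) ![x, y]
  rho : ∃ (c d : LittleIntervals 2) (p q : Path c d) (H : Path p q), ∀ x y : X,
    Pi2.IsCell (M.coherence.rho ⟨x⟩ ⟨y⟩).hom fun u t => A.act (H u t) ![x, y]

end LittleIntervalsAlgebra

end operad

end

/-! ### Straight spaces: contractibility in a form that persists to paths and homotopies. -/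

noncomputable section

open CategoryTheory Bicategory
open scoped unitInterval

universe w u

/-! All coherence comes from one fact: intervals in `(0, 1)` listed in a fixed left-to-right order
form a convex set. Two homotopies between the same two paths in a convex set are homotopic relative
to the boundary, by the straight line between them. Hence an equation between 2-cells of `Π₂X` holds
as soon as both sides are images, under one continuous map, of homotopies in a convex space with the
same source path and the same target path. Neither the shape of these homotopies nor the choice of
`π`, `μ`, `λ`, `ρ` matters. This principle is `Pi2.Img.unique`; the other `img_` lemmas exhibit each
structural 2-cell as such an image and track its source and target.

Two devices make it applicable. The first is a convex model in which the operad composition is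
strict. `Config i j` consists of ordered intervals indexed by the positions in `[i, j)`, so that
adjacent configurations multiply as `Config i j × Config j k → Config i k` without reindexing. It is
convex by `convex_configSet`. It maps to `X` by `ev`, and `ev_subst`, which rests on the
associativity axiom of the algebra, says that `ev` turns substitution of configurations into the
action on `X`. The second device is a real label on each interval, which selects a point on a curve
in `X`. A 1-cell of `Π₂X` then lifts to a motion of a label, so that naturality in 1-cells takes
place in the same convex spaces as the equations between objects.

The adjoint equivalences `a`, `l`, `r` come from a general construction. A homotopy `I × Y → X`
between two maps that model pseudofunctors induces a transformation, with naturality cells given by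
sweeping diagonally through a square, and the reversed homotopy induces its inverse. Naturality in
2-cells is the homotopy between the two halves of the boundary of a square (`comp_eq_of_square`).
The remaining axioms of transformations, modifications and adjunctions follow from `Img.unique` over
`I × I` or `I × ℝ`.

Finally `π`, `μ`, `λ`, `ρ` are straight-line homotopies between configurations of four or two full
intervals. Substituting arbitrary configurations into them (`img_piCell` and its companions) shows
that the same cells are images of homotopies when the objects are themselves tensor products. The
modification axioms, the cocycle condition and the normalization conditions then become instances of
`Img.unique` in `Config 0 n` with `n ≤ 5`. -/

/-- A topological space with a continuous choice of a path between any two points, constant on the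
diagonal. -/
class Straight (T : Type w) [TopologicalSpace T] where
  mix : I → T → T → T
  continuous_mix : Continuous fun r : I × T × T => mix r.1 r.2.1 r.2.2
  mix_zero (a b : T) : mix 0 a b = a
  mix_one (a b : T) : mix 1 a b = b
  mix_self (u : I) (a : T) : mix u a a = a

namespace Straight

/-- A convex subset of a topological vector space is straight. -/
@[reducible] def ofConvex {E : Type w} [AddCommGroup E] [Module ℝ E] [TopologicalSpace E]
    [IsTopologicalAddGroup E] [ContinuousSMul ℝ E] {s : Set E} (hs : Convex ℝ s) : Straight s where
  mix u a b := ⟨(1 - (u : ℝ)) • (a : E) + (u : ℝ) • (b : E),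
    hs a.2 b.2 (sub_nonneg.2 u.2.2) u.2.1 (by ring)⟩
  continuous_mix := by
    refine Continuous.subtype_mk ?_ _
    fun_prop
  mix_zero a b := by ext; simp
  mix_one a b := by ext; simp
  mix_self u a := by ext; simp [← add_smul]

instance : Straight I := ofConvex (convex_Icc 0 1)

instance : Straight ℝ where
  mix u a b := (1 - (u : ℝ)) * a + u * b
  continuous_mix := by fun_prop
  mix_zero a b := by simp
  mix_one a b := by simp
  mix_self u a := by ring

instance {S T : Type*} [TopologicalSpace S] [TopologicalSpace T] [Straight S] [Straight T] :
    Straight (S × T) where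
  mix u a b := (mix u a.1 b.1, mix u a.2 b.2)
  continuous_mix := Continuous.prodMk
    (continuous_mix.comp (f := fun r : I × (S × T) × (S × T) => (r.1, r.2.1.1, r.2.2.1))
      (by fun_prop))
    (continuous_mix.comp (f := fun r : I × (S × T) × (S × T) => (r.1, r.2.1.2, r.2.2.2))
      (by fun_prop))
  mix_zero a b := by simp [mix_zero]
  mix_one a b := by simp [mix_one]
  mix_self u a := by simp [mix_self]

variable {T : Type w} [TopologicalSpace T] [Straight T]

/-- The pointwise line between two paths. -/
def mixPath {s t : T} (u : I) (p q : Path s t) : Path s t where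
  toFun v := mix u (p v) (q v)
  source' := by simp [mix_self]
  target' := by simp [mix_self]
  continuous_toFun := continuous_mix.comp (f := fun v => (u, p v, q v)) (by fun_prop)

theorem continuous_mixPath {Z : Type*} [TopologicalSpace Z] {s t : T} {f : Z → I}
    {p q : Z → Path s t} (hf : Continuous f) (hp : Continuous p) (hq : Continuous q) :
    Continuous fun z => mixPath (f z) (p z) (q z) := by
  rw [← Path.continuous_uncurry_iff]
  refine continuous_mix.comp (f := fun r : Z × I => (f r.1, p r.1 r.2, q r.1 r.2)) ?_
  fun_prop

/-- The line between two paths with the same endpoints. -/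
def line {s t : T} (p q : Path s t) : Path p q where
  toFun u := mixPath u p q
  source' := by ext; exact mix_zero _ _
  target' := by ext; exact mix_one _ _
  continuous_toFun := continuous_mixPath continuous_id continuous_const continuous_const

/-- `mix` is applied pointwise in both parameters of the homotopies. By `mix_self` nothing moves
where `R` and `S` agree, in particular on the boundary of the square. -/
theorem homotopic {s t : T} {p q : Path s t} (R S : Path p q) : R.Homotopic S := by
  have hs : ∀ (u : I) (p : Path s t), mixPath u p p = p := fun u p => by
    ext v; exact mix_self _ _
  refine ⟨{ toFun := fun r => mixPath r.1 (R r.2) (S r.2)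
            continuous_toFun := continuous_mixPath continuous_fst
              (R.continuous.comp continuous_snd) (S.continuous.comp continuous_snd)
            map_zero_left := ?_, map_one_left := ?_, prop' := ?_ }⟩
  · intro v; ext; exact mix_zero _ _
  · intro v; ext; exact mix_one _ _
  · rintro u v (rfl | hv)
    · simp [hs]
    · obtain rfl : v = 1 := hv
      simp [hs]

end Straight

/-! ### Lifting 1-cells and 2-cells of `Π₂X` along a continuous map. -/

namespace Pi2

variable {X : Type u} [TopologicalSpace X]

theorem IsPath.source {a b : Pi2 X} {f : a ⟶ b} {φ : I → X} (hf : IsPath f φ) : φ 0 = a.pt :=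
  (hf 0).symm.trans (Path.source _)

theorem IsPath.target {a b : Pi2 X} {f : a ⟶ b} {φ : I → X} (hf : IsPath f φ) : φ 1 = b.pt :=
  (hf 1).symm.trans (Path.target _)

theorem IsCell.isPath_source {a b : Pi2 X} {f g : a ⟶ b} {η : f ⟶ g} {φ : I → I → X}
    (hη : IsCell η φ) : IsPath f (φ 0) := by
  obtain ⟨R, rfl, hR⟩ := hη
  intro t
  rw [← hR 0 t, R.source]

theorem IsCell.isPath_target {a b : Pi2 X} {f g : a ⟶ b} {η : f ⟶ g} {φ : I → I → X}
    (hη : IsCell η φ) : IsPath g (φ 1) := by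
  obtain ⟨R, rfl, hR⟩ := hη
  intro t
  rw [← hR 1 t, R.target]

/-- The constraints of the strict pseudofunctors in play are of the form `eqToHom`; this lemma makes
them constant homotopies. -/
theorem isCell_eqToHom {a b : Pi2 X} {f g : a ⟶ b} (h : f = g) {φ : I → X} (hf : IsPath f φ) :
    IsCell (eqToHom h) fun _ => φ := by
  subst h
  exact ⟨Path.refl _, rfl, fun _ t => hf t⟩

theorem isCell_id {a b : Pi2 X} {f : a ⟶ b} {φ : I → X} (hf : IsPath f φ) :
    IsCell (𝟙 f) fun _ => φ :=
  isCell_eqToHom rfl hf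

/-- The two functions need not be assumed equal, since both describe the middle 1-cell.
Concatenating constant homotopies gives a constant one on the nose. -/
theorem IsCell.comp_const {a b : Pi2 X} {f g h : a ⟶ b} {η : f ⟶ g} {θ : g ⟶ h} {φ ψ : I → X}
    (hη : IsCell η fun _ => φ) (hθ : IsCell θ fun _ => ψ) : IsCell (η ≫ θ) fun _ => φ := by
  have e : φ = ψ := funext fun t => (hη.isPath_target t).symm.trans (hθ.isPath_source t)
  subst e
  obtain ⟨R, rfl, hR⟩ := hη
  obtain ⟨S, rfl, hS⟩ := hθ
  refine ⟨R.trans S, rfl, fun u t => ?_⟩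
  rw [Path.trans_apply]
  split_ifs <;> simp [hR, hS]

/-- An isomorphism is determined by its `hom`, so `η` is `isoOfPath R`, whose inverse is the
reversed path by definition. -/
theorem comp_inv_cell {a b : Pi2 X} {f g : a ⟶ b} (R : Path (X := Path a.pt b.pt) f g)
    (η : f ≅ g) (h : Path.Homotopic.Quotient.mk R = η.hom) :
    Path.Homotopic.Quotient.mk R.symm = η.inv := by
  have : η = isoOfPath R := Iso.ext h.symm
  rw [this]
  rfl

variable {T : Type w} [TopologicalSpace T]

/-- The path `p` is a lift of the 1-cell `f` along `P`. -/
def Lifts (P : C(T, X)) {s t : T} (p : Path s t) {a b : Pi2 X} (f : a ⟶ b) : Prop :=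
  IsPath f fun v => P (p v)

/-- The 2-cell `η` is the image under `P` of a homotopy from `p` to `q`. -/
def Img (P : C(T, X)) {s t : T} (p q : Path s t) {a b : Pi2 X} {f g : a ⟶ b} (η : f ⟶ g) : Prop :=
  ∃ R : Path p q, IsCell η fun u v => P (R u v)

variable {P : C(T, X)}

theorem Lifts.trans {r s t : T} {p : Path r s} {q : Path s t} {a b c : Pi2 X} {f : a ⟶ b}
    {g : b ⟶ c} (hf : Lifts P p f) (hg : Lifts P q g) : Lifts P (p.trans q) (f ≫ g) := by
  intro v
  change (Path.trans (X := X) f g) v = P (p.trans q v)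
  rw [Path.trans_apply, Path.trans_apply]
  split_ifs
  · exact hf _
  · exact hg _

theorem lifts_id {s : T} {a : Pi2 X} (h : P s = a.pt) : Lifts P (Path.refl s) (𝟙 a) :=
  fun _ => h.symm

theorem Img.source {s t : T} {p q : Path s t} {a b : Pi2 X} {f g : a ⟶ b} {η : f ⟶ g}
    (h : Img P p q η) : Lifts P p f := by
  obtain ⟨R, hR⟩ := h
  intro v
  rw [hR.isPath_source v, R.source]

theorem Img.target {s t : T} {p q : Path s t} {a b : Pi2 X} {f g : a ⟶ b} {η : f ⟶ g}
    (h : Img P p q η) : Lifts P q g := by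
  obtain ⟨R, hR⟩ := h
  intro v
  rw [hR.isPath_target v, R.target]

/-- Parallel homotopies in a straight space have equal images. -/
theorem Img.unique [Straight T] {s t : T} {p q : Path s t} {a b : Pi2 X} {f g : a ⟶ b}
    {η θ : f ⟶ g} (hη : Img P p q η) (hθ : Img P p q θ) : η = θ := by
  obtain ⟨x⟩ := a
  obtain ⟨y⟩ := b
  have hf := hη.source
  have hg := hη.target
  obtain ⟨R, R', rfl, hR⟩ := hη
  obtain ⟨S, S', rfl, hS⟩ := hθ
  obtain rfl : P s = x := by simpa using IsPath.source hf
  obtain rfl : P t = y := by simpa using IsPath.target hf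
  -- With the endpoints eliminated, postcomposition with `P` is a continuous map of path spaces, and
  -- the homotopy between the two lifts is pushed forward along it.
  let F : C(Path s t, Path (P s) (P t)) := ⟨fun p => p.map P.continuous, by
    rw [← Path.continuous_uncurry_iff]
    change Continuous fun r : Path s t × I => P (r.1 r.2)
    fun_prop⟩
  obtain rfl : F p = f := Path.ext (funext fun v => (hf v).symm)
  obtain rfl : F q = g := Path.ext (funext fun v => (hg v).symm)
  have e1 : R' = R.map F.continuous := by ext u v; exact hR u v
  have e2 : S' = S.map F.continuous := by ext u v; exact hS u v
  rw [e1, e2]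
  exact Quotient.sound ((Straight.homotopic R S).map F)

theorem Img.comp {s t : T} {p q r : Path s t} {a b : Pi2 X} {f g h : a ⟶ b} {η : f ⟶ g}
    {θ : g ⟶ h} (hη : Img P p q η) (hθ : Img P q r θ) : Img P p r (η ≫ θ) := by
  obtain ⟨R, R', rfl, hR⟩ := hη
  obtain ⟨S, S', rfl, hS⟩ := hθ
  refine ⟨R.trans S, R'.trans S', rfl, fun u v => ?_⟩
  change R'.trans S' u v = P (R.trans S u v)
  rw [Path.trans_apply, Path.trans_apply]
  split_ifs
  · exact hR _ _
  · exact hS _ _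

theorem img_id {s t : T} {p : Path s t} {a b : Pi2 X} {f : a ⟶ b} (hf : Lifts P p f) :
    Img P p p (𝟙 f) :=
  ⟨Path.refl p, isCell_id hf⟩

theorem Img.inv {s t : T} {p q : Path s t} {a b : Pi2 X} {f g : a ⟶ b} {η : f ≅ g}
    (hη : Img P p q η.hom) : Img P q p η.inv := by
  obtain ⟨R, R', e, hR⟩ := hη
  exact ⟨R.symm, R'.symm, comp_inv_cell R' η e, fun u v => hR _ v⟩

theorem Img.whiskerLeft {r s t : T} {k : Path r s} {p q : Path s t} {a b c : Pi2 X} {f : a ⟶ b}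
    {g h : b ⟶ c} {η : g ⟶ h} (hf : Lifts P k f) (hη : Img P p q η) :
    Img P (k.trans p) (k.trans q) (f ◁ η) := by
  obtain ⟨R, R', rfl, hR⟩ := hη
  refine ⟨R.map (f := fun p => k.trans p) (by fun_prop),
    R'.map (f := fun p => Path.trans (X := X) f p) (by fun_prop), rfl, fun u v => ?_⟩
  change (Path.trans (X := X) f (R' u)) v = P (k.trans (R u) v)
  rw [Path.trans_apply, Path.trans_apply]
  split_ifs
  · exact hf _
  · exact hR _ _

theorem Img.whiskerRight {r s t : T} {p q : Path r s} {k : Path s t} {a b c : Pi2 X} {f g : a ⟶ b}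
    {h : b ⟶ c} {η : f ⟶ g} (hη : Img P p q η) (hh : Lifts P k h) :
    Img P (p.trans k) (q.trans k) (η ▷ h) := by
  obtain ⟨R, R', rfl, hR⟩ := hη
  refine ⟨R.map (f := fun p => p.trans k) (by fun_prop),
    R'.map (f := fun p => Path.trans (X := X) p h) (by fun_prop), rfl, fun u v => ?_⟩
  change (Path.trans (X := X) (R' u) h) v = P ((R u).trans k v)
  rw [Path.trans_apply, Path.trans_apply]
  split_ifs
  · exact hR _ _
  · exact hh _

/-- Reparametrization of a path commutes with postcomposition by `P`, so the thin homotopy in `T`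
covers the one in `X`. The same applies to the unitors. -/
theorem img_associator {r s t t' : T} {p : Path r s} {q : Path s t} {k : Path t t'}
    {a b c d : Pi2 X} {f : a ⟶ b} {g : b ⟶ c} {h : c ⟶ d} (hf : Lifts P p f) (hg : Lifts P q g)
    (hh : Lifts P k h) :
    Img P ((p.trans q).trans k) (p.trans (q.trans k)) (α_ f g h).hom :=
  ⟨thinPath assocParam (p.trans (q.trans k)) (trans_trans_eq p q k), _, rfl,
    fun _ _ => hf.trans (hg.trans hh) _⟩

theorem img_leftUnitor {s t : T} {p : Path s t} {a b : Pi2 X} {f : a ⟶ b} (hf : Lifts P p f) :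
    Img P ((Path.refl s).trans p) p (λ_ f).hom :=
  ⟨thinPath leftParam p (refl_trans_eq p), _, rfl, fun _ _ => hf _⟩

theorem img_rightUnitor {s t : T} {p : Path s t} {a b : Pi2 X} {f : a ⟶ b} (hf : Lifts P p f) :
    Img P (p.trans (Path.refl t)) p (ρ_ f).hom :=
  ⟨thinPath rightParam p (trans_refl_eq p), _, rfl, fun _ _ => hf _⟩

/-- The image of a homotopy, as a 2-cell between given 1-cells. -/
def cellOf {s t : T} {p q : Path s t} {a b : Pi2 X} {f g : a ⟶ b} (hf : Lifts P p f)
    (hg : Lifts P q g) (R : Path p q) : f ≅ g :=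
  isoOfPath (X := X) (x := a.pt) (y := b.pt)
    { toFun u :=
        { toFun v := P (R u v)
          source' := by simpa using IsPath.source hf
          target' := by simpa using IsPath.target hf }
      source' := by ext v; simpa using (hf v).symm
      target' := by ext v; simpa using (hg v).symm
      continuous_toFun := by
        rw [← Path.continuous_uncurry_iff]
        change Continuous fun r : I × I => P (R r.1 r.2)
        fun_prop }

theorem isCell_cellOf {s t : T} {p q : Path s t} {a b : Pi2 X} {f g : a ⟶ b} (hf : Lifts P p f)
    (hg : Lifts P q g) (R : Path p q) : IsCell (cellOf hf hg R).hom fun u v => P (R u v) :=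
  ⟨_, rfl, fun _ _ => rfl⟩

/-- A cell given by a family of points of `T` which is a homotopy from `p` to `q`. -/
theorem IsCell.img {s t : T} {p q : Path s t} {a b : Pi2 X} {f g : a ⟶ b} {η : f ⟶ g}
    {φ : I → I → T} (hη : IsCell η fun u v => P (φ u v)) (hφ : Continuous fun r : I × I => φ r.1 r.2)
    (hp : ∀ v, φ 0 v = p v) (hq : ∀ v, φ 1 v = q v) (hs : ∀ u, φ u 0 = s) (ht : ∀ u, φ u 1 = t) :
    Img P p q η :=
  ⟨{ toFun := fun u => ⟨⟨φ u, hφ.comp (f := fun v => (u, v)) (by fun_prop)⟩, hs u, ht u⟩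
     source' := Path.ext (funext hp)
     target' := Path.ext (funext hq)
     continuous_toFun := by
       rw [← Path.continuous_uncurry_iff]
       exact hφ }, hη⟩

end Pi2

end

/-! ### Labelled configurations of ordered intervals and their substitution. -/

noncomputable section

open CategoryTheory Bicategory
open scoped unitInterval

universe u

namespace LittleIntervals

/-- The image of the labelled interval `v` (left endpoint, right endpoint, label) under the linear
embedding onto the interval `o`. -/
def glue (o v : ℝ × ℝ × ℝ) : ℝ × ℝ × ℝ :=
  ((o.2.1 - o.1) * v.1 + o.1, (o.2.1 - o.1) * v.2.1 + o.1, v.2.2)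

theorem glue_assoc (o v w : ℝ × ℝ × ℝ) : glue (glue o v) w = glue o (glue v w) := by
  ext <;> simp only [glue] <;> ring

theorem one_glue (τ : ℝ) (v : ℝ × ℝ × ℝ) : glue (0, 1, τ) v = v := by
  ext <;> simp [glue]

/-- Disjoint intervals in `(0, 1)`, with real labels, listed from left to right and indexed by the
natural numbers in `[i, j)`. -/
def configSet (i j : ℕ) : Set (ℕ → ℝ × ℝ × ℝ) :=
  {c | i ≤ j ∧ (∀ q, i ≤ q → q < j → 0 ≤ (c q).1 ∧ (c q).1 < (c q).2.1 ∧ (c q).2.1 ≤ 1) ∧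
    (∀ q q', i ≤ q → q < q' → q' < j → (c q).2.1 ≤ (c q').1) ∧
    ∀ q, ¬(i ≤ q ∧ q < j) → c q = 0}

/-- The space of labelled configurations indexed by `[i, j)`. -/
abbrev Config (i j : ℕ) : Type := configSet i j

/-- Dimension one enters here: once the order is fixed, disjointness becomes a linear inequality
between a right endpoint and a later left endpoint. Positivity of lengths, containment in `[0, 1]`
and vanishing off `[i, j)` are convex conditions too, and the labels are unconstrained. -/
theorem convex_configSet (i j : ℕ) : Convex ℝ (configSet i j) := by
  intro c hc d hd a b ha hb hab
  refine ⟨hc.1, fun q h h' => ?_, fun q q' h h' h'' => ?_, fun q h => ?_⟩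
  · obtain ⟨h1, h2, h3⟩ := hc.2.1 q h h'
    obtain ⟨k1, k2, k3⟩ := hd.2.1 q h h'
    simp only [Pi.add_apply, Pi.smul_apply, Prod.fst_add, Prod.smul_fst, Prod.snd_add,
      Prod.smul_snd, smul_eq_mul]
    refine ⟨by positivity, ?_, by nlinarith⟩
    -- Strictness is inherited from whichever configuration has positive weight: from `d` when `a =
    -- 0`, and from `c` otherwise.
    rcases ha.eq_or_lt with rfl | ha
    · obtain rfl : b = 1 := by linarith
      linarith
    · have := mul_lt_mul_of_pos_left h2 ha
      have := mul_le_mul_of_nonneg_left k2.le hb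
      linarith
  · have h1 := mul_le_mul_of_nonneg_left (hc.2.2.1 q q' h h' h'') ha
    have h2 := mul_le_mul_of_nonneg_left (hd.2.2.1 q q' h h' h'') hb
    simp only [Pi.add_apply, Pi.smul_apply, Prod.fst_add, Prod.smul_fst, Prod.snd_add,
      Prod.smul_snd, smul_eq_mul]
    linarith
  · simp [hc.2.2.2 q h, hd.2.2.2 q h]

instance (i j : ℕ) : Straight (Config i j) := Straight.ofConvex (convex_configSet i j)

/-- The substitution of the configurations `d q`, indexed by the blocks `[b q, b (q + 1))`, into the
intervals of `c` with indices in `[i, j)`. -/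
def substFun (b : ℕ → ℕ) (d : ℕ → ℕ → ℝ × ℝ × ℝ) (i j : ℕ) (c : ℕ → ℝ × ℝ × ℝ) (x : ℕ) :
    ℝ × ℝ × ℝ :=
  ∑ q ∈ Finset.Ico i j, if b q ≤ x ∧ x < b (q + 1) then glue (c q) (d q x) else 0

section substFun
variable {b : ℕ → ℕ} (hb : Monotone b) {d : ℕ → ℕ → ℝ × ℝ × ℝ} {i j : ℕ} {c : ℕ → ℝ × ℝ × ℝ}
include hb

theorem block_unique {q q' x : ℕ} (h : b q ≤ x) (h' : x < b (q + 1)) (k : b q' ≤ x)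
    (k' : x < b (q' + 1)) : q = q' := by
  by_contra hne
  rcases lt_or_gt_of_ne hne with hlt | hlt
  · have := hb (Nat.succ_le_of_lt hlt)
    simp only [Nat.succ_eq_add_one] at this
    omega
  · have := hb (Nat.succ_le_of_lt hlt)
    simp only [Nat.succ_eq_add_one] at this
    omega

theorem substFun_of_mem {q x : ℕ} (hi : i ≤ q) (hj : q < j) (h : b q ≤ x) (h' : x < b (q + 1)) :
    substFun b d i j c x = glue (c q) (d q x) := by
  rw [substFun, Finset.sum_eq_single q]
  · rw [if_pos ⟨h, h'⟩]
  · intro q' _ hne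
    rw [if_neg]
    rintro ⟨k, k'⟩
    exact hne (block_unique hb k k' h h')
  · intro hq
    exact absurd (Finset.mem_Ico.2 ⟨hi, hj⟩) hq

theorem substFun_of_notMem {x : ℕ} (h : ¬(b i ≤ x ∧ x < b j)) : substFun b d i j c x = 0 := by
  refine Finset.sum_eq_zero fun q hq => if_neg ?_
  rintro ⟨k, k'⟩
  obtain ⟨h1, h2⟩ := Finset.mem_Ico.1 hq
  exact h ⟨(hb h1).trans k, k'.trans_le (hb h2)⟩

omit hb in
theorem exists_block {x : ℕ} (hij : i ≤ j) (h : b i ≤ x) (h' : x < b j) :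
    ∃ q, i ≤ q ∧ q < j ∧ b q ≤ x ∧ x < b (q + 1) := by
  induction j, hij using Nat.le_induction with
  | base => omega
  | succ j hj ih =>
    by_cases hx : x < b j
    · obtain ⟨q, h1, h2, h3⟩ := ih hx
      exact ⟨q, h1, by omega, h3⟩
    · exact ⟨j, hj, by omega, not_lt.1 hx, h'⟩

/-- By `key`, each glued interval stays inside its host interval of `c`. The order of two positions
then comes from `d q` if they share a host, and from `c` if they do not. -/
theorem substFun_mem (hc : c ∈ configSet i j)
    (hd : ∀ q, i ≤ q → q < j → d q ∈ configSet (b q) (b (q + 1))) :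
    substFun b d i j c ∈ configSet (b i) (b j) := by
  have key : ∀ q, i ≤ q → q < j → ∀ x, b q ≤ x → x < b (q + 1) →
      (c q).1 ≤ (glue (c q) (d q x)).1 ∧ (glue (c q) (d q x)).1 < (glue (c q) (d q x)).2.1 ∧
        (glue (c q) (d q x)).2.1 ≤ (c q).2.1 := by
    intro q hi hj x h h'
    obtain ⟨h1, h2, h3⟩ := hc.2.1 q hi hj
    obtain ⟨k1, k2, k3⟩ := (hd q hi hj).2.1 x h h'
    have hl := sub_pos.2 h2
    have e1 := mul_nonneg hl.le k1
    have e2 := mul_lt_mul_of_pos_left k2 hl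
    have e3 := mul_le_mul_of_nonneg_left k3 hl.le
    simp only [glue]
    exact ⟨by linarith, by linarith, by linarith⟩
  refine ⟨hb hc.1, fun x h h' => ?_, fun x x' h hxx h' => ?_, fun x h =>
    substFun_of_notMem hb h⟩
  · obtain ⟨q, hi, hj, k, k'⟩ := exists_block hc.1 h h'
    rw [substFun_of_mem hb hi hj k k']
    obtain ⟨e1, e2, e3⟩ := key q hi hj x k k'
    obtain ⟨h1, h2, h3⟩ := hc.2.1 q hi hj
    exact ⟨h1.trans e1, e2, e3.trans h3⟩
  · obtain ⟨q, hi, hj, k, k'⟩ := exists_block (x := x) hc.1 h (hxx.trans h')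
    obtain ⟨q', hi', hj', l, l'⟩ := exists_block (x := x') hc.1 (h.trans hxx.le) h'
    rw [substFun_of_mem hb hi hj k k', substFun_of_mem hb hi' hj' l l']
    have hqq : q ≤ q' := by
      by_contra hlt
      have := hb (Nat.succ_le_of_lt (not_le.1 hlt))
      simp only [Nat.succ_eq_add_one] at this
      omega
    rcases hqq.eq_or_lt with rfl | hlt
    · obtain ⟨h1, h2, h3⟩ := hc.2.1 q hi hj
      have := mul_le_mul_of_nonneg_left ((hd q hi hj).2.2.1 x x' k hxx l') (sub_pos.2 h2).le
      simp only [glue]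
      linarith
    · exact ((key q hi hj x k k').2.2.trans (hc.2.2.1 q q' hi hlt hj')).trans
        (key q' hi' hj' x' l l').1

/-- At each position both sides select the same nested pair of blocks, and `glue_assoc` finishes.
Positions are absolute natural numbers, so associativity of substitution is an equality without any
reindexing of summands. -/
theorem substFun_substFun {b' : ℕ → ℕ} (hb' : Monotone b') {d' : ℕ → ℕ → ℝ × ℝ × ℝ}
    (hij : i ≤ j) :
    substFun b d (b' i) (b' j) (substFun b' d' i j c) =
      substFun (b ∘ b') (fun q => substFun b d (b' q) (b' (q + 1)) (d' q)) i j c := by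
  funext x
  by_cases hx : b (b' i) ≤ x ∧ x < b (b' j)
  · obtain ⟨r, hi, hj, h, h'⟩ := exists_block (hb' hij) hx.1 hx.2
    obtain ⟨q, ki, kj, k, k'⟩ := exists_block hij hi hj
    rw [substFun_of_mem hb hi hj h h', substFun_of_mem hb' ki kj k k',
      substFun_of_mem (hb.comp hb') ki kj ((hb k).trans h) (h'.trans_le (hb k')),
      substFun_of_mem hb k k' h h', glue_assoc]
  · rw [substFun_of_notMem hb hx, substFun_of_notMem (hb.comp hb') hx]

end substFun

/-- The block test involves only the position, not the configurations. Each term of the finite sum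
is therefore zero or polynomial in the data. -/
theorem continuous_substFun {Z : Type*} [TopologicalSpace Z] (b : ℕ → ℕ) (i j : ℕ)
    {d : Z → ℕ → ℕ → ℝ × ℝ × ℝ} {c : Z → ℕ → ℝ × ℝ × ℝ} (hd : ∀ q, Continuous fun z => d z q)
    (hc : Continuous c) : Continuous fun z => substFun b (d z) i j (c z) := by
  refine continuous_pi fun x => continuous_finsetSum _ fun q _ => ?_
  have h1 : Continuous fun z => d z q x := (continuous_apply x).comp (hd q)
  have h2 : Continuous fun z => c z q := (continuous_apply q).comp hc
  split_ifs
  · unfold glue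
    fun_prop
  · exact continuous_const

/-- A sequence of configurations indexed by consecutive blocks of natural numbers. -/
structure Blocks where
  b : ℕ → ℕ
  d : ℕ → ℕ → ℝ × ℝ × ℝ
  mem (q : ℕ) : d q ∈ configSet (b q) (b (q + 1))

namespace Blocks

theorem mono (B : Blocks) : Monotone B.b := monotone_nat_of_le_succ fun q => (B.mem q).1

/-- The substitution of a sequence of configurations into a configuration. -/
def subst (B : Blocks) {i j : ℕ} (c : Config i j) : Config (B.b i) (B.b j) :=
  ⟨substFun B.b B.d i j c.1, substFun_mem B.mono c.2 fun q _ _ => B.mem q⟩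

/-- Associativity in a form fit for explicit lists of blocks: the contents have to be compared only
for `i ≤ q < j`, so the trailing empty blocks play no role. -/
theorem substFun_eq_of_comp {B B' B'' : Blocks} {i j : ℕ} (c : ℕ → ℝ × ℝ × ℝ) (hij : i ≤ j)
    (hb : ∀ q, B''.b q = B.b (B'.b q))
    (hd : ∀ q, i ≤ q → q < j → B''.d q = substFun B.b B.d (B'.b q) (B'.b (q + 1)) (B'.d q)) :
    substFun B.b B.d (B'.b i) (B'.b j) (substFun B'.b B'.d i j c) =
      substFun B''.b B''.d i j c := by
  rw [substFun_substFun B.mono B'.mono hij]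
  funext x
  refine Finset.sum_congr rfl fun q hq => ?_
  obtain ⟨h, h'⟩ := Finset.mem_Ico.1 hq
  simp only [hb, hd q h h', Function.comp]

end Blocks

/-- The empty configuration. -/
def emp (i : ℕ) : Config i i :=
  ⟨fun _ => 0, le_rfl, by omega, by omega, by simp⟩

/-- The configuration consisting of the whole interval with the label `τ`. -/
def pnt (q : ℕ) (τ : ℝ) : Config q (q + 1) :=
  ⟨fun x => if x = q then (0, 1, τ) else 0, by omega, fun x h h' => by
    obtain rfl : x = q := by omega
    simp, by omega, fun x h => if_neg (by omega)⟩

theorem continuous_pnt (q : ℕ) : Continuous (pnt q) := by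
  refine Continuous.subtype_mk (continuous_pi fun x => ?_) _
  split_ifs <;> fun_prop

theorem Blocks.subst_emp (B : Blocks) (i : ℕ) : B.subst (emp i) = emp (B.b i) := by
  refine Subtype.ext (funext fun x => ?_)
  exact substFun_of_notMem B.mono (by omega)

/-- The full interval is a unit for substitution. Its own label `τ` is lost, because `glue` keeps
the inner label. -/
theorem Blocks.subst_pnt (B : Blocks) (q : ℕ) (τ : ℝ) : B.subst (pnt q τ) = ⟨B.d q, B.mem q⟩ := by
  refine Subtype.ext (funext fun x => ?_)
  by_cases h : B.b q ≤ x ∧ x < B.b (q + 1)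
  · refine (substFun_of_mem B.mono le_rfl (Nat.lt_succ_self q) h.1 h.2).trans ?_
    simp [pnt, one_glue]
  · exact (substFun_of_notMem B.mono h).trans ((B.mem q).2.2.2 x h).symm

section blocks
variable {i j k l n : ℕ}

/-- The boundaries of one block. -/
def bounds₁ (i j : ℕ) : ℕ → ℕ
  | 0 => i | _ => j

/-- The boundaries of two blocks. -/
def bounds₂ (i j k : ℕ) : ℕ → ℕ
  | 0 => i | 1 => j | _ => k

/-- The boundaries of three blocks. -/
def bounds₃ (i j k l : ℕ) : ℕ → ℕ
  | 0 => i | 1 => j | 2 => k | _ => l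

/-- The boundaries of four blocks. -/
def bounds₄ (i j k l n : ℕ) : ℕ → ℕ
  | 0 => i | 1 => j | 2 => k | 3 => l | _ => n

/-- One block. -/
def blocks₁ (u : Config i j) : Blocks where
  b := bounds₁ i j
  d | 0 => u.1 | _ => (emp j).1
  mem | 0 => u.2 | _ + 1 => (emp j).2

/-- Two blocks. -/
def blocks₂ (u : Config i j) (v : Config j k) : Blocks where
  b := bounds₂ i j k
  d | 0 => u.1 | 1 => v.1 | _ => (emp k).1
  mem | 0 => u.2 | 1 => v.2 | _ + 2 => (emp k).2

/-- Three blocks. -/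
def blocks₃ (u : Config i j) (v : Config j k) (w : Config k l) : Blocks where
  b := bounds₃ i j k l
  d | 0 => u.1 | 1 => v.1 | 2 => w.1 | _ => (emp l).1
  mem | 0 => u.2 | 1 => v.2 | 2 => w.2 | _ + 3 => (emp l).2

/-- Four blocks. -/
def blocks₄ (u : Config i j) (v : Config j k) (w : Config k l) (z : Config l n) : Blocks where
  b := bounds₄ i j k l n
  d | 0 => u.1 | 1 => v.1 | 2 => w.1 | 3 => z.1 | _ => (emp n).1
  mem | 0 => u.2 | 1 => v.2 | 2 => w.2 | 3 => z.2 | _ + 4 => (emp n).2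

/-- Substitution into a single interval. -/
def op₁ (c : Config 0 1) (u : Config i j) : Config i j := (blocks₁ u).subst c

/-- Substitution into a pair of intervals. -/
def op₂ (c : Config 0 2) (u : Config i j) (v : Config j k) : Config i k := (blocks₂ u v).subst c

/-- Substitution into a triple of intervals. -/
def op₃ (c : Config 0 3) (u : Config i j) (v : Config j k) (w : Config k l) : Config i l :=
  (blocks₃ u v w).subst c

/-- Substitution into a quadruple of intervals. -/
def op₄ (c : Config 0 4) (u : Config i j) (v : Config j k) (w : Config k l) (z : Config l n) :
    Config i n := (blocks₄ u v w z).subst c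

section continuity
variable {Z : Type*} [TopologicalSpace Z]

theorem continuous_op₁ {c : Z → Config 0 1} {u : Z → Config i j} (hc : Continuous c)
    (hu : Continuous u) : Continuous fun z => op₁ (c z) (u z) := by
  refine continuous_induced_rng.2 (continuous_substFun (bounds₁ i j) 0 1
    (d := fun z => (blocks₁ (u z)).d) (fun q => ?_) (continuous_subtype_val.comp hc))
  match q with
  | 0 => exact continuous_subtype_val.comp hu
  | _ + 1 => exact continuous_const

theorem continuous_op₂ {c : Z → Config 0 2} {u : Z → Config i j} {v : Z → Config j k}
    (hc : Continuous c) (hu : Continuous u) (hv : Continuous v) :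
    Continuous fun z => op₂ (c z) (u z) (v z) := by
  refine continuous_induced_rng.2 (continuous_substFun (bounds₂ i j k) 0 2
    (d := fun z => (blocks₂ (u z) (v z)).d) (fun q => ?_) (continuous_subtype_val.comp hc))
  match q with
  | 0 => exact continuous_subtype_val.comp hu
  | 1 => exact continuous_subtype_val.comp hv
  | _ + 2 => exact continuous_const

theorem continuous_op₃ {c : Z → Config 0 3} {u : Z → Config i j} {v : Z → Config j k}
    {w : Z → Config k l} (hc : Continuous c) (hu : Continuous u) (hv : Continuous v)
    (hw : Continuous w) : Continuous fun z => op₃ (c z) (u z) (v z) (w z) := by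
  refine continuous_induced_rng.2 (continuous_substFun (bounds₃ i j k l) 0 3
    (d := fun z => (blocks₃ (u z) (v z) (w z)).d) (fun q => ?_) (continuous_subtype_val.comp hc))
  match q with
  | 0 => exact continuous_subtype_val.comp hu
  | 1 => exact continuous_subtype_val.comp hv
  | 2 => exact continuous_subtype_val.comp hw
  | _ + 3 => exact continuous_const

theorem continuous_op₄ (u : Config i j) (v : Config j k) (w : Config k l) (z : Config l n)
    {c : Z → Config 0 4} (hc : Continuous c) : Continuous fun x => op₄ (c x) u v w z :=
  continuous_induced_rng.2 (continuous_substFun (bounds₄ i j k l n) 0 4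
    (d := fun _ => (blocks₄ u v w z).d) (fun _ => continuous_const)
    (continuous_subtype_val.comp hc))

end continuity

variable (B : Blocks)

/-- Both operations are substitutions, so this is associativity of substitution; the same holds for
`op₂` and `op₃`. The case distinctions only compare the lists of block bounds and contents. -/
theorem Blocks.subst_op₁ (c : Config 0 1) (u : Config i j) :
    B.subst (op₁ c u) = op₁ c (B.subst u) := by
  refine Subtype.ext (Blocks.substFun_eq_of_comp (B := B) (B' := blocks₁ u)
    (B'' := blocks₁ (B.subst u)) c.1 (Nat.zero_le 1) (fun q => ?_) (fun q _ hq => ?_))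
  · match q with
    | 0 => rfl
    | _ + 1 => rfl
  · match q, hq with
    | 0, _ => rfl

theorem Blocks.subst_op₂ (c : Config 0 2) (u : Config i j) (v : Config j k) :
    B.subst (op₂ c u v) = op₂ c (B.subst u) (B.subst v) := by
  refine Subtype.ext (Blocks.substFun_eq_of_comp (B := B) (B' := blocks₂ u v)
    (B'' := blocks₂ (B.subst u) (B.subst v)) c.1 (Nat.zero_le 2) (fun q => ?_) (fun q _ hq => ?_))
  · match q with
    | 0 => rfl
    | 1 => rfl
    | _ + 2 => rfl
  · match q, hq with
    | 0, _ => rfl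
    | 1, _ => rfl

theorem Blocks.subst_op₃ (c : Config 0 3) (u : Config i j) (v : Config j k) (w : Config k l) :
    B.subst (op₃ c u v w) = op₃ c (B.subst u) (B.subst v) (B.subst w) := by
  refine Subtype.ext (Blocks.substFun_eq_of_comp (B := B) (B' := blocks₃ u v w)
    (B'' := blocks₃ (B.subst u) (B.subst v) (B.subst w)) c.1 (Nat.zero_le 3) (fun q => ?_)
    (fun q _ hq => ?_))
  · match q with
    | 0 => rfl
    | 1 => rfl
    | 2 => rfl
    | _ + 3 => rfl
  · match q, hq with
    | 0, _ => rfl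
    | 1, _ => rfl
    | 2, _ => rfl

end blocks

end LittleIntervals

end

/-! ### The product, associativity and unit paths on configurations. -/

noncomputable section

open CategoryTheory Bicategory
open scoped unitInterval

universe u

namespace LittleIntervals

/-- The underlying tuple of intervals of a labelled configuration. -/
def ofConfig {i j : ℕ} (c : Config i j) : LittleIntervals (j - i) :=
  ofOrdered (fun q => (c.1 (i + q)).1) (fun q => (c.1 (i + q)).2.1)
    (fun q => (c.2.2.1 _ (by omega) (by omega)).1) (fun q => (c.2.2.1 _ (by omega) (by omega)).2.1)
    (fun q => (c.2.2.1 _ (by omega) (by omega)).2.2)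
    (fun q q' h => c.2.2.2.1 _ _ (by omega) (by simpa using h) (by omega))

theorem continuous_ofConfig (i j : ℕ) : Continuous (ofConfig (i := i) (j := j)) := by
  have h : ∀ x, Continuous fun c : Config i j => c.1 x := fun x =>
    (continuous_apply x).comp continuous_subtype_val
  exact continuous_of_endpoints (fun q => (h _).fst) fun q => (h _).snd.fst

/-- The pair of intervals `m`, as a labelled configuration. -/
def mConfig : Config 0 2 :=
  ⟨fun | 0 => (1 / 5, 2 / 5, 0) | 1 => (3 / 5, 4 / 5, 0) | _ => 0, by omega, fun q _ h => by
    interval_cases q <;> norm_num, fun q q' _ h h' => by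
    obtain rfl : q' = 1 := by omega
    obtain rfl : q = 0 := by omega
    norm_num, fun
    | 0, h => by simp at h
    | 1, h => by simp at h
    | _ + 2, _ => rfl⟩

/-- The path `assocPath`, as a path of labelled configurations. -/
def assocConfig (s : I) : Config 0 3 :=
  ⟨fun
    | 0 => ((13 + 2 * (s : ℝ)) / 50 - (1 + 4 * (s : ℝ)) / 25 / 2,
        (13 + 2 * (s : ℝ)) / 50 + (1 + 4 * (s : ℝ)) / 25 / 2, 0)
    | 1 => ((17 + 16 * (s : ℝ)) / 50 - 1 / 25 / 2, (17 + 16 * (s : ℝ)) / 50 + 1 / 25 / 2, 0)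
    | 2 => ((35 + 2 * (s : ℝ)) / 50 - (5 - 4 * (s : ℝ)) / 25 / 2,
        (35 + 2 * (s : ℝ)) / 50 + (5 - 4 * (s : ℝ)) / 25 / 2, 0)
    | _ => 0, by omega, fun q _ h => by
    have h0 := s.2.1
    have h1 := s.2.2
    interval_cases q <;> norm_num <;> refine ⟨?_, ?_, ?_⟩ <;> linarith, fun q q' _ h h' => by
    have h0 := s.2.1
    have h1 := s.2.2
    interval_cases q' <;> interval_cases q <;> norm_num <;> linarith, fun
    | 0, h => by simp at h
    | 1, h => by simp at h
    | 2, h => by simp at h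
    | _ + 3, _ => rfl⟩

/-- The path `leftUnitPath`, as a path of labelled configurations. -/
def leftConfig (s : I) : Config 0 1 :=
  ⟨fun | 0 => (3 / 5 * (1 - (s : ℝ)), 4 / 5 + 1 / 5 * (s : ℝ), 0) | _ => 0, by omega,
    fun q _ h => by
    have h0 := s.2.1
    have h1 := s.2.2
    interval_cases q
    norm_num
    refine ⟨?_, ?_, ?_⟩ <;> linarith, by omega, fun
    | 0, h => by simp at h
    | _ + 1, _ => rfl⟩

/-- The path `rightUnitPath`, as a path of labelled configurations. -/
def rightConfig (s : I) : Config 0 1 :=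
  ⟨fun | 0 => (1 / 5 * (1 - (s : ℝ)), 2 / 5 + 3 / 5 * (s : ℝ), 0) | _ => 0, by omega,
    fun q _ h => by
    have h0 := s.2.1
    have h1 := s.2.2
    interval_cases q
    norm_num
    refine ⟨?_, ?_, ?_⟩ <;> linarith, by omega, fun
    | 0, h => by simp at h
    | _ + 1, _ => rfl⟩

theorem continuous_assocConfig : Continuous assocConfig :=
  continuous_induced_rng.2 (continuous_pi fun
    | 0 | 1 | 2 => by simp only [assocConfig, Function.comp_def]; fun_prop
    | _ + 3 => continuous_const)

theorem continuous_leftConfig : Continuous leftConfig :=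
  continuous_induced_rng.2 (continuous_pi fun
    | 0 => by simp only [leftConfig, Function.comp_def]; fun_prop
    | _ + 1 => continuous_const)

theorem continuous_rightConfig : Continuous rightConfig :=
  continuous_induced_rng.2 (continuous_pi fun
    | 0 => by simp only [rightConfig, Function.comp_def]; fun_prop
    | _ + 1 => continuous_const)

theorem ofConfig_mConfig : ofConfig mConfig = m := by
  ext q <;> fin_cases q <;> simp [ofConfig, mConfig, m, ofOrdered]

theorem ofConfig_assocConfig (s : I) : ofConfig (assocConfig s) = assocPath s := by
  ext q <;> fin_cases q <;> simp [ofConfig, assocConfig, assocPath, ofOrdered]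

theorem ofConfig_leftConfig (s : I) : ofConfig (leftConfig s) = leftUnitPath s := by
  ext q <;> fin_cases q <;> simp [ofConfig, leftConfig, leftUnitPath, ofOrdered]

theorem ofConfig_rightConfig (s : I) : ofConfig (rightConfig s) = rightUnitPath s := by
  ext q <;> fin_cases q <;> simp [ofConfig, rightConfig, rightUnitPath, ofOrdered]

section
variable {i j k l n : ℕ}

/-- The product of configurations. -/
def mul (u : Config i j) (v : Config j k) : Config i k := op₂ mConfig u v

theorem continuous_mul {Z : Type*} [TopologicalSpace Z] {u : Z → Config i j} {v : Z → Config j k}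
    (hu : Continuous u) (hv : Continuous v) : Continuous fun z => mul (u z) (v z) :=
  continuous_op₂ continuous_const hu hv

/-- The formulas for `op₁`, `op₂`, `op₃` at a position reduce the identities between products below
to arithmetic of endpoints. -/
theorem op₁_val (c : Config 0 1) (u : Config i j) (x : ℕ) :
    (op₁ c u).1 x = if i ≤ x ∧ x < j then glue (c.1 0) (u.1 x) else 0 := by
  change substFun (bounds₁ i j) (blocks₁ u).d 0 1 c.1 x = _
  simp [substFun, blocks₁, bounds₁]

theorem op₂_val (c : Config 0 2) (u : Config i j) (v : Config j k) (x : ℕ) :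
    (op₂ c u v).1 x = (if i ≤ x ∧ x < j then glue (c.1 0) (u.1 x) else 0) +
      if j ≤ x ∧ x < k then glue (c.1 1) (v.1 x) else 0 := by
  change substFun (bounds₂ i j k) (blocks₂ u v).d 0 2 c.1 x = _
  simp [substFun, Finset.sum_range_succ, blocks₂, bounds₂]

theorem op₃_val (c : Config 0 3) (u : Config i j) (v : Config j k) (w : Config k l) (x : ℕ) :
    (op₃ c u v w).1 x = ((if i ≤ x ∧ x < j then glue (c.1 0) (u.1 x) else 0) +
      if j ≤ x ∧ x < k then glue (c.1 1) (v.1 x) else 0) +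
      if k ≤ x ∧ x < l then glue (c.1 2) (w.1 x) else 0 := by
  change substFun (bounds₃ i j k l) (blocks₃ u v w).d 0 3 c.1 x = _
  simp [substFun, Finset.sum_range_succ, blocks₃, bounds₃]

/-- The associativity path starts at the intervals of `m (m, 1)`, namely `(6/25, 7/25)`, `(8/25,
9/25)`, `(3/5, 4/5)`. The combinations of block tests excluded by `i ≤ j ≤ k ≤ l` are discarded by
`omega`. -/
theorem mul_mul_left (u : Config i j) (v : Config j k) (w : Config k l) :
    mul (mul u v) w = op₃ (assocConfig 0) u v w := by
  have h1 := u.2.1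
  have h2 := v.2.1
  have h3 := w.2.1
  refine Subtype.ext (funext fun x => ?_)
  simp only [mul, op₂_val, op₃_val]
  split_ifs <;> first | omega | (ext <;> simp [glue, mConfig, assocConfig] <;> ring)

/-- At time 1 the path has reached `(1/5, 2/5)`, `(16/25, 17/25)`, `(18/25, 19/25)`, which is `m (1,
m)`. -/
theorem mul_mul_right (u : Config i j) (v : Config j k) (w : Config k l) :
    mul u (mul v w) = op₃ (assocConfig 1) u v w := by
  have h1 := u.2.1
  have h2 := v.2.1
  have h3 := w.2.1
  refine Subtype.ext (funext fun x => ?_)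
  simp only [mul, op₂_val, op₃_val]
  split_ifs <;> first | omega | (ext <;> simp [glue, mConfig, assocConfig] <;> ring)

theorem emp_mul (u : Config i j) : mul (emp i) u = op₁ (leftConfig 0) u := by
  refine Subtype.ext (funext fun x => ?_)
  simp only [mul, op₂_val, op₁_val]
  split_ifs <;> first | omega | (ext <;> simp [glue, mConfig, leftConfig])

theorem mul_emp (u : Config i j) : mul u (emp j) = op₁ (rightConfig 0) u := by
  refine Subtype.ext (funext fun x => ?_)
  simp only [mul, op₂_val, op₁_val]
  split_ifs <;> first | omega | (ext <;> simp [glue, mConfig, rightConfig])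

theorem op₁_leftConfig_one (u : Config i j) : op₁ (leftConfig 1) u = u := by
  refine Subtype.ext (funext fun x => ?_)
  rw [op₁_val]
  split_ifs with h
  · ext <;> simp [glue, leftConfig] <;> ring
  · exact (u.2.2.2.2 x h).symm

theorem op₁_rightConfig_one (u : Config i j) : op₁ (rightConfig 1) u = u := by
  refine Subtype.ext (funext fun x => ?_)
  rw [op₁_val]
  split_ifs with h
  · ext <;> simp [glue, rightConfig] <;> ring
  · exact (u.2.2.2.2 x h).symm

/-- The product of paths of configurations. -/
def mulPath {u u' : Config i j} {v v' : Config j k} (p : Path u u') (q : Path v v') :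
    Path (mul u v) (mul u' v') where
  toFun t := mul (p t) (q t)
  source' := by simp
  target' := by simp
  continuous_toFun := continuous_mul p.continuous q.continuous

/-- The lift of the associativity path. -/
def assocLift (u : Config i j) (v : Config j k) (w : Config k l) :
    Path (mul (mul u v) w) (mul u (mul v w)) where
  toFun t := op₃ (assocConfig t) u v w
  source' := (mul_mul_left u v w).symm
  target' := (mul_mul_right u v w).symm
  continuous_toFun :=
    continuous_op₃ continuous_assocConfig continuous_const continuous_const continuous_const

/-- The lift of the left unit path. -/
def leftLift (u : Config i j) : Path (mul (emp i) u) u where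
  toFun t := op₁ (leftConfig t) u
  source' := (emp_mul u).symm
  target' := op₁_leftConfig_one u
  continuous_toFun := continuous_op₁ continuous_leftConfig continuous_const

/-- The lift of the reversed right unit path. -/
def rightLift (u : Config i j) : Path u (mul u (emp j)) where
  toFun t := op₁ (rightConfig (unitInterval.symm t)) u
  source' := by rw [unitInterval.symm_zero]; exact op₁_rightConfig_one u
  target' := by rw [unitInterval.symm_one]; exact (mul_emp u).symm
  continuous_toFun :=
    continuous_op₁ (continuous_rightConfig.comp unitInterval.continuous_symm) continuous_const

end

end LittleIntervals

/-! ### Evaluation of labelled configurations in the algebra. -/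

namespace LittleIntervalsAlgebra

open LittleIntervals

variable {X : Type u} [TopologicalSpace X] (A : LittleIntervalsAlgebra X)

/-- The arity of an evaluated configuration is `j - i`, which matches the arity produced by the
operad composition only up to a propositional equality. This lemma absorbs the cast. -/
theorem act_congr {n n' : ℕ} (h : n = n') {c : LittleIntervals n} {c' : LittleIntervals n'}
    {x : Fin n → X} {x' : Fin n' → X} (hl : ∀ q, c.left q = c'.left (Fin.cast h q))
    (hr : ∀ q, c.right q = c'.right (Fin.cast h q)) (hx : ∀ q, x q = x' (Fin.cast h q)) :
    A.act c x = A.act c' x' := by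
  subst h
  obtain rfl : c = c' := LittleIntervals.ext (funext hl) (funext hr)
  obtain rfl : x = x' := funext hx
  rfl

/-- The action on the points given by the labels of a configuration in a sequence of curves. -/
def ev (xs : ℕ → C(ℝ, X)) (i j : ℕ) : C(Config i j, X) where
  toFun c := A.act (ofConfig c) fun q => xs (i + q) (c.1 (i + q)).2.2
  continuous_toFun := by
    refine (A.continuous_act _).comp ((continuous_ofConfig i j).prodMk
      (continuous_pi fun q => (xs _).continuous.comp ?_))
    exact ((continuous_apply _).comp continuous_subtype_val).snd.snd

/-- The bridge between configurations and the algebra: after matching positions in the blocks with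
indices of the sigma type, it is the associativity axiom `act_comp`. -/
theorem ev_subst (xs : ℕ → C(ℝ, X)) (B : Blocks) {n : ℕ} (c : Config 0 n) :
    A.ev xs _ _ (B.subst c) =
      A.act (k := n) (ofConfig c) fun q => A.ev xs _ _ ⟨B.d q, B.mem q⟩ := by
  let k : Fin n → ℕ := fun q => B.b (q + 1) - B.b q
  -- The block lengths telescope, so the first `r` blocks occupy exactly the positions from `B.b 0`
  -- to `B.b r`.
  have hk : ∀ r, r ≤ n → ∑ q ∈ Finset.range r, (B.b (q + 1) - B.b q) = B.b r - B.b 0 :=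
    fun r _ => Finset.sum_range_tsub B.mono r
  have hN : B.b n - B.b 0 = ∑ q, k q := by
    rw [← hk n le_rfl, Fin.sum_univ_eq_sum_range (fun q => B.b (q + 1) - B.b q)]
  -- These are the points named by the labels of the inner configurations; substitution does not
  -- change labels.
  let x' : Fin (∑ q, k q) → X := fun s =>
    let p := finSigmaFinEquiv.symm s
    xs (B.b p.1 + p.2) (B.d p.1 (B.b p.1 + p.2)).2.2
  -- The value of `finSigmaFinEquiv` at a pair is the total length of the preceding blocks plus the
  -- offset. Relative to `B.b 0`, this is the absolute position.
  have key : ∀ q : Fin (B.b n - B.b 0), B.b 0 + q =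
      B.b (finSigmaFinEquiv.symm (Fin.cast hN q)).1 + (finSigmaFinEquiv.symm (Fin.cast hN q)).2 := by
    intro q
    set p := finSigmaFinEquiv.symm (Fin.cast hN q) with hp
    have e : finSigmaFinEquiv p = Fin.cast hN q := by simp [hp]
    have e' := congrArg Fin.val e
    rw [finSigmaFinEquiv_apply] at e'
    have e'' : ∑ r : Fin (p.1 : ℕ), k (Fin.castLE p.1.2.le r) = B.b p.1 - B.b 0 := by
      rw [← hk p.1 p.1.2.le, ← Fin.sum_univ_eq_sum_range (fun q => B.b (q + 1) - B.b q)]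
      rfl
    have h0 := B.mono (Nat.zero_le (p.1 : ℕ))
    simp only [Fin.val_cast] at e'
    omega
  have hval : ∀ p : (q : Fin n) × Fin (k q), (B.subst c).1 (B.b p.1 + p.2) =
      glue (c.1 p.1) (B.d p.1 (B.b p.1 + p.2)) := by
    intro p
    have h2 : (p.2 : ℕ) < B.b (p.1 + 1) - B.b p.1 := p.2.2
    exact substFun_of_mem B.mono (Nat.zero_le _) p.1.2 (by omega) (by omega)
  have hx' : ∀ p, x' (finSigmaFinEquiv p) =
      xs (B.b p.1 + p.2) (B.d p.1 (B.b p.1 + p.2)).2.2 := by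
    intro p
    simp only [x']
    rw [Equiv.symm_apply_apply]
  refine (A.act_congr (x' := x') (c' := LittleIntervals.comp (k := k) (n := n) (ofConfig c)
    fun q => ofConfig ⟨B.d q, B.mem q⟩) hN (fun q => ?_) (fun q => ?_) (fun q => ?_)).trans ?_
  · simp only [ofConfig, ofOrdered, LittleIntervals.comp, key, hval, zero_add]
    rfl
  · simp only [ofConfig, ofOrdered, LittleIntervals.comp, key, hval, zero_add]
    rfl
  · simp only [x', key, hval]
    rfl
  · rw [A.act_comp]
    simp only [hx']
    rfl

variable (xs : ℕ → C(ℝ, X)) {i j k l n : ℕ}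

theorem ev_op₁ (c : Config 0 1) (u : Config i j) :
    A.ev xs i j (op₁ c u) = A.act (k := 1) (ofConfig c) ![A.ev xs i j u] := by
  refine (A.ev_subst xs (blocks₁ u) c).trans (congrArg _ (funext fun q => ?_))
  fin_cases q
  rfl

theorem ev_op₂ (c : Config 0 2) (u : Config i j) (v : Config j k) :
    A.ev xs i k (op₂ c u v) = A.act (k := 2) (ofConfig c) ![A.ev xs i j u, A.ev xs j k v] := by
  refine (A.ev_subst xs (blocks₂ u v) c).trans (congrArg _ (funext fun q => ?_))
  fin_cases q <;> rfl

theorem ev_op₃ (c : Config 0 3) (u : Config i j) (v : Config j k) (w : Config k l) :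
    A.ev xs i l (op₃ c u v w) =
      A.act (k := 3) (ofConfig c) ![A.ev xs i j u, A.ev xs j k v, A.ev xs k l w] := by
  refine (A.ev_subst xs (blocks₃ u v w) c).trans (congrArg _ (funext fun q => ?_))
  fin_cases q <;> rfl

theorem ev_op₄ (c : Config 0 4) (u : Config i j) (v : Config j k) (w : Config k l)
    (z : Config l n) : A.ev xs i n (op₄ c u v w z) =
      A.act (k := 4) (ofConfig c)
        ![A.ev xs i j u, A.ev xs j k v, A.ev xs k l w, A.ev xs l n z] := by
  refine (A.ev_subst xs (blocks₄ u v w z) c).trans (congrArg _ (funext fun q => ?_))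
  fin_cases q <;> rfl

/-- The unit axiom of the algebra: a full interval with label `τ` evaluates to the point of its
curve at `τ`. -/
theorem ev_pnt (q : ℕ) (τ : ℝ) : A.ev xs q (q + 1) (pnt q τ) = xs q τ := by
  refine (A.act_congr (n' := 1) (c' := LittleIntervals.one) (x' := fun _ => xs q τ) (by omega)
    (fun r => ?_) (fun r => ?_) (fun r => ?_)).trans (A.act_one _)
  all_goals
    obtain ⟨r, hr⟩ := r
    obtain rfl : r = 0 := by omega
    simp [ofConfig, ofOrdered, pnt, LittleIntervals.one]

theorem ev_emp (q : ℕ) : A.ev xs q q (emp q) = A.act LittleIntervals.i Fin.elim0 :=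
  A.act_congr (Nat.sub_self q) (fun r => absurd r.2 (by omega)) (fun r => absurd r.2 (by omega))
    (fun r => absurd r.2 (by omega))

end LittleIntervalsAlgebra

end

/-! ### Strong transformations from homotopies. -/

noncomputable section

open CategoryTheory Bicategory
open scoped unitInterval Pseudofunctor.StrongTrans

universe w' v' u' w u

namespace Pi2

variable {X : Type u} [TopologicalSpace X]

theorem continuous_uncurry_lineReparam (φ ψ : Path (0 : I) 1) :
    Continuous fun r : I × I => lineReparam φ ψ r.1 r.2 :=
  Path.continuous_uncurry_iff.2 (continuous_lineReparam φ ψ)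

theorem lineReparam_zero (φ ψ : Path (0 : I) 1) : lineReparam φ ψ 0 = φ := by
  ext t; simp [lineReparam]

theorem lineReparam_one (φ ψ : Path (0 : I) 1) : lineReparam φ ψ 1 = ψ := by
  ext t; simp [lineReparam]

/-- Concatenation traverses two sides of a square: the pair `(rightParam, leftParam)` moves its
first coordinate while the second rests at 0, and then its second coordinate while the first rests
at 1. Interchanging the two by straight lines sweeps one boundary path of the square to the other.
-/
theorem trans_apply_eq_left {T : Type*} [TopologicalSpace T] {r s t : T} (p : Path r s)
    (q : Path s t) {v : I} (hv : (v : ℝ) ≤ 1 / 2) :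
    p.trans q v = p (rightParam v) ∧ leftParam v = 0 := by
  rw [Path.trans_apply, dif_pos hv]
  constructor
  · congr 1
    ext
    simp only [rightParam, Path.coe_mk_mk]
    rw [Set.projIcc_of_mem zero_le_one
      (show 2 * (v : ℝ) ∈ Set.Icc 0 1 from ⟨by linarith [v.2.1], by linarith⟩)]
  · exact Set.projIcc_of_le_left zero_le_one (by linarith)

theorem trans_apply_eq_right {T : Type*} [TopologicalSpace T] {r s t : T} (p : Path r s)
    (q : Path s t) {v : I} (hv : ¬(v : ℝ) ≤ 1 / 2) :
    p.trans q v = q (leftParam v) ∧ rightParam v = 1 := by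
  rw [Path.trans_apply, dif_neg hv]
  constructor
  · congr 1
    ext
    simp only [leftParam, Path.coe_mk_mk]
    rw [Set.projIcc_of_mem zero_le_one
      (show 2 * (v : ℝ) - 1 ∈ Set.Icc 0 1 from ⟨by linarith, by linarith [v.2.2]⟩)]
  · exact Set.projIcc_of_right_le zero_le_one (by linarith)

section square
variable {T : Type w} [TopologicalSpace T] {P : C(T, X)}

/-- A cell given by the diagonal sweep through a square is the image of a homotopy between the two
boundary paths of the square. -/
theorem IsCell.img_square {Φ : I → I → T} {r s s' t : T} {a b : Pi2 X} {f g : a ⟶ b} {η : f ⟶ g}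
    (hη : IsCell η fun u v =>
      P (Φ (lineReparam leftParam rightParam u v) (lineReparam rightParam leftParam u v)))
    (hΦ : Continuous fun r : I × I => Φ r.1 r.2) {p₁ : Path r s} {q₁ : Path s t} {q₂ : Path r s'}
    {p₂ : Path s' t} (hp₁ : ∀ v, p₁ v = Φ 0 v) (hq₁ : ∀ v, q₁ v = Φ v 1) (hq₂ : ∀ v, q₂ v = Φ v 0)
    (hp₂ : ∀ v, p₂ v = Φ 1 v) : Img P (p₁.trans q₁) (q₂.trans p₂) η := by
  refine hη.img (φ := fun u v => Φ (lineReparam leftParam rightParam u v)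
    (lineReparam rightParam leftParam u v)) ?_ (fun v => ?_) (fun v => ?_) (fun u => ?_) (fun u => ?_)
  · exact hΦ.comp (f := fun r : I × I => (lineReparam leftParam rightParam r.1 r.2,
      lineReparam rightParam leftParam r.1 r.2)) ((continuous_uncurry_lineReparam _ _).prodMk
      (continuous_uncurry_lineReparam _ _))
  · simp only [lineReparam_zero]
    by_cases hv : (v : ℝ) ≤ 1 / 2
    · rw [(trans_apply_eq_left p₁ q₁ hv).1, (trans_apply_eq_left p₁ q₁ hv).2, hp₁]
    · rw [(trans_apply_eq_right p₁ q₁ hv).1, (trans_apply_eq_right p₁ q₁ hv).2, hq₁]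
  · simp only [lineReparam_one]
    by_cases hv : (v : ℝ) ≤ 1 / 2
    · rw [(trans_apply_eq_left q₂ p₂ hv).1, (trans_apply_eq_left q₂ p₂ hv).2, hq₂]
    · rw [(trans_apply_eq_right q₂ p₂ hv).1, (trans_apply_eq_right q₂ p₂ hv).2, hp₂]
  · rw [Path.source, Path.source, ← hp₁, Path.source]
  · rw [Path.target, Path.target, ← hp₂, Path.target]

/-- The diagonal sweep through a product of two paths. -/
def sweep {S : Type*} {S' : Type*} [TopologicalSpace S] [TopologicalSpace S'] {r r' : S} {s s' : S'}
    (κ : Path r r') (p : Path s s') :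
    Path (((Path.refl r).prod p).trans (κ.prod (Path.refl s')))
      ((κ.prod (Path.refl s)).trans ((Path.refl r').prod p)) where
  toFun u :=
    { toFun v := (κ (lineReparam leftParam rightParam u v), p (lineReparam rightParam leftParam u v))
      source' := by simp
      target' := by simp }
  source' := by
    ext1; funext v
    simp only [lineReparam_zero, Path.coe_mk_mk]
    by_cases hv : (v : ℝ) ≤ 1 / 2
    -- The pair `κ`, `κ.symm` is an arbitrary composable pair; only the value of `leftParam v` is
    -- read off from it.
    · rw [(trans_apply_eq_left _ _ hv).1, (trans_apply_eq_left κ κ.symm hv).2]; simp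
    · rw [(trans_apply_eq_right _ _ hv).1, (trans_apply_eq_right κ κ.symm hv).2]; simp
  target' := by
    ext1; funext v
    simp only [lineReparam_one, Path.coe_mk_mk]
    by_cases hv : (v : ℝ) ≤ 1 / 2
    · rw [(trans_apply_eq_left _ _ hv).1, (trans_apply_eq_left κ κ.symm hv).2]; simp
    · rw [(trans_apply_eq_right _ _ hv).1, (trans_apply_eq_right κ κ.symm hv).2]; simp
  continuous_toFun := by
    rw [← Path.continuous_uncurry_iff]
    exact (κ.continuous.comp (continuous_uncurry_lineReparam _ _)).prodMk
      (p.continuous.comp (continuous_uncurry_lineReparam _ _))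

end square

/-- The boundary of a square in the space of paths commutes. -/
theorem comp_eq_of_square {a b : Pi2 X} {f g h k : a ⟶ b} {η : f ⟶ g} {θ : g ⟶ k} {η' : f ⟶ h}
    {θ' : h ⟶ k} (Ψ : C(I × I, Path a.pt b.pt)) (hη : IsCell η fun u t => Ψ (0, u) t)
    (hθ : IsCell θ fun u t => Ψ (u, 1) t) (hη' : IsCell η' fun u t => Ψ (u, 0) t)
    (hθ' : IsCell θ' fun u t => Ψ (1, u) t) : η ≫ θ = η' ≫ θ' := by
  obtain rfl : Ψ (0, 0) = f := Path.ext (funext fun t => (hη.isPath_source t).symm)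
  obtain rfl : Ψ (0, 1) = g := Path.ext (funext fun t => (hη.isPath_target t).symm)
  obtain rfl : Ψ (1, 0) = h := Path.ext (funext fun t => (hη'.isPath_target t).symm)
  obtain rfl : Ψ (1, 1) = k := Path.ext (funext fun t => (hθ.isPath_target t).symm)
  obtain ⟨R₁, rfl, h₁⟩ := hη
  obtain ⟨R₂, rfl, h₂⟩ := hθ
  obtain ⟨R₃, rfl, h₃⟩ := hη'
  obtain ⟨R₄, rfl, h₄⟩ := hθ'
  let e₁ : Path ((0 : I), (0 : I)) (0, 1) := (Path.refl 0).prod Path.id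
  let e₂ : Path ((0 : I), (1 : I)) (1, 1) := Path.id.prod (Path.refl 1)
  let e₃ : Path ((0 : I), (0 : I)) (1, 0) := Path.id.prod (Path.refl 0)
  let e₄ : Path ((1 : I), (0 : I)) (1, 1) := (Path.refl 1).prod Path.id
  have k₁ : R₁ = e₁.map Ψ.continuous := by ext u t; exact h₁ u t
  have k₂ : R₂ = e₂.map Ψ.continuous := by ext u t; exact h₂ u t
  have k₃ : R₃ = e₃.map Ψ.continuous := by ext u t; exact h₃ u t
  have k₄ : R₄ = e₄.map Ψ.continuous := by ext u t; exact h₄ u t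
  -- The square `I × I` is straight, so its two boundary paths from corner to corner are homotopic;
  -- `Ψ` carries this homotopy into the path space.
  have key : (e₁.trans e₂).Homotopic (e₃.trans e₄) := by
    refine ⟨{ toFun := fun r => Straight.mixPath r.1 (e₁.trans e₂) (e₃.trans e₄) r.2
              continuous_toFun := ?_, map_zero_left := ?_, map_one_left := ?_, prop' := ?_ }⟩
    · exact Path.continuous_uncurry_iff.2
        (Straight.continuous_mixPath continuous_id continuous_const continuous_const)
    · intro v; exact Straight.mix_zero _ _
    · intro v; exact Straight.mix_one _ _
    · rintro u v (rfl | hv)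
      · simp
      · obtain rfl : v = 1 := hv
        simp
  rw [k₁, k₂, k₃, k₄]
  change Path.Homotopic.Quotient.mk ((e₁.map Ψ.continuous).trans (e₂.map Ψ.continuous)) =
    Path.Homotopic.Quotient.mk ((e₃.map Ψ.continuous).trans (e₄.map Ψ.continuous))
  rw [← Path.map_trans, ← Path.map_trans]
  exact Quotient.sound (key.map Ψ)

/-- Two composable paths become segments of one curve on `ℝ`, which gives them a common straight
context. The two constant paths only fill the remaining slots of `chain_induction`. -/
theorem exists_chain {Y : Type u} [TopologicalSpace Y] {x y z : Y} (f : Path x y) (g : Path y z) :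
    ∃ Q : C(ℝ, Y), (∀ t, f t = Q (seg 0 1 t)) ∧ ∀ t, g t = Q (seg 1 2 t) :=
  chain_induction (motive := fun f g _ _ =>
    ∃ Q : C(ℝ, Y), (∀ t, f t = Q (seg 0 1 t)) ∧ ∀ t, g t = Q (seg 1 2 t))
    (fun Q => ⟨Q, fun _ => rfl, fun _ => rfl⟩) f g (Path.refl z) (Path.refl z)

end Pi2

/-- A functorial assignment of points, paths and homotopies of paths in `Y` to the cells of a
bicategory. -/
structure PathModel (B : Type u') [Bicategory.{w', v'} B] (Y : Type u) [TopologicalSpace Y] where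
  pt : B → Y
  arr {a b : B} : (a ⟶ b) → Path (pt a) (pt b)
  rep {a b : B} {f g : a ⟶ b} : (f ⟶ g) → Path (arr f) (arr g)
  arr_id (a : B) : arr (𝟙 a) = Path.refl (pt a)
  arr_comp {a b c : B} (f : a ⟶ b) (g : b ⟶ c) : arr (f ≫ g) = (arr f).trans (arr g)

namespace PathModel

variable {B : Type u'} [Bicategory.{w', v'} B] {X Y : Type u} [TopologicalSpace X]
  [TopologicalSpace Y] (D : PathModel B Y)

/-- The pseudofunctor `F` is the composite of the model with the map `F₀`. -/
structure Models (F : B ⥤ᵖ Pi2 X) (F₀ : Y → X) : Prop where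
  obj (a : B) : (F.obj a).pt = F₀ (D.pt a)
  map {a b : B} (f : a ⟶ b) : Pi2.IsPath (F.map f) fun t => F₀ (D.arr f t)
  map₂ {a b : B} {f g : a ⟶ b} (η : f ⟶ g) : Pi2.IsCell (F.map₂ η) fun u t => F₀ (D.rep η u t)
  mapId (a : B) : Pi2.IsCell (F.mapId a).hom fun _ _ => F₀ (D.pt a)
  mapComp {a b c : B} (f : a ⟶ b) (g : b ⟶ c) :
    Pi2.IsCell (F.mapComp f g).hom fun _ t => F₀ ((D.arr f).trans (D.arr g) t)

variable {D} (H : C(I × Y, X)) {F G : B ⥤ᵖ Pi2 X} {r r' : I} (κ : Path r r')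
  (hF : D.Models F fun y => H (r, y)) (hG : D.Models G fun y => H (r', y))

open Pi2

/-- The 1-cell components of the transformation induced by a homotopy. -/
def sweepApp (a : B) : F.obj a ⟶ G.obj a :=
  show Path (F.obj a).pt (G.obj a).pt from
    { toFun t := H (κ t, D.pt a)
      source' := by rw [hF.obj, κ.source]
      target' := by rw [hG.obj, κ.target] }

/-- The naturality 2-cells of the transformation induced by a homotopy. -/
def sweepNaturality {a b : B} (f : a ⟶ b) :
    F.map f ≫ sweepApp H κ hF hG b ≅ sweepApp H κ hF hG a ≫ G.map f :=
  cellOf (P := H) (Lifts.trans (p := (Path.refl r).prod (D.arr f))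
      (q := κ.prod (Path.refl (D.pt b))) (hF.map f) fun _ => rfl)
    (Lifts.trans (p := κ.prod (Path.refl (D.pt a))) (q := (Path.refl r').prod (D.arr f))
      (fun _ => rfl) (hG.map f)) (sweep κ (D.arr f))

theorem isCell_sweepNaturality {a b : B} (f : a ⟶ b) :
    IsCell (sweepNaturality H κ hF hG f).hom fun u t =>
      H (κ (lineReparam leftParam rightParam u t),
        D.arr f (lineReparam rightParam leftParam u t)) :=
  isCell_cellOf _ _ _

section context
variable {S : Type w} [TopologicalSpace S] (Q : C(S, Y))

/-- The homotopy `H`, in a context of points of `Y` parametrised by `S`. -/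
abbrev inContext : C(I × S, X) := H.comp ((ContinuousMap.id I).prodMap Q)

theorem lifts_sweepApp {s : S} {a : B} (h : D.pt a = Q s) :
    Lifts (inContext H Q) (κ.prod (Path.refl s)) (sweepApp H κ hF hG a) :=
  fun t => congrArg (fun y => H (κ t, y)) h

include hF in
omit κ hG in
theorem lifts_map {s s' : S} {p : Path s s'} {a b : B} {f : a ⟶ b}
    (h : ∀ t, D.arr f t = Q (p t)) : Lifts (inContext H Q) ((Path.refl r).prod p) (F.map f) :=
  fun t => (hF.map f t).trans (congrArg (fun y => H (r, y)) (h t))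

/-- The context `S` parametrises just those points of `Y` that occur in an axiom. The sweep then
takes place in `I × S`, which is straight whenever `S` is, although `Y` need not be. -/
theorem img_sweepNaturality {s s' : S} {p : Path s s'} {a b : B} {f : a ⟶ b}
    (h : ∀ t, D.arr f t = Q (p t)) :
    Img (inContext H Q) (((Path.refl r).prod p).trans (κ.prod (Path.refl s')))
      ((κ.prod (Path.refl s)).trans ((Path.refl r').prod p))
      (sweepNaturality H κ hF hG f).hom := by
  refine ⟨sweep κ p, ?_⟩
  convert isCell_sweepNaturality H κ hF hG f using 4
  exact congrArg (fun y => H (_, y)) (h _).symm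

end context

/-- The strong transformation induced by a homotopy. -/
def sweepTrans : F ⟶ G where
  app := sweepApp H κ hF hG
  naturality := sweepNaturality H κ hF hG
  naturality_naturality {a b f g} η := by
    -- The first coordinate performs the sweep and the second follows the representative `D.rep η`.
    -- The sides of this square are the two whiskered images of `η` and the naturality cells at `f`
    -- and `g`.
    let Ψ : C(I × I, Path (F.obj a).pt (G.obj b).pt) :=
      ⟨fun z =>
        { toFun t := H (κ (lineReparam leftParam rightParam z.1 t),
            D.rep η z.2 (lineReparam rightParam leftParam z.1 t))
          source' := by simp [hF.obj]
          target' := by simp [hG.obj] }, by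
        rw [← Path.continuous_uncurry_iff]
        have h1 : Continuous fun z : (I × I) × I => lineReparam leftParam rightParam z.1.1 z.2 :=
          (continuous_uncurry_lineReparam _ _).comp (f := fun z : (I × I) × I => (z.1.1, z.2))
            (by fun_prop)
        have h2 : Continuous fun z : (I × I) × I => lineReparam rightParam leftParam z.1.1 z.2 :=
          (continuous_uncurry_lineReparam _ _).comp (f := fun z : (I × I) × I => (z.1.1, z.2))
            (by fun_prop)
        change Continuous fun z : (I × I) × I => H (κ (lineReparam leftParam rightParam z.1.1 z.2),
          D.rep η z.1.2 (lineReparam rightParam leftParam z.1.1 z.2))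
        fun_prop⟩
    refine comp_eq_of_square Ψ ?_ ?_ ?_ ?_
    · obtain ⟨R, hR, hR'⟩ := hF.map₂ η
      rw [← hR]
      refine ⟨R.map (f := fun p => Path.trans (X := X) p (sweepApp H κ hF hG b)) (by fun_prop), rfl,
        fun u t => ?_⟩
      change Path.trans (X := X) (R u) (sweepApp H κ hF hG b) t =
        H (κ (lineReparam leftParam rightParam 0 t), D.rep η u (lineReparam rightParam leftParam 0 t))
      rw [lineReparam_zero, lineReparam_zero]
      by_cases ht : (t : ℝ) ≤ 1 / 2
      · rw [(trans_apply_eq_left _ _ ht).1, (trans_apply_eq_left κ κ.symm ht).2, hR', κ.source]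
      · rw [(trans_apply_eq_right _ _ ht).1, (trans_apply_eq_right κ κ.symm ht).2, Path.target]
        rfl
    · convert isCell_sweepNaturality H κ hF hG g using 4
      simp [Ψ]
    · convert isCell_sweepNaturality H κ hF hG f using 4
      simp [Ψ]
    · obtain ⟨R, hR, hR'⟩ := hG.map₂ η
      rw [← hR]
      refine ⟨R.map (f := fun p => Path.trans (X := X) (sweepApp H κ hF hG a) p) (by fun_prop), rfl,
        fun u t => ?_⟩
      change Path.trans (X := X) (sweepApp H κ hF hG a) (R u) t =
        H (κ (lineReparam leftParam rightParam 1 t), D.rep η u (lineReparam rightParam leftParam 1 t))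
      rw [lineReparam_one, lineReparam_one]
      by_cases ht : (t : ℝ) ≤ 1 / 2
      · rw [(trans_apply_eq_left _ _ ht).1, (trans_apply_eq_left κ κ.symm ht).2, Path.source]
        rfl
      · rw [(trans_apply_eq_right _ _ ht).1, (trans_apply_eq_right κ κ.symm ht).2, hR', κ.target]
  naturality_id a := by
    -- A single object needs only a constant context, in which the identity 1-cell is lifted to the
    -- constant path at 0.
    let Q : C(I, Y) := ContinuousMap.const I (D.pt a)
    have hQ : ∀ t, D.arr (𝟙 a) t = Q (Path.refl (0 : I) t) := fun t => by rw [D.arr_id]; rfl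
    have hI : ∀ {r : I} {F : B ⥤ᵖ Pi2 X}, D.Models F (fun y => H (r, y)) →
        Img (inContext H Q) ((Path.refl r).prod (Path.refl (0 : I))) (Path.refl (r, (0 : I)))
          (F.mapId a).hom := fun hF =>
      (hF.mapId a).img (φ := fun _ _ => (_, 0)) continuous_const (fun _ => rfl) (fun _ => rfl)
        (fun _ => rfl) (fun _ => rfl)
    have l := lifts_sweepApp H κ hF hG Q (s := 0) (a := a) rfl
    exact ((img_sweepNaturality H κ hF hG Q hQ).comp ((hI hG).whiskerLeft l)).unique
      (((hI hF).whiskerRight l).comp ((img_leftUnitor l).comp (img_rightUnitor l).inv))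
  naturality_comp {a b c} f g := by
    -- With `f` and `g` traced on one curve, all cells of the axiom lift to `I × ℝ`.
    obtain ⟨Q, hf, hg⟩ := exists_chain (D.arr f) (D.arr g)
    have hc : ∀ t, (D.arr f).trans (D.arr g) t = Q ((seg 0 1).trans (seg 1 2) t) := by
      intro t
      rw [Path.trans_apply, Path.trans_apply]
      split_ifs
      · exact hf _
      · exact hg _
    have hfg : ∀ t, D.arr (f ≫ g) t = Q ((seg 0 1).trans (seg 1 2) t) := by
      rwa [D.arr_comp]
    have ha : D.pt a = Q 0 := by simpa using hf 0
    have hb : D.pt b = Q 1 := by simpa using hf 1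
    have hc' : D.pt c = Q 2 := by simpa using hg 1
    -- Pairing a concatenation with a constant path is pointwise the concatenation of the pairings,
    -- so a constant homotopy lifts the composition constraint.
    have hI : ∀ {r : I} {F : B ⥤ᵖ Pi2 X}, D.Models F (fun y => H (r, y)) →
        Img (inContext H Q) ((Path.refl r).prod ((seg 0 1).trans (seg 1 2)))
          (((Path.refl r).prod (seg 0 1)).trans ((Path.refl r).prod (seg 1 2)))
          (F.mapComp f g).hom := by
      intro r F hF
      refine IsCell.img (φ := fun _ t => (r, (seg 0 1).trans (seg 1 2) t)) ?_ (by fun_prop)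
        (fun v => rfl) (fun v => ?_) (by simp) (by simp)
      · convert hF.mapComp f g using 3
        exact congrArg (fun y => H (r, y)) (hc _).symm
      · rw [Path.trans_apply, Path.trans_apply]
        split_ifs <;> rfl
    have la := lifts_sweepApp H κ hF hG Q ha
    have lb := lifts_sweepApp H κ hF hG Q hb
    have lc := lifts_sweepApp H κ hF hG Q hc'
    have F₁ := lifts_map H hF Q hf
    have F₂ := lifts_map H hF Q hg
    have G₁ := lifts_map H hG Q hf
    have G₂ := lifts_map H hG Q hg
    exact ((img_sweepNaturality H κ hF hG Q hfg).comp ((hI hG).whiskerLeft la)).unique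
      (((hI hF).whiskerRight lc).comp ((img_associator F₁ F₂ lc).comp
        (((img_sweepNaturality H κ hF hG Q hg).whiskerLeft F₁).comp
          ((img_associator F₁ lb G₂).inv.comp
            (((img_sweepNaturality H κ hF hG Q hf).whiskerRight G₂).comp
              (img_associator la G₁ G₂))))))

end PathModel

end

/-! ### Adjoint equivalences from homotopies. -/

noncomputable section

open CategoryTheory Bicategory
open scoped unitInterval Pseudofunctor.StrongTrans

universe w' v' u' w u

namespace PathModel

open Pi2

/-- The contraction of `γ γ⁻¹`. -/
def unitLine : Path (Path.refl (0 : I)) (Path.id.trans Path.id.symm) := Straight.line _ _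

/-- The contraction of `γ⁻¹ γ`. -/
def counitLine : Path (Path.id.symm.trans Path.id) (Path.refl (1 : I)) := Straight.line _ _

variable {B : Type u'} [Bicategory.{w', v'} B] {X Y : Type u} [TopologicalSpace X]
  [TopologicalSpace Y] {D : PathModel B Y} (H : C(I × Y, X)) {F G : B ⥤ᵖ Pi2 X}
  (hF : D.Models F fun y => H (0, y)) (hG : D.Models G fun y => H (1, y))

/-- The restriction of a homotopy to a point. -/
abbrev atPoint (y : Y) : C(I, X) := H.comp ((ContinuousMap.id I).prodMk (ContinuousMap.const I y))

/-- The components of the unit. -/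
def unitApp (a : B) : 𝟙 (F.obj a) ≅
    sweepApp H Path.id hF hG a ≫ sweepApp H Path.id.symm hG hF a :=
  cellOf (P := atPoint H (D.pt a)) (p := Path.refl (0 : I)) (q := Path.id.trans Path.id.symm)
    (lifts_id (hF.obj a).symm) (Lifts.trans (fun _ => rfl) fun _ => rfl) unitLine

/-- The components of the counit. -/
def counitApp (a : B) : sweepApp H Path.id.symm hG hF a ≫ sweepApp H Path.id hF hG a ≅
    𝟙 (G.obj a) :=
  cellOf (P := atPoint H (D.pt a)) (p := Path.id.symm.trans Path.id) (q := Path.refl (1 : I))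
    (Lifts.trans (fun _ => rfl) fun _ => rfl) (lifts_id (hG.obj a).symm) counitLine

theorem isCell_unitApp (a : B) :
    IsCell (unitApp H hF hG a).hom fun u t => H (unitLine u t, D.pt a) :=
  isCell_cellOf _ _ _

theorem isCell_counitApp (a : B) :
    IsCell (counitApp H hF hG a).hom fun u t => H (counitLine u t, D.pt a) :=
  isCell_cellOf _ _ _

section context
variable {S : Type w} [TopologicalSpace S] (Q : C(S, Y)) {s : S} {a : B} (h : D.pt a = Q s)
include h

theorem img_unitApp : Img (inContext H Q) (Path.refl ((0 : I), s))
    ((Path.id.prod (Path.refl s)).trans (Path.id.symm.prod (Path.refl s)))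
    (unitApp H hF hG a).hom := by
  refine IsCell.img (φ := fun u t => (unitLine u t, s)) ?_ ?_ (fun t => ?_) (fun t => ?_)
    (by simp) (by simp)
  · convert isCell_unitApp H hF hG a using 4
    exact congrArg (fun y => H (_, y)) h.symm
  · exact (Path.continuous_uncurry_iff.2 unitLine.continuous).prodMk continuous_const
  · simp
  · rw [unitLine.target, Path.trans_apply, Path.trans_apply]
    split_ifs <;> rfl

theorem img_counitApp : Img (inContext H Q)
    ((Path.id.symm.prod (Path.refl s)).trans (Path.id.prod (Path.refl s)))
    (Path.refl ((1 : I), s)) (counitApp H hF hG a).hom := by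
  refine IsCell.img (φ := fun u t => (counitLine u t, s)) ?_ ?_ (fun t => ?_) (fun t => ?_)
    (by simp) (by simp)
  · convert isCell_counitApp H hF hG a using 4
    exact congrArg (fun y => H (_, y)) h.symm
  · exact (Path.continuous_uncurry_iff.2 counitLine.continuous).prodMk continuous_const
  · rw [counitLine.source, Path.trans_apply, Path.trans_apply]
    split_ifs <;> rfl
  · simp

end context

/-- The adjoint equivalence induced by a homotopy. -/
def sweepEquivalence : F ≌ G where
  hom := sweepTrans H Path.id hF hG
  inv := sweepTrans H Path.id.symm hG hF
  unit := Pseudofunctor.StrongTrans.isoMk (unitApp H hF hG) fun {a b} f => by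
    -- The path underlying `f` serves as its own context and `f` lifts to the identity path of `I`.
    -- The modification axiom thus compares two homotopies in `I × I`.
    let Q : C(I, Y) := ⟨D.arr f, (D.arr f).continuous⟩
    have hQ : ∀ t, D.arr f t = Q (Path.id t) := fun t => rfl
    have ha : D.pt a = Q 0 := (D.arr f).source.symm
    have hb : D.pt b = Q 1 := (D.arr f).target.symm
    have F₁ := lifts_map H hF Q hQ
    have G₁ := lifts_map H hG Q hQ
    have la := lifts_sweepApp H Path.id hF hG Q ha
    have lb := lifts_sweepApp H Path.id hF hG Q hb
    have la' := lifts_sweepApp H Path.id.symm hG hF Q ha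
    have lb' := lifts_sweepApp H Path.id.symm hG hF Q hb
    have n := img_sweepNaturality H Path.id hF hG Q hQ
    have n' := img_sweepNaturality H Path.id.symm hG hF Q hQ
    rw [Pseudofunctor.StrongTrans.categoryStruct_comp_naturality_hom,
      Pseudofunctor.StrongTrans.categoryStruct_id_naturality_hom]
    exact ((Img.whiskerLeft F₁ (img_unitApp H hF hG Q hb)).comp
      ((img_associator F₁ lb lb').inv.comp ((n.whiskerRight lb').comp
        ((img_associator la G₁ lb').comp ((n'.whiskerLeft la).comp
          (img_associator la la' F₁).inv))))).unique
      (((img_rightUnitor F₁).comp (img_leftUnitor F₁).inv).comp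
        ((img_unitApp H hF hG Q ha).whiskerRight F₁))
  counit := Pseudofunctor.StrongTrans.isoMk (counitApp H hF hG) fun {a b} f => by
    let Q : C(I, Y) := ⟨D.arr f, (D.arr f).continuous⟩
    have hQ : ∀ t, D.arr f t = Q (Path.id t) := fun t => rfl
    have ha : D.pt a = Q 0 := (D.arr f).source.symm
    have hb : D.pt b = Q 1 := (D.arr f).target.symm
    have F₁ := lifts_map H hF Q hQ
    have G₁ := lifts_map H hG Q hQ
    have la := lifts_sweepApp H Path.id hF hG Q ha
    have lb := lifts_sweepApp H Path.id hF hG Q hb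
    have la' := lifts_sweepApp H Path.id.symm hG hF Q ha
    have lb' := lifts_sweepApp H Path.id.symm hG hF Q hb
    have n := img_sweepNaturality H Path.id hF hG Q hQ
    have n' := img_sweepNaturality H Path.id.symm hG hF Q hQ
    rw [Pseudofunctor.StrongTrans.categoryStruct_comp_naturality_hom,
      Pseudofunctor.StrongTrans.categoryStruct_id_naturality_hom]
    exact ((Img.whiskerLeft G₁ (img_counitApp H hF hG Q hb)).comp
      ((img_rightUnitor G₁).comp (img_leftUnitor G₁).inv)).unique
      (((img_associator G₁ lb' lb).inv.comp ((n'.whiskerRight lb).comp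
        ((img_associator la' F₁ lb).comp ((n.whiskerLeft la').comp
          (img_associator la' la G₁).inv)))).comp
        ((img_counitApp H hF hG Q ha).whiskerRight G₁))
  left_triangle := by
    refine Iso.ext (Pseudofunctor.StrongTrans.homCategory.ext fun a => ?_)
    -- Modifications are equal when their components are. Over one object the triangle identity
    -- compares homotopies along the direction of `H` alone, so the context is constant.
    let Q : C(I, Y) := ContinuousMap.const I (D.pt a)
    have ha : D.pt a = Q 0 := rfl
    have la := lifts_sweepApp H Path.id hF hG Q ha
    have la' := lifts_sweepApp H Path.id.symm hG hF Q ha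
    have hu := img_unitApp H hF hG Q ha
    have hc := img_counitApp H hF hG Q ha
    simp only [leftZigzagIso_hom, leftZigzag, bicategoricalComp,
      BicategoricalCoherence.assoc_iso, BicategoricalCoherence.refl_iso,
      BicategoricalCoherence.whiskerRight_iso, Iso.trans_hom, whiskerRightIso_hom, Iso.refl_hom,
      id_whiskerRight, Category.comp_id]
    exact ((hu.whiskerRight la).comp ((img_associator la la' la).comp
      (hc.whiskerLeft la))).unique ((img_leftUnitor la).comp (img_rightUnitor la).inv)

-- An existence statement that records only the paths and homotopies representing the cells; the
-- later arguments need nothing else about the equivalence.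
include hF hG in
theorem exists_sweepEquivalence : ∃ e : F ≌ G,
    (∀ a, IsPath (e.hom.app a) fun t => H (t, D.pt a)) ∧
    (∀ {a b : B} (f : a ⟶ b), IsCell (e.hom.naturality f).hom fun u t =>
      H (lineReparam leftParam rightParam u t,
        D.arr f (lineReparam rightParam leftParam u t))) ∧
    (∀ a, IsPath (e.inv.app a) fun t => H (σ t, D.pt a)) ∧
    (∀ {a b : B} (f : a ⟶ b), IsCell (e.inv.naturality f).hom fun u t =>
      H (σ (lineReparam leftParam rightParam u t),
        D.arr f (lineReparam rightParam leftParam u t))) ∧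
    (∀ a, IsCell (e.unit.hom.as.app a) fun u t => H (unitLine u t, D.pt a)) ∧
    ∀ a, IsCell (e.counit.hom.as.app a) fun u t => H (counitLine u t, D.pt a) :=
  ⟨sweepEquivalence H hF hG, fun _ _ => rfl, isCell_sweepNaturality H Path.id hF hG,
    fun _ _ => rfl, isCell_sweepNaturality H Path.id.symm hG hF, isCell_unitApp H hF hG,
    isCell_counitApp H hF hG⟩

end PathModel

end

/-! ### The tensor and unit functors, and models of their composites. -/

noncomputable section

open CategoryTheory Bicategory
open scoped unitInterval Pseudofunctor.StrongTrans

universe w' v' u' w u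

namespace LittleIntervalsAlgebra

open Pi2 LittleIntervals

variable {X : Type u} [TopologicalSpace X] (A : LittleIntervalsAlgebra X)

/-- The homotopy given by the action of a path in the operad. -/
def actHomotopy {k : ℕ} (γ : C(I, LittleIntervals k)) : C(I × (Fin k → X), X) where
  toFun z := A.act (γ z.1) z.2
  continuous_toFun := (A.continuous_act k).comp
    (f := fun z : I × (Fin k → X) => (γ z.1, z.2)) (by fun_prop)

/-- A path in the operad induces an adjoint equivalence between pseudofunctors modelled on the
action of its endpoints. -/
theorem exists_isEquivalenceOf {B : Type u'} [Bicategory.{w', v'} B] {F G : B ⥤ᵖ Pi2 X} {k : ℕ}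
    (γ : C(I, LittleIntervals k)) (D : PathModel B (Fin k → X)) (hF : D.Models F (A.act (γ 0)))
    (hG : D.Models G (A.act (γ 1))) :
    ∃ e : F ≌ G, A.IsEquivalenceOf e γ D.pt fun f => D.arr f := by
  obtain ⟨e, h₁, h₂, h₃, h₄, h₅, h₆⟩ :=
    PathModel.exists_sweepEquivalence (A.actHomotopy γ) hF hG
  let g : Path (γ 0) (γ 1) := Path.id.map γ.continuous
  have hγ : Continuous fun p : Path (0 : I) 0 => p.map γ.continuous := by
    rw [← Path.continuous_uncurry_iff]
    change Continuous fun r : Path (0 : I) 0 × I => γ (r.1 r.2)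
    fun_prop
  have hγ' : Continuous fun p : Path (1 : I) 1 => p.map γ.continuous := by
    rw [← Path.continuous_uncurry_iff]
    change Continuous fun r : Path (1 : I) 1 × I => γ (r.1 r.2)
    fun_prop
  -- The contractions in `I` are carried to the operad by `γ`. Postcomposition preserves
  -- concatenation strictly, so only the names of the endpoints have to be adjusted.
  refine ⟨e, h₁, h₂, h₃, h₄, ⟨g, (PathModel.unitLine.map hγ).cast rfl ?_, fun t => rfl, h₅⟩,
    ⟨g, (PathModel.counitLine.map hγ').cast ?_ rfl, fun t => rfl, h₆⟩⟩
  · exact (Path.map_trans Path.id Path.id.symm γ.continuous).symm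
  · exact (Path.map_trans Path.id.symm Path.id γ.continuous).symm

section tensor

omit A in
theorem _root_.Pi2.IsCell.congr {a b : Pi2 X} {f g : a ⟶ b} {η : f ⟶ g} {φ ψ : I → I → X}
    (hη : IsCell η φ) (h : ∀ u t, φ u t = ψ u t) : IsCell η ψ := by
  obtain ⟨R, rfl, hR⟩ := hη
  exact ⟨R, rfl, fun u t => (hR u t).trans (h u t)⟩

theorem isPath_tensor {a b : Pi2 X × Pi2 X} (f : a ⟶ b) {φ ψ : I → X} (h₁ : IsPath f.1 φ)
    (h₂ : IsPath f.2 ψ) : IsPath (A.tensor.map f) fun t => A.act m ![φ t, ψ t] := fun t =>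
  congrArg₂ (fun x y => A.act m ![x, y]) (h₁ t) (h₂ t)

theorem isCell_tensor {a b : Pi2 X × Pi2 X} {f g : a ⟶ b} (η : f ⟶ g) {φ ψ : I → I → X}
    (h₁ : IsCell η.1 φ) (h₂ : IsCell η.2 ψ) :
    IsCell (A.tensor.map₂ η) fun u t => A.act m ![φ u t, ψ u t] := by
  obtain ⟨η₁, η₂⟩ := η
  obtain ⟨R, rfl, hR⟩ := h₁
  obtain ⟨S, rfl, hS⟩ := h₂
  exact ⟨((R.prod S).map (prodPath _ _ _ _).continuous).map (mapPath A.mul _ _).continuous, rfl,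
    fun u t => congrArg₂ (fun x y => A.act m ![x, y]) (hR u t) (hS u t)⟩

omit A in
theorem isCell_map₂ {Y : Type u} [TopologicalSpace Y] (F : C(Y, X)) {a b : Pi2 Y} {f g : a ⟶ b}
    {η : f ⟶ g} {φ : I → I → Y} (h : IsCell η φ) :
    IsCell ((Pi2.map F).map₂ η) fun u t => F (φ u t) := by
  obtain ⟨R, rfl, hR⟩ := h
  exact ⟨R.map (mapPath F _ _).continuous, rfl, fun u t => congrArg F (hR u t)⟩

/-- The constraint of a composite of strict pseudofunctors is a composite of strictness equalities,
hence again a constant homotopy; likewise for `mapComp`. -/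
theorem isCell_tensor_mapId (a : Pi2 X × Pi2 X) :
    IsCell (A.tensor.mapId a).hom fun _ _ => A.act m ![a.1.pt, a.2.pt] :=
  (isCell_map₂ A.mul (isCell_eqToHom (φ := fun _ => (a.1.pt, a.2.pt))
    ((Pi2.prodComparison X X).map_id a) fun _ => rfl)).comp_const
    (isCell_eqToHom (φ := fun _ => A.act m ![a.1.pt, a.2.pt])
      ((Pi2.map A.mul).map_id _) fun _ => rfl)

theorem isCell_tensor_mapComp {a b c : Pi2 X × Pi2 X} (f : a ⟶ b) (g : b ⟶ c) :
    IsCell (A.tensor.mapComp f g).hom fun _ t =>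
      A.act m ![Path.trans (X := X) f.1 g.1 t, Path.trans (X := X) f.2 g.2 t] :=
  (isCell_map₂ A.mul (isCell_eqToHom
    (φ := fun t => (Path.trans (X := X) f.1 g.1 t, Path.trans (X := X) f.2 g.2 t))
    ((Pi2.prodComparison X X).map_comp f g) fun _ => rfl)).comp_const
    (isCell_eqToHom (φ := fun _ => A.mul _)
      ((Pi2.map A.mul).map_comp _ _) fun _ => rfl)

section comp
variable {B : Type u'} [Bicategory.{w', v'} B] (F : B ⥤ᵖ (Pi2 X × Pi2 X))

theorem isCell_comp_tensor_mapId {a : B} {x y : X} (h₁ : IsCell (F.mapId a).hom.1 fun _ _ => x)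
    (h₂ : IsCell (F.mapId a).hom.2 fun _ _ => y) :
    IsCell ((F.comp A.tensor).mapId a).hom fun _ _ => A.act m ![x, y] :=
  (A.isCell_tensor (F.mapId a).hom h₁ h₂).comp_const (A.isCell_tensor_mapId _)

theorem isCell_comp_tensor_mapComp {a b c : B} {f : a ⟶ b} {g : b ⟶ c} {φ ψ : I → X}
    (h₁ : IsCell (F.mapComp f g).hom.1 fun _ => φ) (h₂ : IsCell (F.mapComp f g).hom.2 fun _ => ψ) :
    IsCell ((F.comp A.tensor).mapComp f g).hom fun _ t => A.act m ![φ t, ψ t] :=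
  (A.isCell_tensor (F.mapComp f g).hom h₁ h₂).comp_const (A.isCell_tensor_mapComp _ _)

end comp

end tensor

section models

/-- The path of triples given by three paths. -/
def vecPath₃ {x x' y y' z z' : X} (p : Path x x') (q : Path y y') (r : Path z z') :
    Path ![x, y, z] ![x', y', z'] where
  toFun t := ![p t, q t, r t]
  source' := by simp
  target' := by simp
  continuous_toFun := continuous_pi fun j => by fin_cases j <;> simp <;> fun_prop

/-- The path of one-element tuples given by a path. -/
def vecPath₁ {x x' : X} (p : Path x x') : Path ![x] ![x'] where
  toFun t := ![p t]
  source' := by simp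
  target' := by simp
  continuous_toFun := continuous_pi fun j => by fin_cases j; simp; fun_prop

theorem vecPath₃_trans {x x' x'' y y' y'' z z' z'' : X} (p : Path x x') (p' : Path x' x'')
    (q : Path y y') (q' : Path y' y'') (r : Path z z') (r' : Path z' z'') :
    vecPath₃ (p.trans p') (q.trans q') (r.trans r') =
      (vecPath₃ p q r).trans (vecPath₃ p' q' r') := by
  ext1
  funext t
  simp only [vecPath₃, Path.coe_mk_mk, Path.trans_apply]
  split_ifs <;> rfl

theorem vecPath₁_trans {x x' x'' : X} (p : Path x x') (p' : Path x' x'') :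
    vecPath₁ (p.trans p') = (vecPath₁ p).trans (vecPath₁ p') := by
  ext1
  funext t
  simp only [vecPath₁, Path.coe_mk_mk, Path.trans_apply]
  split_ifs <;> rfl

/-- A homotopy representing a 2-cell. -/
def repr {a b : Pi2 X} {f g : a ⟶ b} (η : f ⟶ g) : Path (X := Path a.pt b.pt) f g :=
  Quotient.out (s := Path.Homotopic.setoid (X := Path a.pt b.pt) f g) η

/-- Representatives are chosen cell by cell, without compatibility with composition. `PathModel.rep`
obeys no laws, since naturality in 2-cells concerns one representative at a time. -/
theorem isCell_repr {a b : Pi2 X} {f g : a ⟶ b} (η : f ⟶ g) :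
    IsCell η fun u t => repr η u t :=
  ⟨repr η, Quotient.out_eq _, fun _ _ => rfl⟩

/-- The tautological model of `(Π₂X × Π₂X) × Π₂X` in triples. -/
def tripleModel (X : Type u) [TopologicalSpace X] :
    PathModel ((Pi2 X × Pi2 X) × Pi2 X) (Fin 3 → X) where
  pt a := ![a.1.1.pt, a.1.2.pt, a.2.pt]
  arr {a b} f := vecPath₃ (x := a.1.1.pt) (x' := b.1.1.pt) (y := a.1.2.pt) (y' := b.1.2.pt)
    (z := a.2.pt) (z' := b.2.pt) f.1.1 f.1.2 f.2
  rep η :=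
    { toFun u := vecPath₃ (repr η.1.1 u) (repr η.1.2 u) (repr η.2 u)
      source' := by simp
      target' := by simp
      continuous_toFun := by
        rw [← Path.continuous_uncurry_iff]
        have h₁ := Path.continuous_uncurry_iff.2 (repr η.1.1).continuous
        have h₂ := Path.continuous_uncurry_iff.2 (repr η.1.2).continuous
        have h₃ := Path.continuous_uncurry_iff.2 (repr η.2).continuous
        exact continuous_pi fun j => by
          fin_cases j
          · exact h₁
          · exact h₂
          · exact h₃ }
  arr_id a := by ext t j; fin_cases j <;> rfl
  arr_comp f g := vecPath₃_trans _ _ _ _ _ _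

/-- The model of `* × Π₂X` in points. -/
def rightModel (X : Type u) [TopologicalSpace X] :
    PathModel (PointBicategory × Pi2 X) (Fin 1 → X) where
  pt a := ![a.2.pt]
  arr {a b} f := vecPath₁ (x := a.2.pt) (x' := b.2.pt) f.2
  rep η :=
    { toFun u := vecPath₁ (repr η.2 u)
      source' := by simp
      target' := by simp
      continuous_toFun := by
        rw [← Path.continuous_uncurry_iff]
        have h₁ := Path.continuous_uncurry_iff.2 (repr η.2).continuous
        exact continuous_pi fun j => by
          fin_cases j
          exact h₁ }
  arr_id a := by ext t j; fin_cases j; rfl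
  arr_comp f g := vecPath₁_trans _ _

/-- The model of `Π₂X × *` in points. -/
def leftModel (X : Type u) [TopologicalSpace X] :
    PathModel (Pi2 X × PointBicategory) (Fin 1 → X) where
  pt a := ![a.1.pt]
  arr {a b} f := vecPath₁ (x := a.1.pt) (x' := b.1.pt) f.1
  rep η :=
    { toFun u := vecPath₁ (repr η.1 u)
      source' := by simp
      target' := by simp
      continuous_toFun := by
        rw [← Path.continuous_uncurry_iff]
        have h₁ := Path.continuous_uncurry_iff.2 (repr η.1).continuous
        exact continuous_pi fun j => by
          fin_cases j
          exact h₁ }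
  arr_id a := by ext t j; fin_cases j; rfl
  arr_comp f g := vecPath₁_trans _ _

/-- The sequence of constant curves at four points. -/
def constCurves (x y z w : X) : ℕ → C(ℝ, X)
  | 0 => .const ℝ x
  | 1 => .const ℝ y
  | 2 => .const ℝ z
  | _ => .const ℝ w

theorem ev_mul (xs : ℕ → C(ℝ, X)) {i j k : ℕ} (u : Config i j) (v : Config j k) :
    A.ev xs i k (LittleIntervals.mul u v) = A.act m ![A.ev xs i j u, A.ev xs j k v] := by
  rw [LittleIntervals.mul, ev_op₂, ofConfig_mConfig]

/-- The identity `mul_mul_left` of configurations, evaluated at three full intervals labelled by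
points. The last entry of `constCurves` is filler. The other action identities below arise in the
same manner. -/
theorem act_m_m_left (x y z : X) :
    A.act m ![A.act m ![x, y], z] = A.act (assocPath 0) ![x, y, z] := by
  have h := congrArg (A.ev (constCurves x y z z) 0 3) (mul_mul_left (pnt 0 0) (pnt 1 0) (pnt 2 0))
  rw [ev_mul, ev_mul, ev_op₃, ofConfig_assocConfig] at h
  simp only [ev_pnt] at h
  exact h

theorem act_m_m_right (x y z : X) :
    A.act m ![x, A.act m ![y, z]] = A.act (assocPath 1) ![x, y, z] := by
  have h := congrArg (A.ev (constCurves x y z z) 0 3) (mul_mul_right (pnt 0 0) (pnt 1 0) (pnt 2 0))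
  rw [ev_mul, ev_mul, ev_op₃, ofConfig_assocConfig] at h
  simp only [ev_pnt] at h
  exact h

theorem act_m_unit_left (x : X) :
    A.act m ![A.act i Fin.elim0, x] = A.act (leftUnitPath 0) ![x] := by
  have h := congrArg (A.ev (constCurves x x x x) 0 1) (emp_mul (pnt 0 0))
  rw [ev_mul, ev_op₁, ofConfig_leftConfig, ev_emp] at h
  simp only [ev_pnt] at h
  exact h

theorem act_m_unit_right (x : X) :
    A.act m ![x, A.act i Fin.elim0] = A.act (rightUnitPath 0) ![x] := by
  have h := congrArg (A.ev (constCurves x x x x) 0 1) (mul_emp (pnt 0 0))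
  rw [ev_mul, ev_op₁, ofConfig_rightConfig, ev_emp] at h
  simp only [ev_pnt] at h
  exact h

theorem act_leftUnitPath_one (x : X) : A.act (leftUnitPath 1) ![x] = x := by
  have h := congrArg (A.ev (constCurves x x x x) 0 1) (op₁_leftConfig_one (pnt 0 0))
  rw [ev_op₁, ofConfig_leftConfig] at h
  simp only [ev_pnt] at h
  exact h

theorem act_rightUnitPath_one (x : X) : A.act (rightUnitPath 1) ![x] = x := by
  have h := congrArg (A.ev (constCurves x x x x) 0 1) (op₁_rightConfig_one (pnt 0 0))
  rw [ev_op₁, ofConfig_rightConfig] at h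
  simp only [ev_pnt] at h
  exact h

/-- The constraints are constant homotopies and the 2-cells act through representatives, so the only
thing left is the pointwise identity `act_m_m_left`. -/
theorem models_assoc_source : (tripleModel X).Models
    ((prodPseudofunctor A.tensor (Pseudofunctor.id (Pi2 X))).comp A.tensor)
    (A.act (assocPath 0)) where
  obj _ := A.act_m_m_left _ _ _
  map _ _ := A.act_m_m_left _ _ _
  map₂ η := (A.isCell_tensor ((prodPseudofunctor A.tensor (Pseudofunctor.id (Pi2 X))).map₂ η)
    (A.isCell_tensor η.1 (isCell_repr η.1.1) (isCell_repr η.1.2)) (isCell_repr η.2)).congr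
    fun _ _ => A.act_m_m_left _ _ _
  mapId a := (A.isCell_comp_tensor_mapId (prodPseudofunctor A.tensor (Pseudofunctor.id (Pi2 X)))
    (A.isCell_tensor_mapId a.1) (isCell_id (φ := fun _ => a.2.pt) fun _ => rfl)).congr
    fun _ _ => A.act_m_m_left _ _ _
  mapComp f g := (A.isCell_comp_tensor_mapComp
    (prodPseudofunctor A.tensor (Pseudofunctor.id (Pi2 X))) (A.isCell_tensor_mapComp f.1 g.1)
    (isCell_id (φ := fun t => Path.trans (X := X) f.2 g.2 t) fun _ => rfl)).congr
    fun _ t => (A.act_m_m_left _ _ _).trans (congrArg (A.act (assocPath 0))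
      (DFunLike.congr_fun ((tripleModel X).arr_comp f g) t))

theorem models_assoc_target : (tripleModel X).Models
    ((prodAssocPseudofunctor (Pi2 X) (Pi2 X) (Pi2 X)).comp
      ((prodPseudofunctor (Pseudofunctor.id (Pi2 X)) A.tensor).comp A.tensor))
    (A.act (assocPath 1)) where
  obj _ := A.act_m_m_right _ _ _
  map _ _ := A.act_m_m_right _ _ _
  map₂ {a b f g} η := by
    have h := A.isCell_tensor (a := (a.1.2, a.2)) (b := (b.1.2, b.2)) (f := (f.1.2, f.2))
      (g := (g.1.2, g.2)) (η.1.2, η.2) (isCell_repr η.1.2) (isCell_repr η.2)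
    exact (A.isCell_tensor ((prodPseudofunctor (Pseudofunctor.id (Pi2 X)) A.tensor).map₂
      ((prodAssocPseudofunctor (Pi2 X) (Pi2 X) (Pi2 X)).map₂ η)) (isCell_repr η.1.1) h).congr
      fun _ _ => A.act_m_m_right _ _ _
  mapId a := by
    have h := A.isCell_comp_tensor_mapId (prodPseudofunctor (Pseudofunctor.id (Pi2 X)) A.tensor)
      (a := (a.1.1, (a.1.2, a.2))) (isCell_id (φ := fun _ => a.1.1.pt) fun _ => rfl)
      (A.isCell_tensor_mapId (a.1.2, a.2))
    -- The rebracketing functor contributes a further factor to the constraint, the image of an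
    -- identity cell. `h₁` and `h₂` show that it too is a constant homotopy.
    have h₁ := A.isCell_tensor (a := (a.1.2, a.2)) (b := (a.1.2, a.2)) (𝟙 (𝟙 a.1.2, 𝟙 a.2))
      (isCell_id (φ := fun _ => a.1.2.pt) fun _ => rfl)
      (isCell_id (φ := fun _ => a.2.pt) fun _ => rfl)
    have h₂ := A.isCell_tensor
      ((prodPseudofunctor (Pseudofunctor.id (Pi2 X)) A.tensor).map₂
        ((prodAssocPseudofunctor (Pi2 X) (Pi2 X) (Pi2 X)).mapId a).hom)
      (isCell_id (φ := fun _ => a.1.1.pt) fun _ => rfl) h₁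
    exact (IsCell.comp_const h₂ h).congr fun _ _ => A.act_m_m_right _ _ _
  mapComp {a b c} f g := by
    have h := A.isCell_comp_tensor_mapComp
      (prodPseudofunctor (Pseudofunctor.id (Pi2 X)) A.tensor)
      (a := (a.1.1, (a.1.2, a.2))) (b := (b.1.1, (b.1.2, b.2))) (c := (c.1.1, (c.1.2, c.2)))
      (f := (f.1.1, (f.1.2, f.2))) (g := (g.1.1, (g.1.2, g.2)))
      (isCell_id (φ := fun t => Path.trans (X := X) f.1.1 g.1.1 t) fun _ => rfl)
      (A.isCell_tensor_mapComp (a := (a.1.2, a.2)) (b := (b.1.2, b.2)) (c := (c.1.2, c.2))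
        (f.1.2, f.2) (g.1.2, g.2))
    have h₁ := A.isCell_tensor (a := (a.1.2, a.2)) (b := (c.1.2, c.2))
      (𝟙 (f.1.2 ≫ g.1.2, f.2 ≫ g.2))
      (isCell_id (φ := fun t => Path.trans (X := X) f.1.2 g.1.2 t) fun _ => rfl)
      (isCell_id (φ := fun t => Path.trans (X := X) f.2 g.2 t) fun _ => rfl)
    have h₂ := A.isCell_tensor
      ((prodPseudofunctor (Pseudofunctor.id (Pi2 X)) A.tensor).map₂
        ((prodAssocPseudofunctor (Pi2 X) (Pi2 X) (Pi2 X)).mapComp f g).hom)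
      (isCell_id (φ := fun t => Path.trans (X := X) f.1.1 g.1.1 t) fun _ => rfl) h₁
    exact (IsCell.comp_const h₂ h).congr fun _ t => (A.act_m_m_right _ _ _).trans
      (congrArg (A.act (assocPath 1)) (DFunLike.congr_fun ((tripleModel X).arr_comp f g) t))

theorem models_leftUnit_source : (rightModel X).Models
    ((prodPseudofunctor A.unit (Pseudofunctor.id (Pi2 X))).comp A.tensor)
    (A.act (leftUnitPath 0)) where
  obj _ := A.act_m_unit_left _
  map _ _ := A.act_m_unit_left _
  map₂ η := (A.isCell_tensor ((prodPseudofunctor A.unit (Pseudofunctor.id (Pi2 X))).map₂ η)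
    (isCell_id (φ := fun _ => A.act i Fin.elim0) fun _ => rfl) (isCell_repr η.2)).congr
    fun _ _ => A.act_m_unit_left _
  mapId a := (A.isCell_comp_tensor_mapId (prodPseudofunctor A.unit (Pseudofunctor.id (Pi2 X)))
    (isCell_eqToHom (φ := fun _ => A.act i Fin.elim0)
      ((Pi2.point (A.act i Fin.elim0)).map_id _) fun _ => rfl)
    (isCell_id (φ := fun _ => a.2.pt) fun _ => rfl)).congr fun _ _ => A.act_m_unit_left _
  mapComp f g := (A.isCell_comp_tensor_mapComp
    (prodPseudofunctor A.unit (Pseudofunctor.id (Pi2 X)))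
    (isCell_eqToHom (φ := fun _ => A.act i Fin.elim0)
      ((Pi2.point (A.act i Fin.elim0)).map_comp _ _) fun _ => rfl)
    (isCell_id (φ := fun t => Path.trans (X := X) f.2 g.2 t) fun _ => rfl)).congr
    fun _ t => (A.act_m_unit_left _).trans (congrArg (A.act (leftUnitPath 0))
      (DFunLike.congr_fun ((rightModel X).arr_comp f g) t))

theorem models_leftUnit_target : (rightModel X).Models
    (Bicategory.Prod.snd PointBicategory (Pi2 X)).toPseudofunctor (A.act (leftUnitPath 1)) where
  obj _ := (A.act_leftUnitPath_one _).symm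
  map _ _ := (A.act_leftUnitPath_one _).symm
  map₂ η := (isCell_repr η.2).congr fun _ _ => (A.act_leftUnitPath_one _).symm
  mapId a := isCell_eqToHom ((Bicategory.Prod.snd PointBicategory (Pi2 X)).map_id a)
    fun _ => (A.act_leftUnitPath_one _).symm
  mapComp f g := isCell_eqToHom ((Bicategory.Prod.snd PointBicategory (Pi2 X)).map_comp f g) fun t =>
    (A.act_leftUnitPath_one _).symm.trans
    (congrArg (A.act (leftUnitPath 1)) (DFunLike.congr_fun ((rightModel X).arr_comp f g) t))

theorem models_rightUnit_source : (leftModel X).Models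
    ((prodPseudofunctor (Pseudofunctor.id (Pi2 X)) A.unit).comp A.tensor)
    (A.act (rightUnitPath 0)) where
  obj _ := A.act_m_unit_right _
  map _ _ := A.act_m_unit_right _
  map₂ η := (A.isCell_tensor ((prodPseudofunctor (Pseudofunctor.id (Pi2 X)) A.unit).map₂ η)
    (isCell_repr η.1) (isCell_id (φ := fun _ => A.act i Fin.elim0) fun _ => rfl)).congr
    fun _ _ => A.act_m_unit_right _
  mapId a := (A.isCell_comp_tensor_mapId (prodPseudofunctor (Pseudofunctor.id (Pi2 X)) A.unit)
    (isCell_id (φ := fun _ => a.1.pt) fun _ => rfl)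
    (isCell_eqToHom (φ := fun _ => A.act i Fin.elim0)
      ((Pi2.point (A.act i Fin.elim0)).map_id _) fun _ => rfl)).congr
    fun _ _ => A.act_m_unit_right _
  mapComp f g := (A.isCell_comp_tensor_mapComp
    (prodPseudofunctor (Pseudofunctor.id (Pi2 X)) A.unit)
    (isCell_id (φ := fun t => Path.trans (X := X) f.1 g.1 t) fun _ => rfl)
    (isCell_eqToHom (φ := fun _ => A.act i Fin.elim0)
      ((Pi2.point (A.act i Fin.elim0)).map_comp _ _) fun _ => rfl)).congr
    fun _ t => (A.act_m_unit_right _).trans (congrArg (A.act (rightUnitPath 0))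
      (DFunLike.congr_fun ((leftModel X).arr_comp f g) t))

theorem models_rightUnit_target : (leftModel X).Models
    (Bicategory.Prod.fst (Pi2 X) PointBicategory).toPseudofunctor (A.act (rightUnitPath 1)) where
  obj _ := (A.act_rightUnitPath_one _).symm
  map _ _ := (A.act_rightUnitPath_one _).symm
  map₂ η := (isCell_repr η.1).congr fun _ _ => (A.act_rightUnitPath_one _).symm
  mapId a := isCell_eqToHom ((Bicategory.Prod.fst (Pi2 X) PointBicategory).map_id a)
    fun _ => (A.act_rightUnitPath_one _).symm
  mapComp f g := isCell_eqToHom ((Bicategory.Prod.fst (Pi2 X) PointBicategory).map_comp f g) fun t =>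
    (A.act_rightUnitPath_one _).symm.trans
    (congrArg (A.act (rightUnitPath 1)) (DFunLike.congr_fun ((leftModel X).arr_comp f g) t))

end models

end LittleIntervalsAlgebra

end

/-! ### The monoidal data and lifts of its cells to configurations. -/

noncomputable section

open CategoryTheory Bicategory
open scoped unitInterval Pseudofunctor.StrongTrans

universe u

namespace LittleIntervalsAlgebra

open Pi2 LittleIntervals

variable {X : Type u} [TopologicalSpace X] (A : LittleIntervalsAlgebra X)

/-- The pseudofunctors and adjoint equivalences of the monoidal bicategory `Π₂X`. -/
def data : MonoidalBicategoryData (Pi2 X) where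
  tensor := A.tensor
  unit := A.unit
  assoc := (A.exists_isEquivalenceOf assocPath _ A.models_assoc_source A.models_assoc_target).choose
  leftUnit := (A.exists_isEquivalenceOf leftUnitPath _ A.models_leftUnit_source
    A.models_leftUnit_target).choose
  rightUnit := (A.exists_isEquivalenceOf rightUnitPath _ A.models_rightUnit_source
    A.models_rightUnit_target).choose

/-- The equivalence in `data` is merely chosen, so everything proved about it goes through this
specification. -/
theorem isEquivalenceOf_assoc : A.IsEquivalenceOf A.data.assoc assocPath (tripleModel X).pt
    fun f => (tripleModel X).arr f :=
  (A.exists_isEquivalenceOf assocPath _ A.models_assoc_source A.models_assoc_target).choose_spec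

theorem isEquivalenceOf_leftUnit : A.IsEquivalenceOf A.data.leftUnit leftUnitPath
    (rightModel X).pt fun f => (rightModel X).arr f :=
  (A.exists_isEquivalenceOf leftUnitPath _ A.models_leftUnit_source
    A.models_leftUnit_target).choose_spec

theorem isEquivalenceOf_rightUnit : A.IsEquivalenceOf A.data.rightUnit rightUnitPath
    (leftModel X).pt fun f => (leftModel X).arr f :=
  (A.exists_isEquivalenceOf rightUnitPath _ A.models_rightUnit_source
    A.models_rightUnit_target).choose_spec

variable {A} {xs : ℕ → C(ℝ, X)} {i j k l n : ℕ}

theorem ev_tO {u : Config i j} {v : Config j k} {a b : Pi2 X} (hu : A.ev xs i j u = a.pt)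
    (hv : A.ev xs j k v = b.pt) : A.ev xs i k (LittleIntervals.mul u v) = (A.data.tO a b).pt := by
  rw [ev_mul, hu, hv]
  rfl

theorem ev_e : A.ev xs i i (emp i) = A.data.e.pt := A.ev_emp xs i

theorem lifts_tH {u u' : Config i j} {v v' : Config j k} {p : Path u u'} {q : Path v v'}
    {a a' b b' : Pi2 X} {f : a ⟶ a'} {g : b ⟶ b'} (hf : Lifts (A.ev xs i j) p f)
    (hg : Lifts (A.ev xs j k) q g) : Lifts (A.ev xs i k) (mulPath p q) (A.data.tH f g) := fun t =>
  (A.isPath_tensor (a := (a, b)) (b := (a', b')) (f, g) hf hg t).trans (A.ev_mul xs _ _).symm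

/-- The configurations lying over the objects are arbitrary, not only single intervals. Objects
which are tensor products, as in the cocycle condition, are therefore covered by taking `u`, `v` or
`w` to be a product. -/
theorem lifts_a {u : Config i j} {v : Config j k} {w : Config k l} {a b c : Pi2 X}
    (hu : A.ev xs i j u = a.pt) (hv : A.ev xs j k v = b.pt) (hw : A.ev xs k l w = c.pt) :
    Lifts (A.ev xs i l) (assocLift u v w) (A.data.a a b c) := fun t =>
  (A.isEquivalenceOf_assoc.hom_app ((a, b), c) t).trans (by
    refine Eq.trans ?_ (A.ev_op₃ xs _ u v w).symm
    rw [ofConfig_assocConfig, hu, hv, hw]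
    rfl)

theorem lifts_l {u : Config i j} {a : Pi2 X} (hu : A.ev xs i j u = a.pt) :
    Lifts (A.ev xs i j) (leftLift u) (A.data.l a) := fun t =>
  (A.isEquivalenceOf_leftUnit.hom_app (PointBicategory.star, a) t).trans (by
    refine Eq.trans ?_ (A.ev_op₁ xs _ u).symm
    rw [ofConfig_leftConfig, hu]
    rfl)

theorem lifts_r' {u : Config i j} {a : Pi2 X} (hu : A.ev xs i j u = a.pt) :
    Lifts (A.ev xs i j) (rightLift u) (A.data.r' a) := fun t =>
  (A.isEquivalenceOf_rightUnit.inv_app (a, PointBicategory.star) t).trans (by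
    refine Eq.trans ?_ (A.ev_op₁ xs _ u).symm
    rw [ofConfig_rightConfig, hu]
    rfl)

theorem lifts_eH : Lifts (A.ev xs i i) (Path.refl (emp i)) A.data.eH := fun _ => ev_e.symm

theorem img_tI {u u' : Config i j} {v v' : Config j k} {p p' : Path u u'} {q q' : Path v v'}
    {a a' b b' : Pi2 X} {f f' : a ⟶ a'} {g g' : b ⟶ b'} {η : f ≅ f'} {θ : g ≅ g'}
    (hη : Img (A.ev xs i j) p p' η.hom) (hθ : Img (A.ev xs j k) q q' θ.hom) :
    Img (A.ev xs i k) (mulPath p q) (mulPath p' q') (A.data.tI η θ).hom := by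
  obtain ⟨R, hR⟩ := hη
  obtain ⟨S, hS⟩ := hθ
  have h := A.isCell_tensor (a := (a, b)) (b := (a', b')) (f := (f, g)) (g := (f', g'))
    (η.hom, θ.hom) hR hS
  refine IsCell.img (φ := fun u t => LittleIntervals.mul (R u t) (S u t))
    (h.congr fun u t => (A.ev_mul xs _ _).symm) ?_ ?_ ?_ ?_ ?_
  · exact continuous_mul (Path.continuous_uncurry_iff.2 R.continuous)
      (Path.continuous_uncurry_iff.2 S.continuous)
  all_goals
    intro _
    simp [mulPath]

/-- Multiplying paths pointwise commutes strictly with concatenation, so the two lifted paths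
coincide and the constant homotopy covers the constraint. -/
theorem img_tComp {u u' u'' : Config i j} {v v' v'' : Config j k} {p : Path u u'}
    {p' : Path u' u''} {q : Path v v'} {q' : Path v' v''} {a a' a'' b b' b'' : Pi2 X}
    {f : a ⟶ a'} {f' : a' ⟶ a''} {g : b ⟶ b'} {g' : b' ⟶ b''} (hf : Lifts (A.ev xs i j) p f)
    (hf' : Lifts (A.ev xs i j) p' f') (hg : Lifts (A.ev xs j k) q g)
    (hg' : Lifts (A.ev xs j k) q' g') :
    Img (A.ev xs i k) (mulPath (p.trans p') (q.trans q')) ((mulPath p q).trans (mulPath p' q'))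
      (A.data.tComp f f' g g').hom := by
  have e : (mulPath p q).trans (mulPath p' q') = mulPath (p.trans p') (q.trans q') := by
    ext1
    funext t
    change ((mulPath p q).trans (mulPath p' q')) t =
      LittleIntervals.mul (p.trans p' t) (q.trans q' t)
    simp only [Path.trans_apply]
    split_ifs <;> rfl
  rw [e]
  refine ⟨Path.refl _, (A.isCell_tensor_mapComp (a := (a, b)) (b := (a', b')) (c := (a'', b''))
    (f, g) (f', g')).congr fun u t => ?_⟩
  exact Eq.trans (congrArg₂ (fun x y => A.act m ![x, y]) (hf.trans hf' t) (hg.trans hg' t))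
    (A.ev_mul xs _ _).symm

theorem img_tId {u : Config i j} {v : Config j k} {a b : Pi2 X} (hu : A.ev xs i j u = a.pt)
    (hv : A.ev xs j k v = b.pt) :
    Img (A.ev xs i k) (mulPath (Path.refl u) (Path.refl v)) (Path.refl (LittleIntervals.mul u v))
      (A.data.tId a b).hom :=
  ⟨Path.refl _, (A.isCell_tensor_mapId (a, b)).congr fun _ _ => (ev_tO hu hv).symm⟩

/-- The square `op₃ (assocConfig s) (p t) (q t) (r t)` covers the prescribed naturality square in
`X`. Its sides at `s = 0` and `s = 1` are the two iterated products by `mul_mul_left` and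
`mul_mul_right`. -/
theorem img_aSq {u u' : Config i j} {v v' : Config j k} {w w' : Config k l} {p : Path u u'}
    {q : Path v v'} {r : Path w w'} {a a' b b' c c' : Pi2 X} {f : a ⟶ a'} {g : b ⟶ b'} {h : c ⟶ c'}
    (hf : Lifts (A.ev xs i j) p f) (hg : Lifts (A.ev xs j k) q g) (hh : Lifts (A.ev xs k l) r h) :
    Img (A.ev xs i l) ((mulPath (mulPath p q) r).trans (assocLift u' v' w'))
      ((assocLift u v w).trans (mulPath p (mulPath q r))) (A.data.aSq f g h).hom := by
  refine IsCell.img_square (Φ := fun s t => op₃ (assocConfig s) (p t) (q t) (r t))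
    ((A.isEquivalenceOf_assoc.hom_naturality (a := ((a, b), c)) (b := ((a', b'), c'))
      ((f, g), h)).congr fun s t => ?_) ?_ (fun t => ?_) (fun t => ?_) (fun t => ?_) (fun t => ?_)
  · rw [A.ev_op₃, ofConfig_assocConfig,
      show ∀ t, A.ev xs i j (p t) = _ from fun t => (hf t).symm,
      show ∀ t, A.ev xs j k (q t) = _ from fun t => (hg t).symm,
      show ∀ t, A.ev xs k l (r t) = _ from fun t => (hh t).symm]
    rfl
  · exact continuous_op₃ (continuous_assocConfig.comp continuous_fst)
      (p.continuous.comp continuous_snd) (q.continuous.comp continuous_snd)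
      (r.continuous.comp continuous_snd)
  · exact mul_mul_left _ _ _
  · simp [assocLift]
  · simp [assocLift]
  · exact mul_mul_right _ _ _

theorem img_lSq {u u' : Config i j} {p : Path u u'} {a a' : Pi2 X} {f : a ⟶ a'}
    (hf : Lifts (A.ev xs i j) p f) :
    Img (A.ev xs i j) ((mulPath (Path.refl (emp i)) p).trans (leftLift u'))
      ((leftLift u).trans p) (A.data.lSq f).hom := by
  refine IsCell.img_square (Φ := fun s t => op₁ (leftConfig s) (p t))
    ((A.isEquivalenceOf_leftUnit.hom_naturality (a := (PointBicategory.star, a))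
      (b := (PointBicategory.star, a')) (𝟙 PointBicategory.star, f)).congr fun s t => ?_) ?_
    (fun t => ?_) (fun t => ?_) (fun t => ?_) (fun t => ?_)
  · rw [A.ev_op₁, ofConfig_leftConfig, show ∀ t, A.ev xs i j (p t) = _ from fun t => (hf t).symm]
    rfl
  · exact continuous_op₁ (continuous_leftConfig.comp continuous_fst)
      (p.continuous.comp continuous_snd)
  · exact emp_mul _
  · simp [leftLift]
  · simp [leftLift]
  · exact (op₁_leftConfig_one _).symm

theorem img_rSq' {u u' : Config i j} {p : Path u u'} {a a' : Pi2 X} {f : a ⟶ a'}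
    (hf : Lifts (A.ev xs i j) p f) :
    Img (A.ev xs i j) (p.trans (rightLift u'))
      ((rightLift u).trans (mulPath p (Path.refl (emp j)))) (A.data.rSq' f).hom := by
  refine IsCell.img_square (Φ := fun s t => op₁ (rightConfig (unitInterval.symm s)) (p t))
    ((A.isEquivalenceOf_rightUnit.inv_naturality (a := (a, PointBicategory.star))
      (b := (a', PointBicategory.star)) (f, 𝟙 PointBicategory.star)).congr fun s t => ?_) ?_
    (fun t => ?_) (fun t => ?_) (fun t => ?_) (fun t => ?_)
  · rw [A.ev_op₁, ofConfig_rightConfig, show ∀ t, A.ev xs i j (p t) = _ from fun t => (hf t).symm]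
    rfl
  · exact continuous_op₁ (continuous_rightConfig.comp
      (unitInterval.continuous_symm.comp continuous_fst)) (p.continuous.comp continuous_snd)
  · rw [unitInterval.symm_zero]; exact (op₁_rightConfig_one _).symm
  · simp [rightLift]
  · simp [rightLift]
  · rw [unitInterval.symm_one]; exact mul_emp _

end LittleIntervalsAlgebra

end

/-! ### The cells `π`, `μ`, `λ`, `ρ`. -/

noncomputable section

open CategoryTheory Bicategory
open scoped unitInterval Pseudofunctor.StrongTrans

universe u

namespace LittleIntervals

variable {i j k l n : ℕ}

/-- The source of `π` in the operad. -/
abbrev piSource (u : Config i j) (v : Config j k) (w : Config k l) (z : Config l n) :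
    Path (mul (mul (mul u v) w) z) (mul u (mul v (mul w z))) :=
  (mulPath (assocLift u v w) (Path.refl z)).trans
    ((assocLift u (mul v w) z).trans (mulPath (Path.refl u) (assocLift v w z)))

/-- The target of `π` in the operad. -/
abbrev piTarget (u : Config i j) (v : Config j k) (w : Config k l) (z : Config l n) :
    Path (mul (mul (mul u v) w) z) (mul u (mul v (mul w z))) :=
  (assocLift (mul u v) w z).trans (assocLift u v (mul w z))

/-- The source of `μ` in the operad. -/
abbrev muSource (u : Config i j) (v : Config j k) : Path (mul u v) (mul u v) :=
  (mulPath (rightLift u) (Path.refl v)).trans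
    ((assocLift u (emp j) v).trans (mulPath (Path.refl u) (leftLift v)))

/-- The source of `λ` in the operad. -/
abbrev lamSource (u : Config i j) (v : Config j k) : Path (mul (mul (emp i) u) v) (mul u v) :=
  mulPath (leftLift u) (Path.refl v)

/-- The target of `λ` in the operad. -/
abbrev lamTarget (u : Config i j) (v : Config j k) : Path (mul (mul (emp i) u) v) (mul u v) :=
  (assocLift (emp i) u v).trans (leftLift (mul u v))

/-- The source of `ρ` in the operad. -/
abbrev rhoSource (u : Config i j) (v : Config j k) : Path (mul u v) (mul u (mul v (emp k))) :=
  mulPath (Path.refl u) (rightLift v)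

/-- The target of `ρ` in the operad. -/
abbrev rhoTarget (u : Config i j) (v : Config j k) : Path (mul u v) (mul u (mul v (emp k))) :=
  (rightLift (mul u v)).trans (assocLift u v (emp k))

section subst
variable (B : Blocks)

theorem subst_mul (u : Config i j) (v : Config j k) :
    B.subst (mul u v) = mul (B.subst u) (B.subst v) :=
  B.subst_op₂ _ _ _

theorem mulPath_apply {u u' : Config i j} {v v' : Config j k} (p : Path u u') (q : Path v v')
    (t : I) : mulPath p q t = mul (p t) (q t) :=
  rfl

theorem assocLift_apply (u : Config i j) (v : Config j k) (w : Config k l) (t : I) :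
    assocLift u v w t = op₃ (assocConfig t) u v w :=
  rfl

theorem leftLift_apply (u : Config i j) (t : I) : leftLift u t = op₁ (leftConfig t) u :=
  rfl

theorem rightLift_apply (u : Config i j) (t : I) :
    rightLift u t = op₁ (rightConfig (unitInterval.symm t)) u :=
  rfl

/-- Substituting into the individual full intervals recovers the blocks; the bounds reduce to `i`,
`j`, `k` by definition, so no casts arise. -/
theorem blocks₂_congr {α : Sort*} (F : Config i j → Config j k → α) (u : Config i j)
    (v : Config j k) :
    F ((blocks₂ u v).subst (pnt 0 0)) ((blocks₂ u v).subst (pnt 1 0)) = F u v :=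
  congrArg₂ F ((blocks₂ u v).subst_pnt 0 0) ((blocks₂ u v).subst_pnt 1 0)

theorem blocks₄_congr {α : Sort*} (F : Config i j → Config j k → Config k l → Config l n → α)
    (u : Config i j) (v : Config j k) (w : Config k l) (z : Config l n) :
    F ((blocks₄ u v w z).subst (pnt 0 0)) ((blocks₄ u v w z).subst (pnt 1 0))
      ((blocks₄ u v w z).subst (pnt 2 0)) ((blocks₄ u v w z).subst (pnt 3 0)) = F u v w z :=
  (congrArg₂ (fun u v => F u v _ _) ((blocks₄ u v w z).subst_pnt 0 0)
    ((blocks₄ u v w z).subst_pnt 1 0)).trans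
    (congrArg₂ (F u v) ((blocks₄ u v w z).subst_pnt 2 0) ((blocks₄ u v w z).subst_pnt 3 0))

/-- The path is assembled from products and operadic substitutions, all of which `B.subst` respects.
This relates the path at four full intervals to the path at arbitrary configurations, and the
companion lemmas do the same for the other boundary paths. -/
theorem subst_piSource (u : Config i j) (v : Config j k) (w : Config k l) (z : Config l n) (t : I) :
    B.subst (piSource u v w z t) = piSource (B.subst u) (B.subst v) (B.subst w) (B.subst z) t := by
  simp only [piSource, Path.trans_apply]
  split_ifs <;> simp only [mulPath_apply, assocLift_apply, Path.refl_apply,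
    subst_mul, B.subst_op₃]

theorem subst_piTarget (u : Config i j) (v : Config j k) (w : Config k l) (z : Config l n) (t : I) :
    B.subst (piTarget u v w z t) = piTarget (B.subst u) (B.subst v) (B.subst w) (B.subst z) t := by
  simp only [piTarget, Path.trans_apply]
  split_ifs <;> simp only [assocLift_apply,
    subst_mul, B.subst_op₃]

theorem subst_muSource (u : Config i j) (v : Config j k) (t : I) :
    B.subst (muSource u v t) = muSource (B.subst u) (B.subst v) t := by
  simp only [muSource, Path.trans_apply]
  split_ifs <;> simp only [mulPath_apply, assocLift_apply, leftLift_apply, rightLift_apply, Path.refl_apply,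
    subst_mul, B.subst_op₁, B.subst_op₃, B.subst_emp]

theorem subst_lamSource (u : Config i j) (v : Config j k) (t : I) :
    B.subst (lamSource u v t) = lamSource (B.subst u) (B.subst v) t := by
  simp only [lamSource, mulPath_apply, leftLift_apply, Path.refl_apply,
    subst_mul, B.subst_op₁]

theorem subst_lamTarget (u : Config i j) (v : Config j k) (t : I) :
    B.subst (lamTarget u v t) = lamTarget (B.subst u) (B.subst v) t := by
  simp only [lamTarget, Path.trans_apply]
  split_ifs <;> simp only [assocLift_apply, leftLift_apply,
    subst_mul, B.subst_op₁, B.subst_op₃, B.subst_emp]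

theorem subst_rhoSource (u : Config i j) (v : Config j k) (t : I) :
    B.subst (rhoSource u v t) = rhoSource (B.subst u) (B.subst v) t := by
  simp only [rhoSource, mulPath_apply, rightLift_apply, Path.refl_apply,
    subst_mul, B.subst_op₁]

theorem subst_rhoTarget (u : Config i j) (v : Config j k) (t : I) :
    B.subst (rhoTarget u v t) = rhoTarget (B.subst u) (B.subst v) t := by
  simp only [rhoTarget, Path.trans_apply]
  split_ifs <;> simp only [assocLift_apply, rightLift_apply,
    subst_mul, B.subst_op₁, B.subst_op₃, B.subst_emp]

end subst

/-- A path of configurations, substituted along two blocks. -/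
theorem op₂_eq_of_subst {s t : Config 0 2} {p : Path s t} {u : Config i j} {v : Config j k}
    {s' t' : Config i k} {p' : Path s' t'} (h : ∀ τ, (blocks₂ u v).subst (p τ) = p' τ) :
    op₂ s u v = s' ∧ op₂ t u v = t' := by
  have h0 := h 0
  have h1 := h 1
  rw [p.source, p'.source] at h0
  rw [p.target, p'.target] at h1
  exact ⟨h0, h1⟩

theorem op₄_eq_of_subst {s t : Config 0 4} {p : Path s t} {u : Config i j} {v : Config j k}
    {w : Config k l} {z : Config l n} {s' t' : Config i n} {p' : Path s' t'}
    (h : ∀ τ, (blocks₄ u v w z).subst (p τ) = p' τ) :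
    op₄ s u v w z = s' ∧ op₄ t u v w z = t' := by
  have h0 := h 0
  have h1 := h 1
  rw [p.source, p'.source] at h0
  rw [p.target, p'.target] at h1
  exact ⟨h0, h1⟩

end LittleIntervals

namespace LittleIntervalsAlgebra

open Pi2 LittleIntervals

variable {X : Type u} [TopologicalSpace X] {A : LittleIntervalsAlgebra X}

theorem ev_constCurves₂ (x y : X) (c : Config 0 2) :
    A.ev (constCurves x y y y) 0 2 c = A.act (k := 2) (ofConfig c) ![x, y] :=
  congrArg (A.act (k := 2) (ofConfig c)) (funext fun q => by fin_cases q <;> rfl)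

theorem ev_constCurves₄ (x y z w : X) (c : Config 0 4) :
    A.ev (constCurves x y z w) 0 4 c = A.act (k := 4) (ofConfig c) ![x, y, z, w] :=
  congrArg (A.act (k := 4) (ofConfig c)) (funext fun q => by fin_cases q <;> rfl)

variable {xs : ℕ → C(ℝ, X)} {i j k l n : ℕ}

/-- A cell given by the action of a homotopy of pairs of intervals. -/
theorem img_op₂ {s t : Config 0 2} {p q : Path s t} {H : Path p q} {u : Config i j} {v : Config j k}
    {s' t' : Config i k} {p' q' : Path s' t'} {a b : Pi2 X} {x y : X} {f g : a ⟶ b} {η : f ⟶ g}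
    (hη : IsCell η fun r τ => A.act (k := 2) (ofConfig (H r τ)) ![x, y])
    (hu : A.ev xs i j u = x) (hv : A.ev xs j k v = y)
    (hp : ∀ τ, (blocks₂ u v).subst (p τ) = p' τ) (hq : ∀ τ, (blocks₂ u v).subst (q τ) = q' τ) :
    Img (A.ev xs i k) p' q' η := by
  have h := op₂_eq_of_subst hp
  refine IsCell.img (φ := fun r τ => op₂ (H r τ) u v) (hη.congr fun r τ => ?_)
    (continuous_op₂ (Path.continuous_uncurry_iff.2 H.continuous) continuous_const
      continuous_const) (fun τ => ?_) (fun τ => ?_) (fun r => ?_) (fun r => ?_)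
  · rw [ev_op₂, hu, hv]
  · rw [H.source]; exact hp τ
  · rw [H.target]; exact hq τ
  · rw [Path.source]; exact h.1
  · rw [Path.target]; exact h.2

/-- A cell given by the action of a homotopy of quadruples of intervals. -/
theorem img_op₄ {s t : Config 0 4} {p q : Path s t} {H : Path p q} {u : Config i j} {v : Config j k}
    {w : Config k l} {z : Config l n} {s' t' : Config i n} {p' q' : Path s' t'} {a b : Pi2 X}
    {x₁ x₂ x₃ x₄ : X} {f g : a ⟶ b} {η : f ⟶ g}
    (hη : IsCell η fun r τ => A.act (k := 4) (ofConfig (H r τ)) ![x₁, x₂, x₃, x₄])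
    (hu : A.ev xs i j u = x₁) (hv : A.ev xs j k v = x₂) (hw : A.ev xs k l w = x₃)
    (hz : A.ev xs l n z = x₄) (hp : ∀ τ, (blocks₄ u v w z).subst (p τ) = p' τ)
    (hq : ∀ τ, (blocks₄ u v w z).subst (q τ) = q' τ) : Img (A.ev xs i n) p' q' η := by
  have h := op₄_eq_of_subst hp
  refine IsCell.img (φ := fun r τ => op₄ (H r τ) u v w z) (hη.congr fun r τ => ?_)
    (continuous_op₄ _ _ _ _ (Path.continuous_uncurry_iff.2 H.continuous)) (fun τ => ?_)
    (fun τ => ?_) (fun r => ?_) (fun r => ?_)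
  · rw [ev_op₄, hu, hv, hw, hz]
  · rw [H.source]; exact hp τ
  · rw [H.target]; exact hq τ
  · rw [Path.source]; exact h.1
  · rw [Path.target]; exact h.2

section lifts

variable {u : Config i j} {v : Config j k} {w : Config k l} {z : Config l n} {a b c d : Pi2 X}

theorem lifts_piSource (hu : A.ev xs i j u = a.pt) (hv : A.ev xs j k v = b.pt)
    (hw : A.ev xs k l w = c.pt) (hz : A.ev xs l n z = d.pt) :
    Lifts (A.ev xs i n) (piSource u v w z) (A.data.tH (A.data.a a b c) (𝟙 d) ≫
      A.data.a a (A.data.tO b c) d ≫ A.data.tH (𝟙 a) (A.data.a b c d)) :=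
  (lifts_tH (lifts_a hu hv hw) (lifts_id hz)).trans ((lifts_a hu (ev_tO hv hw) hz).trans
    (lifts_tH (lifts_id hu) (lifts_a hv hw hz)))

theorem lifts_piTarget (hu : A.ev xs i j u = a.pt) (hv : A.ev xs j k v = b.pt)
    (hw : A.ev xs k l w = c.pt) (hz : A.ev xs l n z = d.pt) :
    Lifts (A.ev xs i n) (piTarget u v w z) (A.data.a (A.data.tO a b) c d ≫
      A.data.a a b (A.data.tO c d)) :=
  (lifts_a (ev_tO hu hv) hw hz).trans (lifts_a hu hv (ev_tO hw hz))

theorem lifts_muSource (hu : A.ev xs i j u = a.pt) (hv : A.ev xs j k v = b.pt) :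
    Lifts (A.ev xs i k) (muSource u v) (A.data.tH (A.data.r' a) (𝟙 b) ≫
      A.data.a a A.data.e b ≫ A.data.tH (𝟙 a) (A.data.l b)) :=
  (lifts_tH (lifts_r' hu) (lifts_id hv)).trans ((lifts_a hu ev_e hv).trans
    (lifts_tH (lifts_id hu) (lifts_l hv)))

theorem lifts_lamSource (hu : A.ev xs i j u = a.pt) (hv : A.ev xs j k v = b.pt) :
    Lifts (A.ev xs i k) (lamSource u v) (A.data.tH (A.data.l a) (𝟙 b)) :=
  lifts_tH (lifts_l hu) (lifts_id hv)

theorem lifts_lamTarget (hu : A.ev xs i j u = a.pt) (hv : A.ev xs j k v = b.pt) :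
    Lifts (A.ev xs i k) (lamTarget u v) (A.data.a A.data.e a b ≫ A.data.l (A.data.tO a b)) :=
  (lifts_a ev_e hu hv).trans (lifts_l (ev_tO hu hv))

theorem lifts_rhoSource (hu : A.ev xs i j u = a.pt) (hv : A.ev xs j k v = b.pt) :
    Lifts (A.ev xs i k) (rhoSource u v) (A.data.tH (𝟙 a) (A.data.r' b)) :=
  lifts_tH (lifts_id hu) (lifts_r' hv)

theorem lifts_rhoTarget (hu : A.ev xs i j u = a.pt) (hv : A.ev xs j k v = b.pt) :
    Lifts (A.ev xs i k) (rhoTarget u v) (A.data.r' (A.data.tO a b) ≫ A.data.a a b A.data.e) :=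
  (lifts_r' (ev_tO hu hv)).trans (lifts_a hu hv ev_e)

end lifts

section cells

/-- The homotopy defining `π`. -/
def piLine : Path (piSource (pnt 0 0) (pnt 1 0) (pnt 2 0) (pnt 3 0))
    (piTarget (pnt 0 0) (pnt 1 0) (pnt 2 0) (pnt 3 0)) := Straight.line _ _

/-- The homotopy defining `μ`. -/
def muLine : Path (muSource (pnt 0 0) (pnt 1 0)) (Path.refl _) := Straight.line _ _

/-- The homotopy defining `λ`. -/
def lamLine : Path (lamSource (pnt 0 0) (pnt 1 0)) (lamTarget (pnt 0 0) (pnt 1 0)) :=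
  Straight.line _ _

/-- The homotopy defining `ρ`. -/
def rhoLine : Path (rhoSource (pnt 0 0) (pnt 1 0)) (rhoTarget (pnt 0 0) (pnt 1 0)) :=
  Straight.line _ _

variable (A) (a b c d : Pi2 X)

/-- The component of `π`. -/
def piCell : A.data.tH (A.data.a a b c) (𝟙 d) ≫ A.data.a a (A.data.tO b c) d ≫
    A.data.tH (𝟙 a) (A.data.a b c d) ≅ A.data.a (A.data.tO a b) c d ≫ A.data.a a b (A.data.tO c d) :=
  cellOf (P := A.ev (constCurves a.pt b.pt c.pt d.pt) 0 4)
    (lifts_piSource (A.ev_pnt _ 0 0) (A.ev_pnt _ 1 0) (A.ev_pnt _ 2 0) (A.ev_pnt _ 3 0))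
    (lifts_piTarget (A.ev_pnt _ 0 0) (A.ev_pnt _ 1 0) (A.ev_pnt _ 2 0) (A.ev_pnt _ 3 0)) piLine

/-- The component of `μ`. -/
def muCell : A.data.tH (A.data.r' a) (𝟙 b) ≫ A.data.a a A.data.e b ≫ A.data.tH (𝟙 a) (A.data.l b) ≅
    𝟙 (A.data.tO a b) :=
  cellOf (P := A.ev (constCurves a.pt b.pt b.pt b.pt) 0 2)
    (lifts_muSource (A.ev_pnt _ 0 0) (A.ev_pnt _ 1 0))
    (lifts_id (ev_tO (A.ev_pnt _ 0 0) (A.ev_pnt _ 1 0))) muLine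

/-- The component of `λ`. -/
def lamCell : A.data.tH (A.data.l a) (𝟙 b) ≅ A.data.a A.data.e a b ≫ A.data.l (A.data.tO a b) :=
  cellOf (P := A.ev (constCurves a.pt b.pt b.pt b.pt) 0 2)
    (lifts_lamSource (A.ev_pnt _ 0 0) (A.ev_pnt _ 1 0))
    (lifts_lamTarget (A.ev_pnt _ 0 0) (A.ev_pnt _ 1 0)) lamLine

/-- The component of `ρ`. -/
def rhoCell : A.data.tH (𝟙 a) (A.data.r' b) ≅ A.data.r' (A.data.tO a b) ≫ A.data.a a b A.data.e :=
  cellOf (P := A.ev (constCurves a.pt b.pt b.pt b.pt) 0 2)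
    (lifts_rhoSource (A.ev_pnt _ 0 0) (A.ev_pnt _ 1 0))
    (lifts_rhoTarget (A.ev_pnt _ 0 0) (A.ev_pnt _ 1 0)) rhoLine

/-- Constant curves make the labels irrelevant, so the homotopy `piLine` is the same for all objects
and only the points acted upon vary. -/
theorem isCell_piCell : IsCell (A.piCell a b c d).hom fun r τ =>
    A.act (k := 4) (ofConfig (piLine r τ)) ![a.pt, b.pt, c.pt, d.pt] :=
  (isCell_cellOf _ _ _).congr fun _ _ => ev_constCurves₄ _ _ _ _ _

theorem isCell_muCell : IsCell (A.muCell a b).hom fun r τ =>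
    A.act (k := 2) (ofConfig (muLine r τ)) ![a.pt, b.pt] :=
  (isCell_cellOf _ _ _).congr fun _ _ => ev_constCurves₂ _ _ _

theorem isCell_lamCell : IsCell (A.lamCell a b).hom fun r τ =>
    A.act (k := 2) (ofConfig (lamLine r τ)) ![a.pt, b.pt] :=
  (isCell_cellOf _ _ _).congr fun _ _ => ev_constCurves₂ _ _ _

theorem isCell_rhoCell : IsCell (A.rhoCell a b).hom fun r τ =>
    A.act (k := 2) (ofConfig (rhoLine r τ)) ![a.pt, b.pt] :=
  (isCell_cellOf _ _ _).congr fun _ _ => ev_constCurves₂ _ _ _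

end cells

section img

variable {u : Config i j} {v : Config j k} {w : Config k l} {z : Config l n} {a b c d : Pi2 X}

/-- Substituting `u`, `v`, `w`, `z` into the fixed homotopy `piLine` gives a homotopy in `Config i
n` that covers the same 2-cell. This is what places components of `π` at tensor products, and at the
ends of moving paths, in one convex space with the other cells of an equation. -/
theorem img_piCell (hu : A.ev xs i j u = a.pt) (hv : A.ev xs j k v = b.pt)
    (hw : A.ev xs k l w = c.pt) (hz : A.ev xs l n z = d.pt) :
    Img (A.ev xs i n) (piSource u v w z) (piTarget u v w z) (A.piCell a b c d).hom := by
  refine img_op₄ (A.isCell_piCell a b c d) hu hv hw hz (fun τ => ?_) (fun τ => ?_)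
  · exact (subst_piSource _ _ _ _ _ τ).trans (blocks₄_congr (fun u v w z => piSource u v w z τ) _ _ _ _)
  · exact (subst_piTarget _ _ _ _ _ τ).trans (blocks₄_congr (fun u v w z => piTarget u v w z τ) _ _ _ _)

theorem img_muCell (hu : A.ev xs i j u = a.pt) (hv : A.ev xs j k v = b.pt) :
    Img (A.ev xs i k) (muSource u v) (Path.refl (LittleIntervals.mul u v)) (A.muCell a b).hom := by
  refine img_op₂ (A.isCell_muCell a b) hu hv (fun τ => ?_) (fun τ => ?_)
  · exact (subst_muSource _ _ _ τ).trans (blocks₂_congr (fun u v => muSource u v τ) _ _)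
  · exact (subst_mul _ _ _).trans (blocks₂_congr LittleIntervals.mul _ _)

theorem img_lamCell (hu : A.ev xs i j u = a.pt) (hv : A.ev xs j k v = b.pt) :
    Img (A.ev xs i k) (lamSource u v) (lamTarget u v) (A.lamCell a b).hom := by
  refine img_op₂ (A.isCell_lamCell a b) hu hv (fun τ => ?_) (fun τ => ?_)
  · exact (subst_lamSource _ _ _ τ).trans (blocks₂_congr (fun u v => lamSource u v τ) _ _)
  · exact (subst_lamTarget _ _ _ τ).trans (blocks₂_congr (fun u v => lamTarget u v τ) _ _)

theorem img_rhoCell (hu : A.ev xs i j u = a.pt) (hv : A.ev xs j k v = b.pt) :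
    Img (A.ev xs i k) (rhoSource u v) (rhoTarget u v) (A.rhoCell a b).hom := by
  refine img_op₂ (A.isCell_rhoCell a b) hu hv (fun τ => ?_) (fun τ => ?_)
  · exact (subst_rhoSource _ _ _ τ).trans (blocks₂_congr (fun u v => rhoSource u v τ) _ _)
  · exact (subst_rhoTarget _ _ _ τ).trans (blocks₂_congr (fun u v => rhoTarget u v τ) _ _)

end img

end LittleIntervalsAlgebra

end

/-! ### The modification axioms for `π`, `μ`, `λ`, `ρ`. -/

noncomputable section

open CategoryTheory Bicategory
open scoped unitInterval Pseudofunctor.StrongTrans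

universe w u

namespace Pi2

variable {X : Type u} [TopologicalSpace X] {T : Type w} [TopologicalSpace T] {P : C(T, X)}

theorem Lifts.source_eq {s t : T} {p : Path s t} {a b : Pi2 X} {f : a ⟶ b} (hf : Lifts P p f) :
    P s = a.pt :=
  (congrArg P p.source).symm.trans ((hf 0).symm.trans (Path.source _))

theorem Lifts.target_eq {s t : T} {p : Path s t} {a b : Pi2 X} {f : a ⟶ b} (hf : Lifts P p f) :
    P t = b.pt :=
  (congrArg P p.target).symm.trans ((hf 1).symm.trans (Path.target _))

theorem Img.trans_iso {s t : T} {p q r : Path s t} {a b : Pi2 X} {f g h : a ⟶ b} {η : f ≅ g}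
    {θ : g ≅ h} (hη : Img P p q η.hom) (hθ : Img P q r θ.hom) : Img P p r (η ≪≫ θ).hom :=
  hη.comp hθ

theorem img_isoRefl {s t : T} {p : Path s t} {a b : Pi2 X} {f : a ⟶ b} (hf : Lifts P p f) :
    Img P p p (Iso.refl f).hom :=
  img_id hf

theorem Img.symm_iso {s t : T} {p q : Path s t} {a b : Pi2 X} {f g : a ⟶ b} {η : f ≅ g}
    (hη : Img P p q η.hom) : Img P q p η.symm.hom :=
  hη.inv

theorem Img.whiskerLeftIso {r s t : T} {k : Path r s} {p q : Path s t} {a b c : Pi2 X} {f : a ⟶ b}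
    {g h : b ⟶ c} {η : g ≅ h} (hf : Lifts P k f) (hη : Img P p q η.hom) :
    Img P (k.trans p) (k.trans q) (whiskerLeftIso f η).hom :=
  hη.whiskerLeft hf

theorem Img.whiskerRightIso {r s t : T} {p q : Path r s} {k : Path s t} {a b c : Pi2 X}
    {f g : a ⟶ b} {h : b ⟶ c} {η : f ≅ g} (hη : Img P p q η.hom) (hh : Lifts P k h) :
    Img P (p.trans k) (q.trans k) (whiskerRightIso η h).hom :=
  hη.whiskerRight hh

theorem Img.pasteSq {r s t r' s' t' : T} {p : Path r r'} {q : Path s s'} {h : Path t t'}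
    {k : Path r s} {k' : Path r' s'} {l : Path s t} {l' : Path s' t'} {a b c a' b' c' : Pi2 X}
    {f : a ⟶ a'} {g : b ⟶ b'} {h' : c ⟶ c'} {x : a ⟶ b} {x' : a' ⟶ b'} {y : b ⟶ c} {y' : b' ⟶ c'}
    {η : f ≫ x' ≅ x ≫ g} {θ : g ≫ y' ≅ y ≫ h'} (hf : Lifts P p f) (hg : Lifts P q g)
    (hh : Lifts P h h') (hx : Lifts P k x) (hx' : Lifts P k' x') (hy : Lifts P l y)
    (hy' : Lifts P l' y') (hη : Img P (p.trans k') (k.trans q) η.hom)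
    (hθ : Img P (q.trans l') (l.trans h) θ.hom) :
    Img P (p.trans (k'.trans l')) ((k.trans l).trans h) (pasteSq η θ).hom :=
  (img_associator hf hx' hy').inv.comp ((hη.whiskerRight hy').comp
    ((img_associator hx hg hy').comp ((hθ.whiskerLeft hx).comp (img_associator hx hy hh).inv)))

theorem img_idSq {s t : T} {p : Path s t} {a b : Pi2 X} {f : a ⟶ b} (hf : Lifts P p f) :
    Img P (p.trans (Path.refl t)) ((Path.refl s).trans p) (idSq f).hom :=
  (img_rightUnitor hf).comp (img_leftUnitor hf).inv

end Pi2

namespace LittleIntervals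

/-- The path of labels in a single interval. -/
def pntPath (q : ℕ) : Path (pnt q 0) (pnt q 1) where
  toFun t := pnt q t
  source' := by simp
  target' := by simp
  continuous_toFun := (continuous_pnt q).comp continuous_subtype_val

end LittleIntervals

namespace LittleIntervalsAlgebra

open Pi2 LittleIntervals

variable {X : Type u} [TopologicalSpace X] {A : LittleIntervalsAlgebra X}
  {xs : ℕ → C(ℝ, X)} {i j k l n : ℕ}

section derived

variable {a a' a₂ a₃ b b' b₂ c c' : Pi2 X} {u u' u₂ u₃ : Config i j} {v v' v₂ : Config j k}
  {w w' : Config k l}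

theorem img_tR {p : Path u u'} {p' : Path u' u₂} {f : a ⟶ a'} {f' : a' ⟶ a₂}
    (hf : Lifts (A.ev xs i j) p f) (hf' : Lifts (A.ev xs i j) p' f') (hv : A.ev xs j k v = b.pt) :
    Img (A.ev xs i k) (mulPath (p.trans p') (Path.refl v))
      ((mulPath p (Path.refl v)).trans (mulPath p' (Path.refl v))) (A.data.tR f f' b).hom :=
  (img_tI (img_id (hf.trans hf')) (img_leftUnitor (lifts_id hv)).symm_iso).trans_iso
    (img_tComp hf hf' (lifts_id hv) (lifts_id hv))

theorem img_tL {p : Path v v'} {p' : Path v' v₂} {f : b ⟶ b'} {f' : b' ⟶ b₂}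
    (hu : A.ev xs i j u = a.pt) (hf : Lifts (A.ev xs j k) p f) (hf' : Lifts (A.ev xs j k) p' f') :
    Img (A.ev xs i k) (mulPath (Path.refl u) (p.trans p'))
      ((mulPath (Path.refl u) p).trans (mulPath (Path.refl u) p')) (A.data.tL a f f').hom :=
  (img_tI (img_leftUnitor (lifts_id hu)).symm_iso (img_id (hf.trans hf'))).trans_iso
    (img_tComp (lifts_id hu) (lifts_id hu) hf hf')

theorem img_tR₃ {p : Path u u'} {p' : Path u' u₂} {p'' : Path u₂ u₃} {f : a ⟶ a'} {f' : a' ⟶ a₂}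
    {f'' : a₂ ⟶ a₃} (hf : Lifts (A.ev xs i j) p f) (hf' : Lifts (A.ev xs i j) p' f')
    (hf'' : Lifts (A.ev xs i j) p'' f'') (hv : A.ev xs j k v = b.pt) :
    Img (A.ev xs i k) (mulPath (p.trans (p'.trans p'')) (Path.refl v))
      ((mulPath p (Path.refl v)).trans
        ((mulPath p' (Path.refl v)).trans (mulPath p'' (Path.refl v))))
      (A.data.tR₃ f f' f'' b).hom :=
  (img_tR hf (hf'.trans hf'') hv).trans_iso
    ((img_tR hf' hf'' hv).whiskerLeftIso (lifts_tH hf (lifts_id hv)))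

theorem img_tL₃ {v₃ : Config j k} {b₃ : Pi2 X} {p : Path v v'} {p' : Path v' v₂} {p'' : Path v₂ v₃}
    {f : b ⟶ b'} {f' : b' ⟶ b₂} {f'' : b₂ ⟶ b₃} (hu : A.ev xs i j u = a.pt)
    (hf : Lifts (A.ev xs j k) p f) (hf' : Lifts (A.ev xs j k) p' f')
    (hf'' : Lifts (A.ev xs j k) p'' f'') :
    Img (A.ev xs i k) (mulPath (Path.refl u) (p.trans (p'.trans p'')))
      ((mulPath (Path.refl u) p).trans
        ((mulPath (Path.refl u) p').trans (mulPath (Path.refl u) p'')))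
      (A.data.tL₃ a f f' f'').hom :=
  (img_tL hu hf (hf'.trans hf'')).trans_iso
    ((img_tL hu hf' hf'').whiskerLeftIso (lifts_tH (lifts_id hu) hf))

theorem img_tSq {d d' : Pi2 X} {s s' : Config i j} {t t' : Config j k} {p : Path u u'}
    {q : Path u' s'} {p₁ : Path u s} {q₁ : Path s s'} {p' : Path v v'} {q' : Path v' t'}
    {p₁' : Path v t} {q₁' : Path t t'} {f : a ⟶ b} {x : b ⟶ d} {y : a ⟶ c} {g : c ⟶ d}
    {f' : a' ⟶ b'} {x' : b' ⟶ d'} {y' : a' ⟶ c'} {g' : c' ⟶ d'} {η : f ≫ x ≅ y ≫ g}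
    {θ : f' ≫ x' ≅ y' ≫ g'} (hf : Lifts (A.ev xs i j) p f) (hx : Lifts (A.ev xs i j) q x)
    (hy : Lifts (A.ev xs i j) p₁ y) (hg : Lifts (A.ev xs i j) q₁ g)
    (hf' : Lifts (A.ev xs j k) p' f') (hx' : Lifts (A.ev xs j k) q' x')
    (hy' : Lifts (A.ev xs j k) p₁' y') (hg' : Lifts (A.ev xs j k) q₁' g')
    (hη : Img (A.ev xs i j) (p.trans q) (p₁.trans q₁) η.hom)
    (hθ : Img (A.ev xs j k) (p'.trans q') (p₁'.trans q₁') θ.hom) :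
    Img (A.ev xs i k) ((mulPath p p').trans (mulPath q q'))
      ((mulPath p₁ p₁').trans (mulPath q₁ q₁')) (A.data.tSq η θ).hom :=
  (img_tComp hf hx hf' hx').symm_iso.trans_iso
    ((img_tI hη hθ).trans_iso (img_tComp hy hg hy' hg'))

theorem img_aSq₁ {p : Path u u'} {f : a ⟶ a'} (hf : Lifts (A.ev xs i j) p f)
    (hv : A.ev xs j k v = b.pt) (hw : A.ev xs k l w = c.pt) :
    Img (A.ev xs i l) ((mulPath (mulPath p (Path.refl v)) (Path.refl w)).trans (assocLift u' v w))
      ((assocLift u v w).trans (mulPath p (Path.refl (LittleIntervals.mul v w))))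
      (A.data.aSq₁ f b c).hom := by
  have hu : A.ev xs i j u = a.pt := hf.source_eq
  exact (img_aSq hf (lifts_id hv) (lifts_id hw)).trans_iso
    ((img_tI (img_id hf) (img_tId hv hw)).whiskerLeftIso (lifts_a hu hv hw))

theorem img_aSq₂ {q : Path v v'} {f : b ⟶ b'} (hu : A.ev xs i j u = a.pt)
    (hf : Lifts (A.ev xs j k) q f) (hw : A.ev xs k l w = c.pt) :
    Img (A.ev xs i l) ((mulPath (mulPath (Path.refl u) q) (Path.refl w)).trans (assocLift u v' w))
      ((assocLift u v w).trans (mulPath (Path.refl u) (mulPath q (Path.refl w))))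
      (A.data.aSq₂ a f c).hom :=
  img_aSq (lifts_id hu) hf (lifts_id hw)

theorem img_aSq₃ {r : Path w w'} {f : c ⟶ c'} (hu : A.ev xs i j u = a.pt)
    (hv : A.ev xs j k v = b.pt) (hf : Lifts (A.ev xs k l) r f) :
    Img (A.ev xs i l) ((mulPath (Path.refl (LittleIntervals.mul u v)) r).trans (assocLift u v w'))
      ((assocLift u v w).trans (mulPath (Path.refl u) (mulPath (Path.refl v) r)))
      (A.data.aSq₃ a b f).hom := by
  have hw : A.ev xs k l w' = c'.pt := hf.target_eq
  exact (((img_tI (img_tId hu hv).symm_iso (img_id hf))).whiskerRightIso (lifts_a hu hv hw)).trans_iso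
    (img_aSq (lifts_id hu) (lifts_id hv) hf)

end derived

section naturality

/-- The sequence of curves extending four paths. -/
def curves {x x' y y' z z' w w' : X} (f : Path x x') (g : Path y y') (h : Path z z')
    (k : Path w w') : ℕ → C(ℝ, X)
  | 0 => ⟨f.extend, f.continuous_extend⟩
  | 1 => ⟨g.extend, g.continuous_extend⟩
  | 2 => ⟨h.extend, h.continuous_extend⟩
  | _ => ⟨k.extend, k.continuous_extend⟩

/-- This is the purpose of the labels: the interval stays in place while its label runs from 0 to 1
along the extended path. A 1-cell of `Π₂X` thereby lifts to a convex space, although `X` itself has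
no such structure. -/
theorem lifts_pntPath {q : ℕ} {a b : Pi2 X} {f : a ⟶ b}
    (h : ∀ t, xs q t = Path.extend (X := X) f t) :
    Lifts (A.ev xs q (q + 1)) (pntPath q) f := fun t =>
  ((A.ev_pnt xs q t).trans ((h t).trans (Path.extend_apply _ t.2))).symm

variable (A) {a a' b b' c c' d d' : Pi2 X} (f : a ⟶ a') (g : b ⟶ b') (h : c ⟶ c') (k : d ⟶ d')

/-- Four labelled intervals carry all the 1-cells and squares involved, so both pastings are images
of homotopies in `Config 0 4` with the same boundary paths. -/
theorem pi_naturality :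
    A.data.tH (A.data.tH (A.data.tH f g) h) k ◁ (A.piCell a' b' c' d').hom ≫
        (pasteSq (A.data.aSq (A.data.tH f g) h k) (A.data.aSq f g (A.data.tH h k))).hom =
      (pasteSq (A.data.tSq (A.data.aSq f g h) (idSq k))
        (pasteSq (A.data.aSq f (A.data.tH g h) k) (A.data.tSq (idSq f) (A.data.aSq g h k)))).hom ≫
        (A.piCell a b c d).hom ▷ A.data.tH f (A.data.tH g (A.data.tH h k)) := by
  let xs := curves (X := X) f g h k
  have hf := lifts_pntPath (A := A) (xs := xs) (q := 0) (f := f) fun _ => rfl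
  have hg := lifts_pntPath (A := A) (xs := xs) (q := 1) (f := g) fun _ => rfl
  have hh := lifts_pntPath (A := A) (xs := xs) (q := 2) (f := h) fun _ => rfl
  have hk := lifts_pntPath (A := A) (xs := xs) (q := 3) (f := k) fun _ => rfl
  have ha := hf.source_eq
  have hb := hg.source_eq
  have hc := hh.source_eq
  have hd := hk.source_eq
  have ha' := hf.target_eq
  have hb' := hg.target_eq
  have hc' := hh.target_eq
  have hd' := hk.target_eq
  refine Img.unique
    (((img_piCell ha' hb' hc' hd').whiskerLeft (lifts_tH (lifts_tH (lifts_tH hf hg) hh) hk)).comp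
      (Img.pasteSq (lifts_tH (lifts_tH (lifts_tH hf hg) hh) hk)
        (lifts_tH (lifts_tH hf hg) (lifts_tH hh hk)) (lifts_tH hf (lifts_tH hg (lifts_tH hh hk)))
        (lifts_a (ev_tO ha hb) hc hd) (lifts_a (ev_tO ha' hb') hc' hd')
        (lifts_a ha hb (ev_tO hc hd)) (lifts_a ha' hb' (ev_tO hc' hd'))
        (img_aSq (lifts_tH hf hg) hh hk) (img_aSq hf hg (lifts_tH hh hk))))
    (Img.comp ?_ ((img_piCell ha hb hc hd).whiskerRight
      (lifts_tH hf (lifts_tH hg (lifts_tH hh hk)))))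
  -- What remains is the pasting of the three squares that carry the source of `π` along `f`, `g`,
  -- `h`, `k`, with an identity square on the variable that each outer factor leaves alone.
  refine Img.pasteSq (lifts_tH (lifts_tH (lifts_tH hf hg) hh) hk)
    (lifts_tH (lifts_tH hf (lifts_tH hg hh)) hk) (lifts_tH hf (lifts_tH hg (lifts_tH hh hk)))
    (lifts_tH (lifts_a ha hb hc) (lifts_id hd)) (lifts_tH (lifts_a ha' hb' hc') (lifts_id hd'))
    ((lifts_a ha (ev_tO hb hc) hd).trans (lifts_tH (lifts_id ha) (lifts_a hb hc hd)))
    ((lifts_a ha' (ev_tO hb' hc') hd').trans (lifts_tH (lifts_id ha') (lifts_a hb' hc' hd')))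
    (img_tSq (lifts_tH (lifts_tH hf hg) hh) (lifts_a ha' hb' hc') (lifts_a ha hb hc)
      (lifts_tH hf (lifts_tH hg hh)) hk (lifts_id hd') (lifts_id hd) hk (img_aSq hf hg hh)
      (img_idSq hk)) ?_
  exact Img.pasteSq (lifts_tH (lifts_tH hf (lifts_tH hg hh)) hk)
    (lifts_tH hf (lifts_tH (lifts_tH hg hh) hk)) (lifts_tH hf (lifts_tH hg (lifts_tH hh hk)))
    (lifts_a ha (ev_tO hb hc) hd) (lifts_a ha' (ev_tO hb' hc') hd')
    (lifts_tH (lifts_id ha) (lifts_a hb hc hd)) (lifts_tH (lifts_id ha') (lifts_a hb' hc' hd'))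
    (img_aSq hf (lifts_tH hg hh) hk)
    (img_tSq hf (lifts_id ha') (lifts_id ha) hf (lifts_tH (lifts_tH hg hh) hk)
      (lifts_a hb' hc' hd') (lifts_a hb hc hd) (lifts_tH hg (lifts_tH hh hk)) (img_idSq hf)
      (img_aSq hg hh hk))

theorem mu_naturality :
    A.data.tH f g ◁ (A.muCell a' b').hom ≫ (idSq (A.data.tH f g)).hom =
      (pasteSq (A.data.tSq (A.data.rSq' f) (idSq g))
        (pasteSq (A.data.aSq f A.data.eH g) (A.data.tSq (idSq f) (A.data.lSq g)))).hom ≫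
        (A.muCell a b).hom ▷ A.data.tH f g := by
  -- Only the first two curves are evaluated in `Config 0 2`; the repetitions of `g` are filler.
  let xs := curves (X := X) f g g g
  have hf := lifts_pntPath (A := A) (xs := xs) (q := 0) (f := f) fun _ => rfl
  have hg := lifts_pntPath (A := A) (xs := xs) (q := 1) (f := g) fun _ => rfl
  have ha := hf.source_eq
  have hb := hg.source_eq
  have ha' := hf.target_eq
  have hb' := hg.target_eq
  have hfg := lifts_tH hf hg
  refine Img.unique (((img_muCell ha' hb').whiskerLeft hfg).comp (img_idSq hfg))
    (Img.comp ?_ ((img_muCell ha hb).whiskerRight hfg))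
  refine Img.pasteSq hfg (lifts_tH (lifts_tH hf lifts_eH) hg) hfg
    (lifts_tH (lifts_r' ha) (lifts_id hb)) (lifts_tH (lifts_r' ha') (lifts_id hb'))
    ((lifts_a ha ev_e hb).trans (lifts_tH (lifts_id ha) (lifts_l hb)))
    ((lifts_a ha' ev_e hb').trans (lifts_tH (lifts_id ha') (lifts_l hb')))
    (img_tSq hf (lifts_r' ha') (lifts_r' ha) (lifts_tH hf lifts_eH) hg (lifts_id hb') (lifts_id hb)
      hg (img_rSq' hf) (img_idSq hg)) ?_
  exact Img.pasteSq (lifts_tH (lifts_tH hf lifts_eH) hg) (lifts_tH hf (lifts_tH lifts_eH hg)) hfg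
    (lifts_a ha ev_e hb) (lifts_a ha' ev_e hb') (lifts_tH (lifts_id ha) (lifts_l hb))
    (lifts_tH (lifts_id ha') (lifts_l hb')) (img_aSq hf lifts_eH hg)
    (img_tSq hf (lifts_id ha') (lifts_id ha) hf (lifts_tH lifts_eH hg) (lifts_l hb') (lifts_l hb)
      hg (img_idSq hf) (img_lSq hg))

theorem lam_naturality :
    A.data.tH (A.data.tH A.data.eH f) g ◁ (A.lamCell a' b').hom ≫
        (pasteSq (A.data.aSq A.data.eH f g) (A.data.lSq (A.data.tH f g))).hom =
      (A.data.tSq (A.data.lSq f) (idSq g)).hom ≫ (A.lamCell a b).hom ▷ A.data.tH f g := by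
  let xs := curves (X := X) f g g g
  have hf := lifts_pntPath (A := A) (xs := xs) (q := 0) (f := f) fun _ => rfl
  have hg := lifts_pntPath (A := A) (xs := xs) (q := 1) (f := g) fun _ => rfl
  have ha := hf.source_eq
  have hb := hg.source_eq
  have ha' := hf.target_eq
  have hb' := hg.target_eq
  have hfg := lifts_tH hf hg
  exact Img.unique
    (((img_lamCell ha' hb').whiskerLeft (lifts_tH (lifts_tH lifts_eH hf) hg)).comp
      (Img.pasteSq (lifts_tH (lifts_tH lifts_eH hf) hg) (lifts_tH lifts_eH hfg) hfg
        (lifts_a ev_e ha hb) (lifts_a ev_e ha' hb') (lifts_l (ev_tO ha hb))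
        (lifts_l (ev_tO ha' hb')) (img_aSq lifts_eH hf hg) (img_lSq hfg)))
    ((img_tSq (lifts_tH lifts_eH hf) (lifts_l ha') (lifts_l ha) hf hg (lifts_id hb') (lifts_id hb)
      hg (img_lSq hf) (img_idSq hg)).comp ((img_lamCell ha hb).whiskerRight hfg))

theorem rho_naturality :
    A.data.tH f g ◁ (A.rhoCell a' b').hom ≫
        (pasteSq (A.data.rSq' (A.data.tH f g)) (A.data.aSq f g A.data.eH)).hom =
      (A.data.tSq (idSq f) (A.data.rSq' g)).hom ≫
        (A.rhoCell a b).hom ▷ A.data.tH f (A.data.tH g A.data.eH) := by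
  let xs := curves (X := X) f g g g
  have hf := lifts_pntPath (A := A) (xs := xs) (q := 0) (f := f) fun _ => rfl
  have hg := lifts_pntPath (A := A) (xs := xs) (q := 1) (f := g) fun _ => rfl
  have ha := hf.source_eq
  have hb := hg.source_eq
  have ha' := hf.target_eq
  have hb' := hg.target_eq
  have hfg := lifts_tH hf hg
  exact Img.unique
    (((img_rhoCell ha' hb').whiskerLeft hfg).comp
      (Img.pasteSq hfg (lifts_tH hfg lifts_eH) (lifts_tH hf (lifts_tH hg lifts_eH))
        (lifts_r' (ev_tO ha hb)) (lifts_r' (ev_tO ha' hb')) (lifts_a ha hb ev_e)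
        (lifts_a ha' hb' ev_e) (img_rSq' hfg) (img_aSq hf hg lifts_eH)))
    ((img_tSq hf (lifts_id ha') (lifts_id ha) hf hg (lifts_r' hb') (lifts_r' hb)
      (lifts_tH hg lifts_eH) (img_idSq hf) (img_rSq' hg)).comp ((img_rhoCell ha hb).whiskerRight
        (lifts_tH hf (lifts_tH hg lifts_eH))))

end naturality

end LittleIntervalsAlgebra

end

/-! ### The cocycle and normalization conditions. -/

noncomputable section

open CategoryTheory Bicategory
open scoped unitInterval Pseudofunctor.StrongTrans

universe u

namespace LittleIntervalsAlgebra

open Pi2 LittleIntervals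

variable {X : Type u} [TopologicalSpace X] (A : LittleIntervalsAlgebra X) (a b c d e : Pi2 X)

/-- The configurations enter the coherence arguments as arbitrary ones over the given objects: only
their positions and values under `ev` matter. Five are needed for the cocycle condition; the
normalization conditions use three and repeat an object in the rest. -/
theorem exists_points : ∃ (xs : ℕ → C(ℝ, X)) (u : Config 0 1) (v : Config 1 2) (w : Config 2 3)
    (y : Config 3 4) (z : Config 4 5), A.ev xs 0 1 u = a.pt ∧ A.ev xs 1 2 v = b.pt ∧
      A.ev xs 2 3 w = c.pt ∧ A.ev xs 3 4 y = d.pt ∧ A.ev xs 4 5 z = e.pt :=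
  ⟨fun q => .const ℝ (match q with
      | 0 => a.pt | 1 => b.pt | 2 => c.pt | 3 => d.pt | _ => e.pt),
    pnt 0 0, pnt 1 0, pnt 2 0, pnt 3 0, pnt 4 0, A.ev_pnt _ 0 0, A.ev_pnt _ 1 0, A.ev_pnt _ 2 0,
    A.ev_pnt _ 3 0, A.ev_pnt _ 4 0⟩

/-- With all associators and unitors written out, both sides are images of homotopies in `Config 0
3` with the same source and target paths. Convexity makes them equal, whatever homotopies define
`π`, `μ` and `λ`. -/
theorem left_normalization :
    𝟙 (A.data.tH (A.data.tH (A.data.r' a) (𝟙 b)) (𝟙 c) ≫ A.data.tH (A.data.a a A.data.e b) (𝟙 c) ≫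
        A.data.a a (A.data.tO A.data.e b) c ≫ A.data.tH (𝟙 a) (A.data.tH (A.data.l b) (𝟙 c))) ⊗≫
      (A.data.tH (A.data.tH (A.data.r' a) (𝟙 b)) (𝟙 c) ≫ A.data.tH (A.data.a a A.data.e b) (𝟙 c)) ◁
        (A.data.aSq₂ a (A.data.l b) c).inv ⊗≫
      ((A.data.tR₃ _ _ _ c).symm ≪≫ A.data.tI (A.muCell a b) (Iso.refl (𝟙 c)) ≪≫
        A.data.tId (A.data.tO a b) c).hom ▷ A.data.a a b c ⊗≫
      𝟙 (A.data.a a b c) =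
    𝟙 (A.data.tH (A.data.tH (A.data.r' a) (𝟙 b)) (𝟙 c) ≫ A.data.tH (A.data.a a A.data.e b) (𝟙 c) ≫
        A.data.a a (A.data.tO A.data.e b) c ≫ A.data.tH (𝟙 a) (A.data.tH (A.data.l b) (𝟙 c))) ⊗≫
      (A.data.tH (A.data.tH (A.data.r' a) (𝟙 b)) (𝟙 c) ≫ A.data.tH (A.data.a a A.data.e b) (𝟙 c) ≫
        A.data.a a (A.data.tO A.data.e b) c) ◁
        (A.data.tI (Iso.refl (𝟙 a)) (A.lamCell b c) ≪≫ A.data.tL a _ _).hom ⊗≫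
      A.data.tH (A.data.tH (A.data.r' a) (𝟙 b)) (𝟙 c) ◁ (A.piCell a A.data.e b c).hom ▷
        A.data.tH (𝟙 a) (A.data.l (A.data.tO b c)) ⊗≫
      (A.data.aSq₁ (A.data.r' a) b c).hom ▷
        (A.data.a a A.data.e (A.data.tO b c) ≫ A.data.tH (𝟙 a) (A.data.l (A.data.tO b c))) ⊗≫
      A.data.a a b c ◁ (A.muCell a (A.data.tO b c)).hom ⊗≫
      𝟙 (A.data.a a b c) := by
  obtain ⟨xs, u, v, w, -, -, ha, hb, hc, -, -⟩ := A.exists_points a b c c c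
  have h1 := lifts_id (P := A.ev xs 0 1) ha
  have h2 := lifts_id (P := A.ev xs 1 2) hb
  have h3 := lifts_id (P := A.ev xs 2 3) hc
  -- The lift of the common source fixes the initial path for both sides; the intermediate paths are
  -- then determined successively by the cells.
  have hS : Lifts (A.ev xs 0 3) _ (A.data.tH (A.data.tH (A.data.r' a) (𝟙 b)) (𝟙 c) ≫
      A.data.tH (A.data.a a A.data.e b) (𝟙 c) ≫
        A.data.a a (A.data.tO A.data.e b) c ≫ A.data.tH (𝟙 a) (A.data.tH (A.data.l b) (𝟙 c))) :=
    (lifts_tH (lifts_tH (lifts_r' ha) h2) h3).trans ((lifts_tH (lifts_a ha ev_e hb) h3).trans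
      ((lifts_a ha (ev_tO ev_e hb) hc).trans (lifts_tH h1 (lifts_tH (lifts_l hb) h3))))
  -- The coherence cells hidden in `⊗≫` are expanded into explicit associators and unitors, each of
  -- which has its own lift.
  simp only [bicategoricalComp, BicategoricalCoherence.assoc_iso, BicategoricalCoherence.assoc'_iso,
    BicategoricalCoherence.left_iso,
    BicategoricalCoherence.right_iso,
    BicategoricalCoherence.refl_iso, BicategoricalCoherence.whiskerLeft_iso,
    BicategoricalCoherence.whiskerRight_iso, Iso.trans_hom, Iso.symm_hom, Iso.refl_hom,
    whiskerLeftIso_hom, whiskerRightIso_hom]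
  -- The target path is prescribed as well: each side must be shown to end at this same lift of `a`.
  refine Img.unique (P := A.ev xs 0 3) (q := assocLift u v w) ((img_id hS).comp ?_)
    ((img_id hS).comp ?_)
  -- The shape of the 2-cell selects the lemma and unification supplies the intermediate paths.
  -- Reducible transparency keeps the cells from being unfolded past the form the lemmas recognise.
  all_goals
    repeat with_reducible first
      | assumption
      | exact ev_e
      | apply ev_tO
      | apply lifts_id
      | apply lifts_tH
      | apply lifts_a
      | apply lifts_l
      | apply lifts_r'
      | apply Lifts.trans
      | apply img_piCell
      | apply img_muCell
      | apply img_lamCell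
      | apply img_rhoCell
      | apply img_aSq₁
      | apply img_aSq₂
      | apply Img.inv (img_aSq₂ _ _ _)
      | apply Img.inv (img_aSq₃ _ _ _)
      | apply img_tR
      | apply img_tL
      | apply Img.inv (img_tR₃ _ _ _ _)
      | apply Img.inv (img_tL₃ _ _ _ _)
      | apply img_tId
      | eapply img_tI
      | apply img_associator
      | apply Img.inv (img_associator _ _ _)
      | apply img_leftUnitor
      | apply img_rightUnitor
      | apply img_id
      | apply img_isoRefl
      | eapply Img.whiskerLeft
      | eapply Img.whiskerRight
      | eapply Img.comp

/-- Again a comparison in `Config 0 3`: the empty block inserted by `r'` adds no interval, so the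
middle unit object does not enlarge the configuration space. -/
theorem right_normalization :
    𝟙 (A.data.tH (A.data.tH (𝟙 a) (A.data.r' b)) (𝟙 c) ≫ A.data.a a (A.data.tO b A.data.e) c ≫
      A.data.tH (𝟙 a) (A.data.a b A.data.e c) ≫
        A.data.tH (𝟙 a) (A.data.tH (𝟙 b) (A.data.l c))) ⊗≫
      (A.data.aSq₂ a (A.data.r' b) c).hom ▷
        (A.data.tH (𝟙 a) (A.data.a b A.data.e c) ≫ A.data.tH (𝟙 a) (A.data.tH (𝟙 b) (A.data.l c)))
          ⊗≫
      A.data.a a b c ◁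
        ((A.data.tL₃ a _ _ _).symm ≪≫ A.data.tI (Iso.refl (𝟙 a)) (A.muCell b c) ≪≫ A.data.tId a
          (A.data.tO b c)).hom ⊗≫
      𝟙 (A.data.a a b c) =
    𝟙 (A.data.tH (A.data.tH (𝟙 a) (A.data.r' b)) (𝟙 c) ≫ A.data.a a (A.data.tO b A.data.e) c ≫
      A.data.tH (𝟙 a) (A.data.a b A.data.e c) ≫
        A.data.tH (𝟙 a) (A.data.tH (𝟙 b) (A.data.l c))) ⊗≫
      (A.data.tI (A.rhoCell a b) (Iso.refl (𝟙 c)) ≪≫ A.data.tR _ _ c).hom ▷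
        (A.data.a a (A.data.tO b A.data.e) c ≫ A.data.tH (𝟙 a) (A.data.a b A.data.e c) ≫ A.data.tH
          (𝟙 a) (A.data.tH (𝟙 b) (A.data.l c))) ⊗≫
      A.data.tH (A.data.r' (A.data.tO a b)) (𝟙 c) ◁ (A.piCell a b A.data.e c).hom ▷ A.data.tH (𝟙 a)
        (A.data.tH (𝟙 b) (A.data.l c)) ⊗≫
      (A.data.tH (A.data.r' (A.data.tO a b)) (𝟙 c) ≫ A.data.a (A.data.tO a b) A.data.e c) ◁
        (A.data.aSq₃ a b (A.data.l c)).inv ⊗≫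
      (A.muCell (A.data.tO a b) c).hom ▷ A.data.a a b c ⊗≫
      𝟙 (A.data.a a b c) := by
  obtain ⟨xs, u, v, w, -, -, ha, hb, hc, -, -⟩ := A.exists_points a b c c c
  have h1 := lifts_id (P := A.ev xs 0 1) ha
  have h2 := lifts_id (P := A.ev xs 1 2) hb
  have h3 := lifts_id (P := A.ev xs 2 3) hc
  have hS := (lifts_tH (lifts_tH h1 (lifts_r' hb)) h3).trans ((lifts_a ha (ev_tO hb ev_e) hc).trans
    ((lifts_tH h1 (lifts_a hb ev_e hc)).trans (lifts_tH h1 (lifts_tH h2 (lifts_l hc)))))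
  simp only [bicategoricalComp, BicategoricalCoherence.assoc_iso, BicategoricalCoherence.assoc'_iso,
    BicategoricalCoherence.left_iso,
    BicategoricalCoherence.right_iso,
    BicategoricalCoherence.refl_iso, BicategoricalCoherence.whiskerLeft_iso,
    BicategoricalCoherence.whiskerRight_iso, Iso.trans_hom, Iso.symm_hom, Iso.refl_hom,
    whiskerLeftIso_hom, whiskerRightIso_hom]
  refine Img.unique (P := A.ev xs 0 3) (q := assocLift u v w) ((img_id hS).comp ?_)
    ((img_id hS).comp ?_)
  all_goals
    repeat with_reducible first
      | assumption
      | exact ev_e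
      | apply ev_tO
      | apply lifts_id
      | apply lifts_tH
      | apply lifts_a
      | apply lifts_l
      | apply lifts_r'
      | apply Lifts.trans
      | apply img_piCell
      | apply img_muCell
      | apply img_lamCell
      | apply img_rhoCell
      | apply img_aSq₁
      | apply img_aSq₂
      | apply Img.inv (img_aSq₂ _ _ _)
      | apply Img.inv (img_aSq₃ _ _ _)
      | apply img_tR
      | apply img_tL
      | apply Img.inv (img_tR₃ _ _ _ _)
      | apply Img.inv (img_tL₃ _ _ _ _)
      | apply img_tId
      | eapply img_tI
      | apply img_associator
      | apply Img.inv (img_associator _ _ _)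
      | apply img_leftUnitor
      | apply img_rightUnitor
      | apply img_id
      | apply img_isoRefl
      | eapply Img.whiskerLeft
      | eapply Img.whiskerRight
      | eapply Img.comp

/-- The two sides are the halves of the boundary of the associahedron on five letters: its six
pentagons are the components of `π` and its three squares the naturality cells of `a`. The sphere
they form lies over the convex space `Config 0 5`, so no explicit filling is needed. -/
theorem cocycle :
    𝟙 (A.data.tH (A.data.tH (A.data.a a b c) (𝟙 d)) (𝟙 e) ≫ A.data.tH (A.data.a a (A.data.tO b c)
      d) (𝟙 e) ≫
        A.data.tH (A.data.tH (𝟙 a) (A.data.a b c d)) (𝟙 e) ≫ A.data.a a (A.data.tO b (A.data.tO c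
          d)) e ≫
        A.data.tH (𝟙 a) (A.data.a b (A.data.tO c d) e) ≫ A.data.tH (𝟙 a) (A.data.tH (𝟙 b) (A.data.a
          c d e))) ⊗≫
      ((A.data.tR₃ _ _ _ e).symm ≪≫ A.data.tI (A.piCell a b c d) (Iso.refl (𝟙 e)) ≪≫ A.data.tR _ _
        e).hom ▷
        (A.data.a a (A.data.tO b (A.data.tO c d)) e ≫ A.data.tH (𝟙 a) (A.data.a b (A.data.tO c d)
          e) ≫
          A.data.tH (𝟙 a) (A.data.tH (𝟙 b) (A.data.a c d e))) ⊗≫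
      A.data.tH (A.data.a (A.data.tO a b) c d) (𝟙 e) ◁ (A.piCell a b (A.data.tO c d) e).hom ▷
        A.data.tH (𝟙 a) (A.data.tH (𝟙 b) (A.data.a c d e)) ⊗≫
      (A.data.tH (A.data.a (A.data.tO a b) c d) (𝟙 e) ≫ A.data.a (A.data.tO a b) (A.data.tO c d) e)
        ◁
        (A.data.aSq₃ a b (A.data.a c d e)).inv ⊗≫
      (A.piCell (A.data.tO a b) c d e).hom ▷ A.data.a a b (A.data.tO c (A.data.tO d e)) ⊗≫
      𝟙 (A.data.a (A.data.tO (A.data.tO a b) c) d e ≫ A.data.a (A.data.tO a b) c (A.data.tO d e) ≫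
        A.data.a a b (A.data.tO c (A.data.tO d e))) =
    𝟙 (A.data.tH (A.data.tH (A.data.a a b c) (𝟙 d)) (𝟙 e) ≫ A.data.tH (A.data.a a (A.data.tO b c)
      d) (𝟙 e) ≫
        A.data.tH (A.data.tH (𝟙 a) (A.data.a b c d)) (𝟙 e) ≫ A.data.a a (A.data.tO b (A.data.tO c
          d)) e ≫
        A.data.tH (𝟙 a) (A.data.a b (A.data.tO c d) e) ≫ A.data.tH (𝟙 a) (A.data.tH (𝟙 b) (A.data.a
          c d e))) ⊗≫
      (A.data.tH (A.data.tH (A.data.a a b c) (𝟙 d)) (𝟙 e) ≫ A.data.tH (A.data.a a (A.data.tO b c)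
        d) (𝟙 e)) ◁
        (A.data.aSq₂ a (A.data.a b c d) e).hom ▷
        (A.data.tH (𝟙 a) (A.data.a b (A.data.tO c d) e) ≫ A.data.tH (𝟙 a) (A.data.tH (𝟙 b)
          (A.data.a c d e))) ⊗≫
      (A.data.tH (A.data.tH (A.data.a a b c) (𝟙 d)) (𝟙 e) ≫ A.data.tH (A.data.a a (A.data.tO b c)
        d) (𝟙 e) ≫
        A.data.a a (A.data.tO (A.data.tO b c) d) e) ◁
        ((A.data.tL₃ a _ _ _).symm ≪≫ A.data.tI (Iso.refl (𝟙 a)) (A.piCell b c d e) ≪≫ A.data.tL a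
          _ _).hom ⊗≫
      A.data.tH (A.data.tH (A.data.a a b c) (𝟙 d)) (𝟙 e) ◁ (A.piCell a (A.data.tO b c) d e).hom ▷
        A.data.tH (𝟙 a) (A.data.a b c (A.data.tO d e)) ⊗≫
      (A.data.aSq₁ (A.data.a a b c) d e).hom ▷
        (A.data.a a (A.data.tO b c) (A.data.tO d e) ≫ A.data.tH (𝟙 a) (A.data.a b c (A.data.tO d
          e))) ⊗≫
      A.data.a (A.data.tO (A.data.tO a b) c) d e ◁ (A.piCell a b c (A.data.tO d e)).hom ⊗≫
      𝟙 (A.data.a (A.data.tO (A.data.tO a b) c) d e ≫ A.data.a (A.data.tO a b) c (A.data.tO d e) ≫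
        A.data.a a b (A.data.tO c (A.data.tO d e))) := by
  obtain ⟨xs, u, v, w, y, z, ha, hb, hc, hd, he⟩ := A.exists_points a b c d e
  have h1 := lifts_id (P := A.ev xs 0 1) ha
  have h2 := lifts_id (P := A.ev xs 1 2) hb
  have h4 := lifts_id (P := A.ev xs 3 4) hd
  have h5 := lifts_id (P := A.ev xs 4 5) he
  have hS := (lifts_tH (lifts_tH (lifts_a ha hb hc) h4) h5).trans
    ((lifts_tH (lifts_a ha (ev_tO hb hc) hd) h5).trans
      ((lifts_tH (lifts_tH h1 (lifts_a hb hc hd)) h5).trans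
        ((lifts_a ha (ev_tO hb (ev_tO hc hd)) he).trans
          ((lifts_tH h1 (lifts_a hb (ev_tO hc hd) he)).trans
            (lifts_tH h1 (lifts_tH h2 (lifts_a hc hd he)))))))
  simp only [bicategoricalComp, BicategoricalCoherence.assoc_iso, BicategoricalCoherence.assoc'_iso,
   
   
    BicategoricalCoherence.refl_iso, BicategoricalCoherence.whiskerLeft_iso,
    BicategoricalCoherence.whiskerRight_iso, Iso.trans_hom, Iso.symm_hom, Iso.refl_hom,
    whiskerLeftIso_hom, whiskerRightIso_hom]
  -- The common target is the lift of the three associativity 1-cells that move the brackets of the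
  -- whole product from the left to the right.
  refine Img.unique (P := A.ev xs 0 5)
    (q := (assocLift (LittleIntervals.mul (LittleIntervals.mul u v) w) y z).trans
    ((assocLift (LittleIntervals.mul u v) w (LittleIntervals.mul y z)).trans
      (assocLift u v (LittleIntervals.mul w (LittleIntervals.mul y z)))))
    ((img_id hS).comp ?_) ((img_id hS).comp ?_)
  all_goals
    repeat with_reducible first
      | assumption
      | exact ev_e
      | apply ev_tO
      | apply lifts_id
      | apply lifts_tH
      | apply lifts_a
      | apply lifts_l
      | apply lifts_r'
      | apply Lifts.trans
      | apply img_piCell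
      | apply img_muCell
      | apply img_lamCell
      | apply img_rhoCell
      | apply img_aSq₁
      | apply img_aSq₂
      | apply Img.inv (img_aSq₂ _ _ _)
      | apply Img.inv (img_aSq₃ _ _ _)
      | apply img_tR
      | apply img_tL
      | apply Img.inv (img_tR₃ _ _ _ _)
      | apply Img.inv (img_tL₃ _ _ _ _)
      | apply img_tId
      | eapply img_tI
      | apply img_associator
      | apply Img.inv (img_associator _ _ _)
      | apply img_leftUnitor
      | apply img_rightUnitor
      | apply img_id
      | apply img_isoRefl
      | eapply Img.whiskerLeft
      | eapply Img.whiskerRight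
      | eapply Img.comp

/-- The invertible modifications of the monoidal bicategory `Π₂X`. -/
def coherence : MonoidalBicategoryCoherence A.data where
  pi := A.piCell
  pi_naturality := A.pi_naturality
  mu := A.muCell
  mu_naturality := A.mu_naturality
  lam := A.lamCell
  lam_naturality := A.lam_naturality
  rho := A.rhoCell
  rho_naturality := A.rho_naturality
  cocycle := A.cocycle
  left_normalization := A.left_normalization
  right_normalization := A.right_normalization

/-- The homotopy of paths of tuples of intervals underlying a homotopy of configurations. -/
def operadHomotopy {n : ℕ} {s t : Config 0 n} {p q : Path s t} (H : Path p q) :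
    Path (p.map (continuous_ofConfig 0 n)) (q.map (continuous_ofConfig 0 n)) :=
  H.map (f := fun p => p.map (continuous_ofConfig 0 n)) (by
    rw [← Path.continuous_uncurry_iff]
    exact (continuous_ofConfig 0 n).comp (f := fun r : Path s t × I => r.1 r.2) (by fun_prop))

/-- The defining homotopies live in labelled configurations; `operadHomotopy` forgets the labels and
so provides homotopies in the operad that are independent of the points. -/
theorem induces : A.Induces ⟨A.data, A.coherence⟩ where
  tensor_eq := rfl
  unit_eq := rfl
  assoc := A.isEquivalenceOf_assoc
  leftUnit := A.isEquivalenceOf_leftUnit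
  rightUnit := A.isEquivalenceOf_rightUnit
  pi := ⟨_, _, _, _, operadHomotopy piLine, fun _ _ _ _ => A.isCell_piCell _ _ _ _⟩
  mu := ⟨_, _, _, _, operadHomotopy muLine, fun _ _ => A.isCell_muCell _ _⟩
  lam := ⟨_, _, _, _, operadHomotopy lamLine, fun _ _ => A.isCell_lamCell _ _⟩
  rho := ⟨_, _, _, _, operadHomotopy rhoLine, fun _ _ => A.isCell_rhoCell _ _⟩

end LittleIntervalsAlgebra

end

theorem mainTheorem11 {X : Type*} [TopologicalSpace X] (A : LittleIntervalsAlgebra X) :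
    ∃ M : MonoidalBicategory (Pi2 X), A.Induces M :=
  ⟨⟨A.data, A.coherence⟩, A.induces⟩
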